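/- **Model.** Let $b\ge 1$ and $m\ge 3$ be integers, $n=mb$, $c_n=3b$, and let $\xi$ be a complex random variable. The $n\times n$ periodic block band matrix $\tilde X$ with atom variable $\xi$ and bandwidth $b$ is the $m\times m$ array of $b\times b$ blocks whose block $(i,j)$ (block indices modulo $m$) is $\tilde D_j$ if $j=i$, $\tilde U_j$ if $j=i+1$, $\tilde T_j$ if $j=i-1$, and $0$ otherwise, where all entries of the blocks $\tilde D_j,\tilde U_j,\tilde T_j$ $(1\le j\le m)$ are jointly independent copies of $\xi$. Put $X=c_n^{-1/2}\tilde X$, $X_z=X-zI$ for $z\in\mathbb C$, and $$m_{n,z}(\zeta)=\frac1n\sum_{i=1}^n\frac1{\lambda_i(X_zX_z^*)-\zeta},$$ where $\lambda_i(X_zX_z^*)$ are the eigenvalues of $X_zX_z^*$. **Theorem.** For every integer $p\ge1$ there is a constant $C(p)>0$, depending only on $p$, and for every $z\in\mathbb C$ there is a (non-random) probability measure $\nu_z$ on $[0,\infty)$, depending only on $z$, with Stieltjes transform $m_z(\zeta)=\int\frac{d\nu_z(x)}{x-\zeta}$, such that the following holds. 1. Let $p\ge 1$ be an integer and let $\tilde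 X$ be as above, with $\mathbb E\,\xi=0$, $\mathbb E|\xi|^2=1$ and $\omega_{4p}:=\mathbb E|\xi|^{4p}<\infty$. Then for every $A>1$ and every $\zeta\in\mathbb C$ with $-A<\Re\zeta<A$ and $0<\Im\zeta<1$, $$\mathbb E\,|m_{n,z}(\zeta)-m_z(\zeta)|^{2p}\le\frac{C(p)\,A^p\,\omega_{4p}}{|\Im\zeta|^{8p}}\left[\Big(\frac n{c_n^2}\Big)^p+\frac1{c_n^{p/2}}\right].$$ 2. For every $\zeta\in\mathbb C\setminus[0,\infty)$, $$m_z(\zeta)=\left[\frac{|z|^2}{1+m_z(\zeta)}-(1+m_z(\zeta))\zeta\right]^{-1},$$ and $\Im(\zeta\, m_z(\zeta^2))>0$ and $\Im(m_z(\zeta))>0$ whenever $\Im\zeta>0$. Moreover $m_z$ is the unique such solution: if $\Im\zeta>0$ and $w\in\mathbb C$ satisfies $w=\big[\frac{|z|^2}{1+w}-(1+w)\zeta^2\big]^{-1}$ and $\Im(\zeta w)>0$, then $w=m_z(\zeta^2)$. -/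

import Mathlib

open MeasureTheory ProbabilityTheory
open scoped Matrix

noncomputable section

/-- The three block diagonals of a periodic block band matrix: the diagonal blocks `D`, the blocks
`U` above the diagonal and the blocks `T` below it. -/
inductive BandPart where
  | D
  | U
  | T

/-- The tri-diagonal periodic block band matrix with `m × m` blocks of size `b × b`, where
`Y s j` is the `j`-th block of the block diagonal `s`:
```
  D₁  U₂              T_m
  T₁  D₂  U₃
      T₂  D₃  ⋱
          ⋱   ⋱       U_m
  U₁       T_{m-1}    D_m
```
An index is a pair (block, position inside the block); blocks are numbered modulo `m`, so that
indices wrap around. Every block carries the number of the block column in which it stands. -/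
def periodicBlockBand {m b : ℕ} (Y : BandPart → ZMod m → Matrix (Fin b) (Fin b) ℂ) :
    Matrix (ZMod m × Fin b) (ZMod m × Fin b) ℂ :=
  Matrix.of fun r s =>
    if s.1 = r.1 then Y BandPart.D s.1 r.2 s.2
    else if s.1 = r.1 + 1 then Y BandPart.U s.1 r.2 s.2
    else if s.1 + 1 = r.1 then Y BandPart.T s.1 r.2 s.2
    else 0

/-- `Xt` is a (random) periodic block band matrix with atom variable `ξ`: all entries of all the
blocks are jointly independent copies of `ξ`. -/
def IsPeriodicBlockBand {Ω₀ Ω : Type*} [MeasurableSpace Ω₀] [MeasurableSpace Ω] {m b : ℕ}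
    (ξ : Ω₀ → ℂ) (P₀ : Measure Ω₀)
    (Xt : Ω → Matrix (ZMod m × Fin b) (ZMod m × Fin b) ℂ) (P : Measure Ω) : Prop :=
  ∃ Y : BandPart × ZMod m × Fin b × Fin b → Ω → ℂ,
    iIndepFun Y P ∧ (∀ k, IdentDistrib (Y k) ξ P P₀) ∧
      ∀ ω, Xt ω = periodicBlockBand fun s j => Matrix.of fun a c => Y (s, j, a, c) ω

/-- `X_z = X - z I` with `X = Xt / √(3 b)`. -/
def shiftedScaled {m b : ℕ} (Xt : Matrix (ZMod m × Fin b) (ZMod m × Fin b) ℂ) (z : ℂ) :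
    Matrix (ZMod m × Fin b) (ZMod m × Fin b) ℂ :=
  ((Real.sqrt (3 * b) : ℝ) : ℂ)⁻¹ • Xt - z • (1 : Matrix _ _ ℂ)

/-- `(1/n) ∑ᵢ (λᵢ(B B*) - ζ)⁻¹`, the Stieltjes transform of the empirical spectral measure of
`B B*`, for an `n × n` matrix `B`. -/
def empiricalStieltjes {ι : Type*} [Fintype ι] [DecidableEq ι] (B : Matrix ι ι ℂ) (ζ : ℂ) : ℂ :=
  (Fintype.card ι : ℂ)⁻¹ *
    ∑ i, (((Matrix.isHermitian_mul_conjTranspose_self B).eigenvalues i : ℂ) - ζ)⁻¹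

/-- The Stieltjes transform `∫ (x - ζ)⁻¹ dν(x)` of a measure on the real line. -/
def stieltjes (ν : Measure ℝ) (ζ : ℂ) : ℂ := ∫ x, ((x : ℂ) - ζ)⁻¹ ∂ν

/-- `w` solves `w = [|z|² / (1 + w) - (1 + w) ζ]⁻¹`, with both divisors nonzero. -/
def SolvesFixedPoint (z ζ w : ℂ) : Prop :=
  1 + w ≠ 0 ∧ (‖z‖ : ℂ) ^ 2 / (1 + w) - (1 + w) * ζ ≠ 0 ∧
    w = ((‖z‖ : ℂ) ^ 2 / (1 + w) - (1 + w) * ζ)⁻¹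

end

/-! Write ζ = w² with Im w > 0 and let H be the Hermitian matrix with off-diagonal blocks B = X_z
and B*. Then w m_{n,z}(w²) is the normalized trace of the upper left block of G = (H - w)⁻¹
(`empiricalStieltjes_sq_eq`). Its distance to w m_z(w²) is split into a fluctuation and a bias.

Fluctuation. Changing one column of B changes one row and column of H. By Ward's identity this moves
the diagonal of G by at most 4 / Im w in total, so bounded differences over the n columns control
moments of every order (`integral_norm_pow_sum_maskedGreen_le`).

Bias. The zero pattern is homogeneous, so all diagonal entries of G have one common mean s. The
Schur complement at the two indices of H belonging to k presents the relevant entries of G as a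
column of the inverse of a 2 × 2 matrix. That matrix contains quadratic forms in row and column k of
B whose coefficients are independent of them. The forms on its diagonal concentrate at averages of
diagonal entries of G over the c neighbours of k, hence at s; the off-diagonal ones are small. The
matrix is thus close to the one with diagonal -(w + s) and off-diagonal -z, -z̄, with mean square
error of order ω₄ n / c² for fixed w, and s almost solves s = `fixMap z w s`
(`norm_integral_maskedGreen_sub_fixMap_le`).

Stability (`norm_sub_le_of_approx`). Taking imaginary parts bounds the squared row length of the
inverse of the 2 × 2 model matrix by 1 at an approximate solution and by 1 / (1 + Im w) at an exact
one. The divided difference of the map is at most the geometric mean of the two lengths, so the map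
contracts. When Im w is below the scale of the error, s is compared with its value higher up in the
half plane and a trivial bound suffices (`norm_sub_fixed_le`).

The measure ν_z is not computed. It is a weak limit point of expected spectral measures of one
explicit family of random sign matrices with n / c² → 0, where the approximate equation becomes
exact (`exists_limit_spectral_measure`). Uniqueness is stability with zero error. The argument
yields the term (n / c²)^p alone; the term c^(-p/2) is only slack. -/

/-! ### Resolvents of Hermitian matrices: Ward identities, minors, Schur complements -/

section Green

variable {N : Type*} [DecidableEq N]

/-- The matrix `H` with the rows and columns in `P` replaced by zero. -/
def zeroOut (P : Finset N) (H : Matrix N N ℂ) : Matrix N N ℂ :=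
  Matrix.of fun i j => if i ∈ P ∨ j ∈ P then 0 else H i j

theorem isHermitian_zeroOut {H : Matrix N N ℂ} (hH : H.IsHermitian) (P : Finset N) :
    (zeroOut P H).IsHermitian := by
  ext i j
  simp only [zeroOut, Matrix.conjTranspose_apply, Matrix.of_apply]
  rw [← hH.apply i j]
  by_cases hi : i ∈ P <;> by_cases hj : j ∈ P <;> simp [hi, hj]

theorem zeroOut_insert (P : Finset N) (k : N) (H : Matrix N N ℂ) :
    zeroOut (insert k P) H = zeroOut {k} (zeroOut P H) := by
  ext i j
  simp only [zeroOut, Matrix.of_apply, Finset.mem_insert, Finset.mem_singleton]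
  by_cases hi : i ∈ P <;> by_cases hj : j ∈ P <;> simp [hi, hj]

variable [Fintype N]

/-- The resolvent `(H - w)⁻¹` of a matrix. -/
noncomputable def green (H : Matrix N N ℂ) (w : ℂ) : Matrix N N ℂ := (H - w • 1)⁻¹

/-- A kernel vector v would give v*Hv = w |v|², but the left side is real and Im w > 0. -/
theorem det_sub_smul_one_ne_zero {H : Matrix N N ℂ} (hH : H.IsHermitian) {w : ℂ} (hw : 0 < w.im) :
    (H - w • (1 : Matrix N N ℂ)).det ≠ 0 := by
  intro h0
  obtain ⟨v, hv, hv0⟩ := Matrix.exists_mulVec_eq_zero_iff.mpr h0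
  have h1 : H *ᵥ v = w • v := by
    rw [Matrix.sub_mulVec, Matrix.smul_mulVec, Matrix.one_mulVec, sub_eq_zero] at hv0
    exact hv0
  have h2 : star v ⬝ᵥ (H *ᵥ v) = w * (star v ⬝ᵥ v) := by
    rw [h1, dotProduct_smul, smul_eq_mul]
  have h3 : (star v ⬝ᵥ (H *ᵥ v)).im = 0 := by
    have := hH.im_star_dotProduct_mulVec_self v
    simpa using this
  have h4 : star v ⬝ᵥ v = ((∑ i, ‖v i‖ ^ 2 : ℝ) : ℂ) := by
    simp only [dotProduct, Pi.star_apply, RCLike.star_def, Complex.conj_mul']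
    push_cast; rfl
  rw [h2, h4, Complex.im_mul_ofReal] at h3
  have h5 : (∑ i, ‖v i‖ ^ 2 : ℝ) = 0 := by
    rcases mul_eq_zero.mp h3 with h | h
    · exact absurd h hw.ne'
    · exact h
  apply hv
  ext i
  have := (Finset.sum_eq_zero_iff_of_nonneg (fun i _ => by positivity)).mp h5 i (Finset.mem_univ i)
  simpa using this

variable {H : Matrix N N ℂ} {w : ℂ}

theorem sub_mul_green (hH : H.IsHermitian) (hw : 0 < w.im) : (H - w • 1) * green H w = 1 :=
  Matrix.mul_nonsing_inv _ (isUnit_iff_ne_zero.mpr (det_sub_smul_one_ne_zero hH hw))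

theorem green_mul_sub (hH : H.IsHermitian) (hw : 0 < w.im) : green H w * (H - w • 1) = 1 :=
  Matrix.nonsing_inv_mul _ (isUnit_iff_ne_zero.mpr (det_sub_smul_one_ne_zero hH hw))

theorem sum_mul_green (hH : H.IsHermitian) (hw : 0 < w.im) (i k : N) :
    ∑ j, H i j * green H w j k - w * green H w i k = if i = k then 1 else 0 := by
  have := congrFun (congrFun (sub_mul_green hH hw) i) k
  rw [sub_mul, Matrix.sub_apply, Matrix.smul_mul, one_mul, Matrix.smul_apply, Matrix.mul_apply,
    Matrix.one_apply] at this
  exact this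

/-- A vector solving `(H - w) v = e_k` is the `k`-th column of the resolvent. -/
theorem eq_green_of_sum_eq (hH : H.IsHermitian) (hw : 0 < w.im) (v u : N → ℂ)
    (hv : ∀ i, ∑ j, H i j * v j - w * v i = u i) (i : N) :
    v i = ∑ j, green H w i j * u j := by
  have h1 : (H - w • (1 : Matrix N N ℂ)) *ᵥ v = u := by
    ext i
    rw [Matrix.sub_mulVec, Matrix.smul_mulVec, Matrix.one_mulVec, ← hv i]
    rfl
  have h2 : v = green H w *ᵥ u := by
    rw [← h1, Matrix.mulVec_mulVec, green_mul_sub hH hw, Matrix.one_mulVec]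
  rw [h2]
  rfl

theorem green_sub_green {w' : ℂ} (hH : H.IsHermitian) (hw : 0 < w.im) (hw' : 0 < w'.im) :
    green H w - green H w' = (w - w') • (green H w * green H w') := by
  have h : green H w * ((H - w' • 1) - (H - w • 1)) * green H w' = green H w - green H w' := by
    rw [mul_sub, sub_mul, mul_assoc, sub_mul_green hH hw', green_mul_sub hH hw, mul_one, one_mul]
  rw [← h, sub_sub_sub_cancel_left, ← sub_smul, Matrix.mul_smul, Matrix.smul_mul, mul_one]

/-- Ward's identity along a column. -/
theorem sum_norm_sq_green_col (hH : H.IsHermitian) (hw : 0 < w.im) (k : N) :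
    w.im * ∑ j, ‖green H w j k‖ ^ 2 = (green H w k k).im := by
  have h1 : green H w - (green H w)ᴴ = (w - star w) • ((green H w)ᴴ * green H w) := by
    have hr : (green H w)ᴴ * (H - star w • 1) = 1 := by
      have := congrArg Matrix.conjTranspose (sub_mul_green hH hw)
      simpa [hH.eq] using this
    have h : (green H w)ᴴ * ((H - star w • 1) - (H - w • 1)) * green H w
        = green H w - (green H w)ᴴ := by
      rw [mul_sub, sub_mul, hr, mul_assoc, sub_mul_green hH hw, mul_one, one_mul]
    rw [← h, sub_sub_sub_cancel_left, ← sub_smul, Matrix.mul_smul, Matrix.smul_mul, mul_one]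
  have h2 := congrFun (congrFun h1 k) k
  rw [Matrix.sub_apply, Matrix.smul_apply, Matrix.mul_apply, Matrix.conjTranspose_apply] at h2
  have h3 : ∑ j, (green H w)ᴴ k j * green H w j k = ((∑ j, ‖green H w j k‖ ^ 2 : ℝ) : ℂ) := by
    push_cast
    refine Finset.sum_congr rfl fun j _ => ?_
    rw [Matrix.conjTranspose_apply, RCLike.star_def, Complex.conj_mul']
  rw [h3] at h2
  have h4 := congrArg Complex.im h2
  simp only [RCLike.star_def, Complex.sub_im, Complex.conj_im, smul_eq_mul,
    Complex.im_mul_ofReal] at h4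
  linarith

/-- Ward's identity along a row. -/
theorem sum_norm_sq_green_row (hH : H.IsHermitian) (hw : 0 < w.im) (k : N) :
    w.im * ∑ j, ‖green H w k j‖ ^ 2 = (green H w k k).im := by
  have h1 : green H w - (green H w)ᴴ = (w - star w) • (green H w * (green H w)ᴴ) := by
    have hr : (H - star w • 1) * (green H w)ᴴ = 1 := by
      have := congrArg Matrix.conjTranspose (green_mul_sub hH hw)
      simpa [hH.eq] using this
    have h : green H w * ((H - star w • 1) - (H - w • 1)) * (green H w)ᴴ
        = green H w - (green H w)ᴴ := by
      rw [mul_sub, sub_mul, mul_assoc, hr, green_mul_sub hH hw, mul_one, one_mul]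
    rw [← h, sub_sub_sub_cancel_left, ← sub_smul, Matrix.mul_smul, Matrix.smul_mul, mul_one]
  have h2 := congrFun (congrFun h1 k) k
  rw [Matrix.sub_apply, Matrix.smul_apply, Matrix.mul_apply, Matrix.conjTranspose_apply] at h2
  have h3 : ∑ j, green H w k j * (green H w)ᴴ j k = ((∑ j, ‖green H w k j‖ ^ 2 : ℝ) : ℂ) := by
    push_cast
    refine Finset.sum_congr rfl fun j _ => ?_
    rw [Matrix.conjTranspose_apply, RCLike.star_def, Complex.mul_conj']
  rw [h3] at h2
  have h4 := congrArg Complex.im h2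
  simp only [RCLike.star_def, Complex.sub_im, Complex.conj_im, smul_eq_mul,
    Complex.im_mul_ofReal] at h4
  linarith

theorem norm_green_diag_le (hH : H.IsHermitian) (hw : 0 < w.im) (k : N) :
    ‖green H w k k‖ ≤ 1 / w.im := by
  have h1 := sum_norm_sq_green_row hH hw k
  have h2 : ‖green H w k k‖ ^ 2 ≤ ∑ j, ‖green H w k j‖ ^ 2 :=
    Finset.single_le_sum (f := fun j => ‖green H w k j‖ ^ 2) (fun j _ => by positivity)
      (Finset.mem_univ k)
  have h3 : (green H w k k).im ≤ ‖green H w k k‖ := (le_abs_self _).trans (Complex.abs_im_le_norm _)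
  rw [le_div_iff₀ hw]
  rcases (norm_nonneg (green H w k k)).eq_or_lt with h | h
  · rw [← h]; simp
  · have : w.im * ‖green H w k k‖ ^ 2 ≤ ‖green H w k k‖ := by nlinarith
    nlinarith

theorem sum_norm_sq_green_row_le (hH : H.IsHermitian) (hw : 0 < w.im) (k : N) :
    ∑ j, ‖green H w k j‖ ^ 2 ≤ 1 / w.im ^ 2 := by
  have h1 := sum_norm_sq_green_row hH hw k
  have h3 : (green H w k k).im ≤ ‖green H w k k‖ := (le_abs_self _).trans (Complex.abs_im_le_norm _)
  have h4 := norm_green_diag_le hH hw k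
  have h5 : w.im * ∑ j, ‖green H w k j‖ ^ 2 ≤ 1 / w.im := by linarith
  rw [le_div_iff₀ hw] at h5
  rw [le_div_iff₀ (by positivity)]
  linarith

theorem norm_green_le (hH : H.IsHermitian) (hw : 0 < w.im) (k j : N) :
    ‖green H w k j‖ ≤ 1 / w.im := by
  have h2 : ‖green H w k j‖ ^ 2 ≤ ∑ j, ‖green H w k j‖ ^ 2 :=
    Finset.single_le_sum (f := fun j => ‖green H w k j‖ ^ 2) (fun j _ => by positivity)
      (Finset.mem_univ j)
  have h3 := h2.trans (sum_norm_sq_green_row_le hH hw k)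
  rw [← one_div_pow] at h3
  exact le_of_sq_le_sq h3 (by positivity)

/-- By Ward's identity a vanishing imaginary part would kill the whole k-th row of an invertible
matrix. -/
theorem im_green_diag_pos (hH : H.IsHermitian) (hw : 0 < w.im) (k : N) :
    0 < (green H w k k).im := by
  rw [← sum_norm_sq_green_row hH hw k]
  refine mul_pos hw ?_
  refine lt_of_le_of_ne (by positivity) fun h0 => ?_
  have h1 := (Finset.sum_eq_zero_iff_of_nonneg (fun i _ => by positivity)).mp h0.symm
  have h2 := congrFun (congrFun (green_mul_sub hH hw) k) k
  rw [Matrix.mul_apply, Matrix.one_apply_eq, Finset.sum_eq_zero] at h2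
  · exact zero_ne_one h2
  · intro j hj
    have := h1 j hj
    have h3 : green H w k j = 0 := by simpa using this
    rw [h3, zero_mul]

theorem green_diag_ne_zero (hH : H.IsHermitian) (hw : 0 < w.im) (k : N) : green H w k k ≠ 0 := by
  intro h
  have := im_green_diag_pos hH hw k
  simp [h] at this

/-- The resolvent after removal of one row and column. -/
theorem green_zeroOut_singleton (hH : H.IsHermitian) (hw : 0 < w.im) {k i j : N}
    (hi : i ≠ k) (hj : j ≠ k) :
    green (zeroOut {k} H) w i j
      = green H w i j - green H w i k * green H w k j / green H w k k := by
  have h0 := green_diag_ne_zero hH hw k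
  -- The candidate column is verified against the linear system of the zeroed matrix. Its entry at
  -- `k` vanishes, so the deleted row and column contribute nothing.
  have := eq_green_of_sum_eq (isHermitian_zeroOut hH {k}) hw
    (fun i => green H w i j - green H w i k * green H w k j / green H w k k)
    (fun i => if i = j then 1 else 0) ?_ i
  · rw [this]; simp
  intro l
  have hk : green H w k j - green H w k k * green H w k j / green H w k k = 0 := by
    field_simp; simp
  by_cases hl : l = k
  · subst hl
    have : ∀ x, zeroOut {l} H l x = 0 := fun x => by simp [zeroOut]
    simp [this, hk, hj.symm]
  · have h1 : ∀ x, zeroOut {k} H l x *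
        (green H w x j - green H w x k * green H w k j / green H w k k)
        = H l x * green H w x j - H l x * green H w x k * (green H w k j / green H w k k) := by
      intro x
      by_cases hx : x = k
      · subst hx
        rw [hk, mul_zero, mul_assoc, ← mul_sub, ← mul_div_assoc, hk, mul_zero]
      · simp only [zeroOut, Matrix.of_apply, Finset.mem_singleton, hl, hx, or_self, if_false]
        ring
    simp only [h1, Finset.sum_sub_distrib, ← Finset.sum_mul]
    have h2 := sum_mul_green hH hw l j
    have h3 := sum_mul_green hH hw l k
    rw [if_neg hl] at h3
    linear_combination h2 - (green H w k j / green H w k k) * h3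

/-- Each difference has size |G_jk G_kj / G_kk|. After the arithmetic-geometric mean inequality both
Ward sums produce Im G_kk / Im w, which the denominator |G_kk| absorbs. The bound does not depend on
the dimension. -/
theorem sum_norm_green_zeroOut_sub_le (hH : H.IsHermitian) (hw : 0 < w.im) (k : N) :
    ∑ j ∈ Finset.univ.erase k, ‖green (zeroOut {k} H) w j j - green H w j j‖ ≤ 1 / w.im := by
  have h0 := green_diag_ne_zero hH hw k
  have h0' : 0 < ‖green H w k k‖ := norm_pos_iff.mpr h0
  have h1 : ∀ j ∈ Finset.univ.erase k, ‖green (zeroOut {k} H) w j j - green H w j j‖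
      ≤ (‖green H w j k‖ ^ 2 + ‖green H w k j‖ ^ 2) / (2 * ‖green H w k k‖) := by
    intro j hj
    have hj' := Finset.ne_of_mem_erase hj
    rw [green_zeroOut_singleton hH hw hj' hj', sub_sub_cancel_left, norm_neg, norm_div, norm_mul,
      div_le_div_iff₀ h0' (by positivity)]
    have := two_mul_le_add_sq ‖green H w j k‖ ‖green H w k j‖
    nlinarith
  refine (Finset.sum_le_sum h1).trans ?_
  refine (Finset.sum_le_sum_of_subset_of_nonneg (Finset.erase_subset _ _)
    (fun j _ _ => by positivity)).trans ?_
  rw [← Finset.sum_div, Finset.sum_add_distrib, div_le_div_iff₀ (by positivity) hw, add_mul,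
    mul_comm _ w.im, mul_comm _ w.im, sum_norm_sq_green_row hH hw, sum_norm_sq_green_col hH hw]
  have h3 : (green H w k k).im ≤ ‖green H w k k‖ := (le_abs_self _).trans (Complex.abs_im_le_norm _)
  linarith

/-- The Schur complement formula: the block of the resolvent with indices in `P` is inverted by
the Schur complement. -/
theorem schur_complement (hH : H.IsHermitian) (hw : 0 < w.im) (P : Finset N) {p a : N}
    (hp : p ∈ P) (ha : a ∈ P) :
    ∑ l ∈ P, (H p l - (if p = l then w else 0)
      - ∑ i ∈ Pᶜ, ∑ j ∈ Pᶜ, H p i * green (zeroOut P H) w i j * H j l) * green H w l a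
      = if p = a then 1 else 0 := by
  -- Outside `P`, the column of the resolvent solves the system of the zeroed matrix with source -∑
  -- H_il G_la over l in `P`; so it is the zeroed resolvent applied to that source.
  have hQ : ∀ i ∈ Pᶜ, green H w i a
      = - ∑ j ∈ Pᶜ, green (zeroOut P H) w i j * ∑ l ∈ P, H j l * green H w l a := by
    intro i hi
    have := eq_green_of_sum_eq (isHermitian_zeroOut hH P) hw
      (fun i => if i ∈ P then 0 else green H w i a)
      (fun i => if i ∈ P then 0 else - ∑ l ∈ P, H i l * green H w l a) ?_ i
    · rw [Finset.mem_compl] at hi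
      rw [if_neg hi] at this
      rw [this, ← Finset.sum_add_sum_compl P]
      rw [Finset.sum_eq_zero (s := P) (fun j hj => by simp [hj]), zero_add, ← Finset.sum_neg_distrib]
      refine Finset.sum_congr rfl fun j hj => ?_
      rw [Finset.mem_compl] at hj
      rw [if_neg hj]; ring
    intro l
    by_cases hl : l ∈ P
    · simp [zeroOut, hl]
    · rw [if_neg hl, if_neg hl, ← Finset.sum_add_sum_compl P,
        Finset.sum_eq_zero (s := P) (fun j hj => by simp [hj]), zero_add]
      have h1 := sum_mul_green hH hw l a
      rw [if_neg (fun h : l = a => hl (h ▸ ha)), ← Finset.sum_add_sum_compl P] at h1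
      have h2 : ∑ j ∈ Pᶜ, zeroOut P H l j * (if j ∈ P then 0 else green H w j a)
          = ∑ j ∈ Pᶜ, H l j * green H w j a := by
        refine Finset.sum_congr rfl fun j hj => ?_
        rw [Finset.mem_compl] at hj
        simp [zeroOut, hl, hj]
      rw [h2]
      linear_combination h1
  have h1 := sum_mul_green hH hw p a
  rw [← Finset.sum_add_sum_compl P, Finset.sum_congr (rfl : Pᶜ = Pᶜ)
    (fun i hi => by rw [hQ i hi])] at h1
  rw [← h1]
  simp only [sub_mul, Finset.sum_sub_distrib, ite_mul, zero_mul, Finset.sum_ite_eq, hp, if_true]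
  have h2 : ∑ x ∈ P, (∑ i ∈ Pᶜ, ∑ j ∈ Pᶜ, H p i * green (zeroOut P H) w i j * H j x) * green H w x a
      = ∑ i ∈ Pᶜ, H p i * ∑ j ∈ Pᶜ, green (zeroOut P H) w i j * ∑ l ∈ P, H j l * green H w l a := by
    simp only [Finset.sum_mul, Finset.mul_sum]
    rw [Finset.sum_comm]
    refine Finset.sum_congr rfl fun i _ => ?_
    rw [Finset.sum_comm]
    refine Finset.sum_congr rfl fun j _ => Finset.sum_congr rfl fun x _ => by ring
  rw [h2]
  simp only [mul_neg, Finset.sum_neg_distrib]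
  ring

theorem continuous_green {X : Type*} [TopologicalSpace X] {F : X → Matrix N N ℂ}
    (hF : Continuous F) (hH : ∀ x, (F x).IsHermitian) (hw : 0 < w.im) (i j : N) :
    Continuous fun x => green (F x) w i j := by
  have h1 : Continuous fun x => F x - w • (1 : Matrix N N ℂ) := hF.sub continuous_const
  have h2 : (fun x => green (F x) w i j) = fun x =>
      ((F x - w • (1 : Matrix N N ℂ)).det)⁻¹ * (F x - w • (1 : Matrix N N ℂ)).adjugate i j := by
    ext x
    rw [green, Matrix.inv_def, Ring.inverse_eq_inv', Matrix.smul_apply, smul_eq_mul]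
  rw [h2]
  exact (h1.matrix_det.inv₀ fun x => det_sub_smul_one_ne_zero (hH x) hw).mul
    (h1.matrix_adjugate.matrix_elem i j)

end Green

/-! ### The limiting fixed point equation and its stability -/

section FixedPoint

/-- The map whose fixed point in the upper half plane is the limiting Stieltjes transform of the
Hermitization. -/
noncomputable def fixMap (z w s : ℂ) : ℂ := -(w + s) / ((w + s) ^ 2 - (‖z‖ : ℂ) ^ 2)

/-- The squared length of a row of the `2 × 2` matrix with entries `-(w + s)`, `-z`, inverted. -/
noncomputable def rowSq (z w s : ℂ) : ℝ :=
  (‖w + s‖ ^ 2 + ‖z‖ ^ 2) / ‖(w + s) ^ 2 - (‖z‖ : ℂ) ^ 2‖ ^ 2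

theorem sq_sub_norm_sq_ne_zero {u : ℂ} (hu : 0 < u.im) (z : ℂ) : u ^ 2 - (‖z‖ : ℂ) ^ 2 ≠ 0 := by
  rw [sq_sub_sq]
  refine mul_ne_zero (fun h => ?_) (fun h => ?_)
  · have := congrArg Complex.im h
    simp at this; linarith
  · have := congrArg Complex.im h
    simp at this; linarith

variable {z w s t : ℂ}

theorem rowSq_nonneg : 0 ≤ rowSq z w s := by unfold rowSq; positivity

/-- Ward's identity for the 2 × 2 model: `fixMap` is a diagonal entry of the inverse of the matrix
with rows -(w + s), -z and -z̄, -(w + s), and `rowSq` is the squared length of its row. -/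
theorem im_fixMap (h : 0 < (w + s).im) : (fixMap z w s).im = (w + s).im * rowSq z w s := by
  have hD := sq_sub_norm_sq_ne_zero h z
  unfold fixMap rowSq
  generalize w + s = u at *
  have h1 : ‖u ^ 2 - (‖z‖ : ℂ) ^ 2‖ ^ 2 = Complex.normSq (u ^ 2 - (‖z‖ : ℂ) ^ 2) :=
    (Complex.normSq_eq_norm_sq _).symm
  have h2 : ‖u‖ ^ 2 = u.re ^ 2 + u.im ^ 2 := by
    rw [← Complex.normSq_eq_norm_sq, Complex.normSq_apply]; ring
  have h3 : Complex.normSq (u ^ 2 - (‖z‖ : ℂ) ^ 2) ≠ 0 := by simpa using hD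
  rw [Complex.div_im, h1, h2, mul_div_assoc', ← sub_div, div_eq_div_iff h3 h3]
  simp only [← Complex.ofReal_pow, Complex.sub_re, Complex.sub_im, Complex.ofReal_re,
    Complex.ofReal_im, Complex.neg_re, Complex.neg_im, pow_two u, Complex.mul_re, Complex.mul_im]
  ring

theorem norm_fixMap_sq_le : ‖fixMap z w s‖ ^ 2 ≤ rowSq z w s := by
  unfold fixMap rowSq
  rw [norm_div, div_pow, norm_neg]
  gcongr
  have := sq_nonneg ‖z‖
  linarith

/-- An approximate fixed point has short rows. -/
theorem rowSq_le_of_approx {F : ℝ} (hw : 0 < w.im) (hs : 0 < s.im)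
    (hF : ‖s - fixMap z w s‖ ≤ rowSq z w s * F) (hFw : F ≤ w.im) : rowSq z w s ≤ 1 := by
  have hu : 0 < (w + s).im := by rw [Complex.add_im]; linarith
  have h1 := im_fixMap (z := z) hu
  have h2 : (fixMap z w s - s).im ≤ ‖s - fixMap z w s‖ := by
    rw [norm_sub_rev]
    exact (le_abs_self _).trans (Complex.abs_im_le_norm _)
  rw [Complex.sub_im, h1, Complex.add_im] at h2
  -- With q the squared row length, comparison of imaginary parts reads (Im w + Im s) q - Im s ≤ q F
  -- ≤ q Im w, hence q Im s ≤ Im s. The error must be relative to q for this cancellation.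
  have h3 := rowSq_nonneg (z := z) (w := w) (s := s)
  by_contra! h
  nlinarith

theorem norm_sub_fixMap_le_of_approx {F : ℝ} (hw : 0 < w.im) (hs : 0 < s.im) (hF0 : 0 ≤ F)
    (hF : ‖s - fixMap z w s‖ ≤ rowSq z w s * F) (hFw : F ≤ w.im) :
    ‖s - fixMap z w s‖ ≤ F := by
  have := rowSq_le_of_approx hw hs hF hFw
  nlinarith

theorem norm_le_of_approx {F : ℝ} (hw : 0 < w.im) (hs : 0 < s.im) (hF0 : 0 ≤ F)
    (hF : ‖s - fixMap z w s‖ ≤ rowSq z w s * F) (hFw : F ≤ w.im) : ‖s‖ ≤ 1 + F := by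
  have h1 := rowSq_le_of_approx hw hs hF hFw
  have h2 := norm_sub_fixMap_le_of_approx hw hs hF0 hF hFw
  have h3 := norm_fixMap_sq_le (z := z) (w := w) (s := s)
  have h4 : ‖fixMap z w s‖ ≤ 1 := by
    have : ‖fixMap z w s‖ ^ 2 ≤ 1 ^ 2 := by linarith
    exact le_of_sq_le_sq this zero_le_one
  have h5 : ‖s‖ ≤ ‖s - fixMap z w s‖ + ‖fixMap z w s‖ := by
    simpa using norm_add_le (s - fixMap z w s) (fixMap z w s)
  linarith

theorem rowSq_eq_of_fixed (hw : 0 < w.im) (hs : 0 < s.im) (h : s = fixMap z w s) :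
    (w.im + s.im) * rowSq z w s = s.im := by
  have hu : 0 < (w + s).im := by rw [Complex.add_im]; linarith
  have h1 := im_fixMap (z := z) hu
  rw [← h, Complex.add_im] at h1
  exact h1.symm

theorem norm_le_one_of_fixed (hw : 0 < w.im) (hs : 0 < s.im) (h : s = fixMap z w s) :
    ‖s‖ ≤ 1 := by
  have := norm_le_of_approx (F := 0) hw hs le_rfl (by rw [← h]; simp) hw.le
  linarith

/-- At a fixed point the row length is exactly Im s / (Im w + Im s), which increases in Im s, and Im
s ≤ |s| ≤ 1. This strict gap below 1 is what makes the map a contraction. -/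
theorem rowSq_le_of_fixed (hw : 0 < w.im) (hs : 0 < s.im) (h : s = fixMap z w s) :
    rowSq z w s ≤ 1 / (1 + w.im) := by
  have h1 := rowSq_eq_of_fixed hw hs h
  have h2 := norm_le_one_of_fixed hw hs h
  have h3 : s.im ≤ ‖s‖ := (le_abs_self _).trans (Complex.abs_im_le_norm _)
  rw [le_div_iff₀ (by linarith)]
  have h4 := rowSq_nonneg (z := z) (w := w) (s := s)
  have h5 : rowSq z w s ≤ 1 := by
    by_contra! hc
    nlinarith
  nlinarith

/-- Stability of the fixed point equation. -/
theorem norm_sub_le_of_approx {F : ℝ} (hw : 0 < w.im) (hs : 0 < s.im) (hF0 : 0 ≤ F)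
    (hF : ‖s - fixMap z w s‖ ≤ rowSq z w s * F) (hFw : F ≤ w.im)
    (ht : 0 < t.im) (h : t = fixMap z w t) : ‖s - t‖ ≤ 2 * F * (1 + 1 / w.im) := by
  have hu : 0 < (w + s).im := by rw [Complex.add_im]; linarith
  have hv : 0 < (w + t).im := by rw [Complex.add_im]; linarith
  have hD := sq_sub_norm_sq_ne_zero hu z
  have hE := sq_sub_norm_sq_ne_zero hv z
  have hD' := norm_pos_iff.mpr hD
  have hE' := norm_pos_iff.mpr hE
  -- The divided difference of `fixMap` between s and t.
  set T : ℂ := ((w + s) * (w + t) + (‖z‖ : ℂ) ^ 2) /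
    (((w + s) ^ 2 - (‖z‖ : ℂ) ^ 2) * ((w + t) ^ 2 - (‖z‖ : ℂ) ^ 2)) with hT
  have h1 : fixMap z w s - fixMap z w t = (s - t) * T := by
    unfold fixMap
    rw [hT, div_sub_div _ _ hD hE, mul_div_assoc']
    congr 1
    ring
  -- Cauchy–Schwarz for the vectors (|w + s|, |z|) and (|w + t|, |z|).
  have h2 : ‖T‖ ^ 2 ≤ rowSq z w s * rowSq z w t := by
    rw [hT, norm_div, norm_mul, div_pow, mul_pow, rowSq, rowSq, div_mul_div_comm]
    gcongr
    have h3 : ‖(w + s) * (w + t) + (‖z‖ : ℂ) ^ 2‖ ≤ ‖w + s‖ * ‖w + t‖ + ‖z‖ ^ 2 := by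
      refine (norm_add_le _ _).trans ?_
      rw [norm_mul, norm_pow, Complex.norm_real, norm_norm]
    calc _ ≤ (‖w + s‖ * ‖w + t‖ + ‖z‖ ^ 2) ^ 2 := by gcongr
      _ ≤ _ := by nlinarith [sq_nonneg (‖w + s‖ * ‖z‖ - ‖w + t‖ * ‖z‖)]
  have hq := rowSq_le_of_approx hw hs hF hFw
  have hq0 := rowSq_le_of_fixed hw ht h
  have hT2 : ‖T‖ ^ 2 ≤ 1 / (1 + w.im) := by
    have := rowSq_nonneg (z := z) (w := w) (s := t)
    nlinarith
  have herr := norm_sub_fixMap_le_of_approx hw hs hF0 hF hFw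
  have h4 : ‖s - t‖ ≤ F + ‖s - t‖ * ‖T‖ := by
    have : s - t = (s - fixMap z w s) + (s - t) * T := by
      rw [← h1, ← h]; ring
    calc ‖s - t‖ = ‖(s - fixMap z w s) + (s - t) * T‖ := by rw [← this]
      _ ≤ ‖s - fixMap z w s‖ + ‖(s - t) * T‖ := norm_add_le _ _
      _ ≤ _ := by rw [norm_mul]; gcongr
  have h5 : ‖T‖ < 1 := by
    have : ‖T‖ ^ 2 < 1 ^ 2 := by
      refine hT2.trans_lt ?_
      rw [div_lt_iff₀ (by linarith)]; linarith
    exact lt_of_pow_lt_pow_left₀ 2 zero_le_one this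
  rw [le_div_iff₀ (by linarith)] at hT2
  -- From (1 + Im w) |T|² ≤ 1 one has Im w ≤ (1 + Im w)(1 - |T|)(1 + |T|), and 1 + |T| ≤ 2.
  have h6 : w.im ≤ 2 * (1 + w.im) * (1 - ‖T‖) := by
    have h0 := norm_nonneg T
    nlinarith [mul_nonneg (by linarith : (0:ℝ) ≤ 1 + w.im) (sq_nonneg (1 - ‖T‖))]
  have h7 : ‖s - t‖ * w.im ≤ 2 * F * (1 + w.im) := by
    have h0 := norm_nonneg (s - t)
    have : ‖s - t‖ * (1 - ‖T‖) ≤ F := by linarith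
    nlinarith
  have h8 : 1 + 1 / w.im = (1 + w.im) / w.im := by field_simp; ring
  rw [h8, mul_div_assoc', le_div_iff₀ hw]
  exact h7

theorem fixed_unique (hw : 0 < w.im) (hs : 0 < s.im) (ht : 0 < t.im) (h : s = fixMap z w s)
    (h' : t = fixMap z w t) : s = t := by
  have := norm_sub_le_of_approx (F := 0) hw hs le_rfl (by rw [← h]; simp) hw.le ht h'
  rw [mul_zero, zero_mul] at this
  exact sub_eq_zero.mp (norm_le_zero_iff.mp this)

/-- In the variable `w * m`, the equation is the fixed point equation of the Hermitization. -/
theorem solvesFixedPoint_iff {m : ℂ} (hw : 0 < w.im) (hm : 0 < (w * m).im) :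
    SolvesFixedPoint z (w ^ 2) m ↔ w * m = fixMap z w (w * m) := by
  have hu : 0 < (w + w * m).im := by rw [Complex.add_im]; linarith
  have hD := sq_sub_norm_sq_ne_zero hu z
  have hw0 : w ≠ 0 := fun h => by simp [h] at hw
  have hu0 : w + w * m ≠ 0 := fun h => by simp [h] at hu
  have h1 : 1 + m ≠ 0 := fun h => hu0 (by linear_combination w * h)
  have h2 : (‖z‖ : ℂ) ^ 2 / (1 + m) - (1 + m) * w ^ 2
      = -((w + w * m) ^ 2 - (‖z‖ : ℂ) ^ 2) / (1 + m) := by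
    field_simp; ring
  have h3 : (‖z‖ : ℂ) ^ 2 / (1 + m) - (1 + m) * w ^ 2 ≠ 0 := by
    rw [h2]; exact div_ne_zero (neg_ne_zero.mpr hD) h1
  unfold SolvesFixedPoint fixMap
  simp only [ne_eq, h1, not_false_eq_true, h3, true_and]
  rw [h2, inv_div, div_neg, neg_div, eq_neg_iff_add_eq_zero, eq_neg_iff_add_eq_zero]
  constructor
  · intro h
    rw [← mul_zero w, ← h]; ring
  · intro h
    apply mul_left_cancel₀ hw0
    rw [mul_zero, ← h]; ring

end FixedPoint

/-! ### Conditioning in a product space by resampling coordinates -/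

section Resample

variable {I E : Type*} [Fintype I] [DecidableEq I] [MeasurableSpace E] (μ : Measure E)
  [IsProbabilityMeasure μ]

omit [Fintype I] in
theorem measurable_finset_piecewise (T : Finset I) :
    Measurable fun q : (I → E) × (I → E) => T.piecewise q.2 q.1 := by
  refine measurable_pi_lambda _ fun i => ?_
  by_cases hi : i ∈ T
  · simp only [Finset.piecewise, hi, if_true]; fun_prop
  · simp only [Finset.piecewise, hi, if_false]; fun_prop

/-- Replacing the coordinates in `T` by independent copies preserves the product measure. -/
theorem measurePreserving_piecewise (T : Finset I) :
    MeasurePreserving (fun q : (I → E) × (I → E) => T.piecewise q.2 q.1)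
      ((Measure.pi fun _ : I => μ).prod (Measure.pi fun _ : I => μ)) (Measure.pi fun _ : I => μ) := by
  refine ⟨measurable_finset_piecewise T, ?_⟩
  symm
  refine Measure.pi_eq fun s hs => ?_
  rw [Measure.map_apply (measurable_finset_piecewise T) (MeasurableSet.univ_pi hs)]
  have h : (fun q : (I → E) × (I → E) => T.piecewise q.2 q.1) ⁻¹' Set.pi Set.univ s
      = (Set.pi Set.univ fun i => if i ∈ T then Set.univ else s i) ×ˢ
        (Set.pi Set.univ fun i => if i ∈ T then s i else Set.univ) := by
    ext q
    simp only [Set.mem_preimage, Set.mem_pi, Set.mem_univ, true_implies, Set.mem_prod]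
    constructor
    · intro h
      refine ⟨fun i => ?_, fun i => ?_⟩ <;> have := h i <;> by_cases hi : i ∈ T <;>
        simp_all [Finset.piecewise]
    · rintro ⟨h1, h2⟩ i
      have := h1 i
      have := h2 i
      by_cases hi : i ∈ T <;> simp_all [Finset.piecewise]
  rw [h, Measure.prod_prod, Measure.pi_pi, Measure.pi_pi, ← Finset.prod_mul_distrib]
  refine Finset.prod_congr rfl fun i _ => ?_
  by_cases hi : i ∈ T <;> simp [hi]

variable {μ}
variable {G : Type*} [NormedAddCommGroup G]

theorem integrable_resample (T : Finset I) {F : (I → E) → G}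
    (hF : Integrable F (Measure.pi fun _ : I => μ)) :
    Integrable (fun q : (I → E) × (I → E) => F (T.piecewise q.2 q.1))
      ((Measure.pi fun _ : I => μ).prod (Measure.pi fun _ : I => μ)) :=
  (measurePreserving_piecewise μ T).integrable_comp_of_integrable hF

variable [NormedSpace ℝ G]

/-- Fubini in place of conditional expectation: the inner integral averages over the coordinates in
`T` with the others frozen. The second copy is a full array, of which only the part in `T` is read.
-/
theorem integral_resample (T : Finset I) {F : (I → E) → G}
    (hF : Integrable F (Measure.pi fun _ : I => μ)) :
    ∫ x, F x ∂(Measure.pi fun _ : I => μ) = ∫ x, ∫ y, F (T.piecewise y x)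
      ∂(Measure.pi fun _ : I => μ) ∂(Measure.pi fun _ : I => μ) := by
  have h := measurePreserving_piecewise μ T
  rw [← integral_prod _ (integrable_resample T hF),
    ← integral_map (φ := fun q : (I → E) × (I → E) => T.piecewise q.2 q.1) (f := F)
      h.measurable.aemeasurable (by rw [h.map_eq]; exact hF.1), h.map_eq]

omit [DecidableEq I] in
theorem integral_eval {g : E → G} (hg : StronglyMeasurable g) (i : I) :
    ∫ x, g (x i) ∂(Measure.pi fun _ : I => μ) = ∫ t, g t ∂μ := by
  have h := measurePreserving_eval (fun _ : I => μ) i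
  rw [← integral_map (φ := Function.eval i) (f := g) h.measurable.aemeasurable
    hg.aestronglyMeasurable, h.map_eq]

theorem integral_eq_zero_of_update (i : I) {F : (I → E) → ℂ} (hm : Measurable F)
    (hF : ∀ x, ∫ t, F (Function.update x i t) ∂μ = 0) :
    ∫ x, F x ∂(Measure.pi fun _ : I => μ) = 0 := by
  by_cases hi : Integrable F (Measure.pi fun _ : I => μ)
  · rw [integral_resample {i} hi]
    refine integral_eq_zero_of_ae (Filter.Eventually.of_forall fun x => ?_)
    simp only [Finset.piecewise_singleton, Pi.zero_apply]
    rw [integral_eval (g := fun t => F (Function.update x i t))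
      (hm.comp (measurable_update x)).stronglyMeasurable i]
    exact hF x
  -- Without integrability the Bochner integral is 0 by convention, so the claim still holds.
  · exact integral_undef hi

end Resample

/-! ### Concentration by bounded differences -/

section BoundedDifference

variable {I J E : Type*} [Fintype I] [DecidableEq I] [DecidableEq J] [MeasurableSpace E]
  {μ : Measure E} [IsProbabilityMeasure μ]

theorem integrable_of_bounded {X G : Type*} [MeasurableSpace X] [NormedAddCommGroup G]
    {P : Measure X} [IsFiniteMeasure P] {f : X → G}
    (hf : AEStronglyMeasurable f P) {M : ℝ} (hM : ∀ x, ‖f x‖ ≤ M) : Integrable f P :=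
  Integrable.of_bound hf M (Filter.Eventually.of_forall hM)

/-- Hoeffding's lemma on [-c, c], whose squared half-length c² is the variance proxy. -/
theorem integral_exp_le_of_centered {X : Type*} [MeasurableSpace X] {P : Measure X}
    [IsProbabilityMeasure P] {f : X → ℝ} (hf : Measurable f) {c : ℝ}
    (hc : ∀ x, |f x - ∫ y, f y ∂P| ≤ c) (hi : Integrable f P) (l : ℝ) :
    ∫ x, Real.exp (l * (f x - ∫ y, f y ∂P)) ∂P ≤ Real.exp (l ^ 2 * c ^ 2 / 2) := by
  have h := hasSubgaussianMGF_of_mem_Icc_of_integral_eq_zero (μ := P)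
    (X := fun x => f x - ∫ y, f y ∂P) (a := -c) (b := c) (hf.sub_const _).aemeasurable
    (Filter.Eventually.of_forall fun x => abs_le.mp (hc x))
    (by rw [integral_sub hi (integrable_const _)]; simp)
  have h1 := h.mgf_le l
  rw [mgf] at h1
  refine h1.trans_eq ?_
  congr 2
  push_cast
  rw [Real.norm_eq_abs, div_pow, sq_abs]
  ring

/-- The bounded difference inequality for the moment generating function. The coordinates are
grouped by `col`; changing one group changes `f` by at most `c`. -/
theorem integral_exp_le_of_bounded_difference (col : I → J) {c : ℝ} (l : ℝ) (S : Finset J) :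
    ∀ f : (I → E) → ℝ, Measurable f → (∃ M, ∀ x, |f x| ≤ M) →
      (∀ j x y, (∀ i, col i ≠ j → x i = y i) → |f x - f y| ≤ c) →
      (∀ x y, (∀ i, col i ∈ S → x i = y i) → f x = f y) →
      ∫ x, Real.exp (l * (f x - ∫ y, f y ∂(Measure.pi fun _ : I => μ)))
        ∂(Measure.pi fun _ : I => μ) ≤ Real.exp (S.card * (l ^ 2 * c ^ 2 / 2)) := by
  induction S using Finset.induction_on with
  | empty =>
    intro f _ _ _ h
    have : ∀ x y, f x = f y := fun x y => h x y (by simp)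
    have h1 : ∀ x, f x - ∫ y, f y ∂(Measure.pi fun _ : I => μ) = 0 := by
      intro x
      have : (fun y => f y) = fun _ => f x := funext fun y => this y x
      rw [this]; simp
    simp [h1]
  | insert j S hj ih =>
    intro f hm ⟨M, hM⟩ hd hS
    set π := Measure.pi fun _ : I => μ with hπ
    have hint : ∀ {g : (I → E) → ℝ}, Measurable g → ∀ {K : ℝ}, (∀ x, |g x| ≤ K) → Integrable g π :=
      fun hg K hK => integrable_of_bounded hg.aestronglyMeasurable hK
    set T : Finset I := Finset.univ.filter fun i => col i = j with hT
    -- The martingale step: `h` averages out group `j`. It keeps the difference bounds and depends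
    -- only on the groups in `S`, while given the other groups f - h is centered and bounded by c.
    set h : (I → E) → ℝ := fun x => ∫ y, f (T.piecewise y x) ∂π with hh
    have hmp := measurable_finset_piecewise (E := E) T
    have hpw : ∀ x, Measurable fun y : I → E => f (T.piecewise y x) := fun x =>
      hm.comp (hmp.comp (measurable_const.prodMk measurable_id))
    have hpi : ∀ x, Integrable (fun y : I → E => f (T.piecewise y x)) π := fun x =>
      hint (hpw x) (fun y => hM _)
    have h1 : Measurable h :=
      (StronglyMeasurable.integral_prod_right' (ν := π)
        (hm.comp hmp).stronglyMeasurable).measurable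
    have h2 : ∀ x, |h x| ≤ M := fun x => by
      have := norm_integral_le_of_norm_le_const (μ := π)
        (f := fun y => f (T.piecewise y x)) (Filter.Eventually.of_forall fun y => hM _)
      simpa using this
    have h3 : ∀ j' x y, (∀ i, col i ≠ j' → x i = y i) → |h x - h y| ≤ c := by
      intro j' x y hxy
      rw [hh]
      simp only
      rw [← integral_sub (hpi x) (hpi y)]
      have := norm_integral_le_of_norm_le_const (μ := π) (C := c)
        (f := fun t => f (T.piecewise t x) - f (T.piecewise t y))
        (Filter.Eventually.of_forall fun t => hd j' _ _ fun i hi => by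
          by_cases hiT : i ∈ T <;> simp [Finset.piecewise, hiT, hxy i hi])
      simpa using this
    have h4 : ∀ x y, (∀ i, col i ∈ S → x i = y i) → h x = h y := by
      intro x y hxy
      refine integral_congr_ae (Filter.Eventually.of_forall fun t => hS _ _ fun i hi => ?_)
      by_cases hiT : i ∈ T
      · simp [Finset.piecewise, hiT]
      · have : col i ∈ S := by
          rcases Finset.mem_insert.mp hi with h | h
          · exact absurd (by simp [hT, h]) hiT
          · exact h
        simp [Finset.piecewise, hiT, hxy i this]
    have h5 : ∫ y, h y ∂π = ∫ y, f y ∂π := (integral_resample T (hint hm hM)).symm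
    have key := ih h h1 ⟨M, h2⟩ h3 h4
    rw [h5] at key
    have hexp : Integrable (fun x => Real.exp (l * (f x - ∫ y, f y ∂π))) π := by
      refine hint (K := Real.exp (|l| * (M + M))) (by fun_prop) fun x => ?_
      rw [Real.abs_exp, Real.exp_le_exp]
      refine (le_abs_self _).trans ?_
      rw [abs_mul]
      gcongr
      refine (abs_sub _ _).trans (add_le_add (hM x) ?_)
      have := norm_integral_le_of_norm_le_const (μ := π) (f := f) (Filter.Eventually.of_forall hM)
      simpa using this
    have hexp2 : Integrable (fun x => Real.exp (l * (h x - ∫ y, f y ∂π))) π := by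
      refine hint (K := Real.exp (|l| * (M + M))) (by fun_prop) fun x => ?_
      rw [Real.abs_exp, Real.exp_le_exp]
      refine (le_abs_self _).trans ?_
      rw [abs_mul]
      gcongr
      refine (abs_sub _ _).trans (add_le_add (h2 x) ?_)
      have := norm_integral_le_of_norm_le_const (μ := π) (f := f) (Filter.Eventually.of_forall hM)
      simpa using this
    have hin : ∀ x, ∫ y, Real.exp (l * (f (T.piecewise y x) - ∫ y, f y ∂π)) ∂π
        ≤ Real.exp (l ^ 2 * c ^ 2 / 2) * Real.exp (l * (h x - ∫ y, f y ∂π)) := by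
      intro x
      have h6 := integral_exp_le_of_centered (P := π) (hpw x) (c := c) (fun y => ?_) (hpi x) l
      · have h7 : ∀ y, Real.exp (l * (f (T.piecewise y x) - ∫ y, f y ∂π))
            = Real.exp (l * (f (T.piecewise y x) - ∫ y, f (T.piecewise y x) ∂π))
              * Real.exp (l * (h x - ∫ y, f y ∂π)) := by
          intro y
          rw [← Real.exp_add, hh]
          congr 1
          ring
        simp only [h7]
        rw [integral_mul_const]
        gcongr
      · have h8 : f (T.piecewise y x) - ∫ y, f (T.piecewise y x) ∂π
            = ∫ t, (f (T.piecewise y x) - f (T.piecewise t x)) ∂π := by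
          rw [integral_sub (integrable_const _) (hpi x)]; simp
        rw [h8]
        have := norm_integral_le_of_norm_le_const (μ := π) (C := c)
          (f := fun t => f (T.piecewise y x) - f (T.piecewise t x))
          (Filter.Eventually.of_forall fun t => hd j _ _ fun i hi => by
            have : i ∉ T := by simp [hT, hi]
            simp [Finset.piecewise, this])
        simpa using this
    rw [integral_resample T hexp]
    calc _ ≤ ∫ x, Real.exp (l ^ 2 * c ^ 2 / 2) * Real.exp (l * (h x - ∫ y, f y ∂π)) ∂π :=
          integral_mono (integrable_resample T hexp).integral_prod_left (hexp2.const_mul _) hin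
      _ ≤ Real.exp (l ^ 2 * c ^ 2 / 2) * Real.exp (S.card * (l ^ 2 * c ^ 2 / 2)) := by
          rw [integral_const_mul]
          gcongr
      _ = _ := by
          rw [← Real.exp_add, Finset.card_insert_of_notMem hj]
          congr 1
          push_cast
          ring

theorem pow_le_factorial_mul_exp (x : ℝ) (p : ℕ) :
    x ^ (2 * p) ≤ (2 * p).factorial * (Real.exp x + Real.exp (-x)) := by
  have h1 := Real.pow_div_factorial_le_exp |x| (abs_nonneg x) (2 * p)
  rw [div_le_iff₀ (by positivity), (even_two_mul p).pow_abs] at h1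
  refine h1.trans ?_
  rw [mul_comm]
  gcongr
  rcases abs_cases x with ⟨h, _⟩ | ⟨h, _⟩ <;> rw [h]
  · linarith [Real.exp_pos (-x)]
  · linarith [Real.exp_pos x]

theorem add_pow_le_two_pow_mul {u v : ℝ} (hu : 0 ≤ u) (hv : 0 ≤ v) (p : ℕ) :
    (u + v) ^ p ≤ 2 ^ p * (u ^ p + v ^ p) := by
  have h0 : u + v ≤ 2 * max u v := by
    linarith [le_max_left u v, le_max_right u v]
  refine (pow_le_pow_left₀ (add_nonneg hu hv) h0 p).trans ?_
  rw [mul_pow]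
  gcongr
  rcases max_cases u v with ⟨h, _⟩ | ⟨h, _⟩ <;> rw [h]
  · linarith [pow_nonneg hv p]
  · linarith [pow_nonneg hu p]

variable [Fintype J]

/-- With σ² = |J| c², the moment generating function at ±1/σ is at most exp(1/2) ≤ 2, and a single
term of the exponential series dominates the power. This gives every even moment at the Gaussian
scale σ. -/
theorem integral_pow_le_of_bounded_difference (col : I → J) {c : ℝ} (hc : 0 < c) [Nonempty J]
    {f : (I → E) → ℝ} (hm : Measurable f) {M : ℝ} (hM : ∀ x, |f x| ≤ M)
    (hd : ∀ j x y, (∀ i, col i ≠ j → x i = y i) → |f x - f y| ≤ c) (p : ℕ) :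
    ∫ x, (f x - ∫ y, f y ∂(Measure.pi fun _ : I => μ)) ^ (2 * p) ∂(Measure.pi fun _ : I => μ)
      ≤ 4 * (2 * p).factorial * (Fintype.card J * c ^ 2) ^ p := by
  set π := Measure.pi fun _ : I => μ with hπ
  have hJ : (0 : ℝ) < Fintype.card J := by exact_mod_cast Fintype.card_pos
  set σ : ℝ := Real.sqrt (Fintype.card J * c ^ 2) with hσ
  have hσ2 : σ ^ 2 = Fintype.card J * c ^ 2 := Real.sq_sqrt (by positivity)
  have hσ0 : 0 < σ := Real.sqrt_pos.mpr (by positivity)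
  set a := ∫ y, f y ∂π with ha
  have ha' : |a| ≤ M := by
    have := norm_integral_le_of_norm_le_const (μ := π) (f := f) (Filter.Eventually.of_forall hM)
    simpa using this
  have hb : ∀ x, |f x - a| ≤ M + M := fun x =>
    (abs_sub _ _).trans (add_le_add (hM x) ha')
  have hexp : ∀ l : ℝ, Integrable (fun x => Real.exp (l * (f x - a))) π := fun l => by
    refine integrable_of_bounded (M := Real.exp (|l| * (M + M)))
      (Measurable.aestronglyMeasurable (by fun_prop)) fun x => ?_
    rw [Real.norm_eq_abs, Real.abs_exp, Real.exp_le_exp]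
    refine (le_abs_self _).trans ?_
    rw [abs_mul]
    gcongr
    exact hb x
  have hmgf : ∀ l : ℝ, l ^ 2 = (σ ^ 2)⁻¹ → ∫ x, Real.exp (l * (f x - a)) ∂π ≤ 2 := by
    intro l hl
    refine (integral_exp_le_of_bounded_difference col l Finset.univ f hm ⟨M, hM⟩ hd
      (fun x y h => congrArg f (funext fun i => h i (Finset.mem_univ _)))).trans ?_
    rw [Finset.card_univ, hl, hσ2]
    have : (Fintype.card J : ℝ) * ((Fintype.card J * c ^ 2)⁻¹ * c ^ 2 / 2) = 1 / 2 := by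
      field_simp
    rw [this]
    have h1 := Real.exp_bound_div_one_sub_of_interval (x := 1 / 2) (by norm_num) (by norm_num)
    norm_num at h1 ⊢
    linarith
  have h1 := hmgf σ⁻¹ (by rw [inv_pow])
  have h2 := hmgf (-σ⁻¹) (by rw [neg_sq, inv_pow])
  have hpt : ∀ x, (f x - a) ^ (2 * p) ≤ σ ^ (2 * p) * ((2 * p).factorial *
      (Real.exp (σ⁻¹ * (f x - a)) + Real.exp (-σ⁻¹ * (f x - a)))) := by
    intro x
    have := pow_le_factorial_mul_exp (σ⁻¹ * (f x - a)) p
    calc (f x - a) ^ (2 * p) = σ ^ (2 * p) * (σ⁻¹ * (f x - a)) ^ (2 * p) := by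
          rw [← mul_pow, mul_inv_cancel_left₀ hσ0.ne']
      _ ≤ _ := by
          rw [neg_mul]
          gcongr
  have hint : Integrable (fun x => (f x - a) ^ (2 * p)) π := by
    refine integrable_of_bounded (M := (M + M) ^ (2 * p))
      (Measurable.aestronglyMeasurable (by fun_prop)) fun x => ?_
    rw [norm_pow]
    exact pow_le_pow_left₀ (norm_nonneg _) (hb x) _
  calc _ ≤ ∫ x, σ ^ (2 * p) * ((2 * p).factorial *
      (Real.exp (σ⁻¹ * (f x - a)) + Real.exp (-σ⁻¹ * (f x - a)))) ∂π :=
        integral_mono hint ((((hexp _).add (hexp _)).const_mul _).const_mul _) hpt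
    _ ≤ σ ^ (2 * p) * ((2 * p).factorial * (2 + 2)) := by
        rw [integral_const_mul, integral_const_mul, integral_add (hexp _) (hexp _)]
        gcongr
    _ = _ := by rw [pow_mul, hσ2]; ring

theorem integral_norm_pow_le_of_bounded_difference (col : I → J) {c : ℝ} (hc : 0 < c) [Nonempty J]
    {f : (I → E) → ℂ} (hm : Measurable f) {M : ℝ} (hM : ∀ x, ‖f x‖ ≤ M)
    (hd : ∀ j x y, (∀ i, col i ≠ j → x i = y i) → ‖f x - f y‖ ≤ c) (p : ℕ) :
    ∫ x, ‖f x - ∫ y, f y ∂(Measure.pi fun _ : I => μ)‖ ^ (2 * p) ∂(Measure.pi fun _ : I => μ)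
      ≤ 8 * 2 ^ p * (2 * p).factorial * (Fintype.card J * c ^ 2) ^ p := by
  set π := Measure.pi fun _ : I => μ with hπ
  have hi : Integrable f π := integrable_of_bounded hm.aestronglyMeasurable hM
  set a := ∫ y, f y ∂π with ha
  have hre : a.re = ∫ y, (f y).re ∂π := (integral_re hi).symm
  have him : a.im = ∫ y, (f y).im ∂π := (integral_im hi).symm
  have hmr : Measurable fun x => (f x).re := Complex.measurable_re.comp hm
  have hmi : Measurable fun x => (f x).im := Complex.measurable_im.comp hm
  have h1 := integral_pow_le_of_bounded_difference (μ := μ) col hc hmr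
    (fun x => (Complex.abs_re_le_norm _).trans (hM x))
    (fun j x y h => by
      rw [← Complex.sub_re]
      exact (Complex.abs_re_le_norm _).trans (hd j x y h)) p
  have h2 := integral_pow_le_of_bounded_difference (μ := μ) col hc hmi
    (fun x => (Complex.abs_im_le_norm _).trans (hM x))
    (fun j x y h => by
      rw [← Complex.sub_im]
      exact (Complex.abs_im_le_norm _).trans (hd j x y h)) p
  rw [← hπ, ← hre] at h1
  rw [← hπ, ← him] at h2
  have hb : ∀ x, ‖f x - a‖ ≤ M + M := fun x =>
    (norm_sub_le _ _).trans (add_le_add (hM x) (by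
      have := norm_integral_le_of_norm_le_const (μ := π) (f := f) (Filter.Eventually.of_forall hM)
      simpa using this))
  have hir : Integrable (fun x => ((f x).re - a.re) ^ (2 * p)) π := by
    refine integrable_of_bounded (M := (M + M) ^ (2 * p))
      (Measurable.aestronglyMeasurable (by fun_prop)) fun x => ?_
    rw [norm_pow, ← Complex.sub_re]
    exact pow_le_pow_left₀ (norm_nonneg _) ((Complex.abs_re_le_norm _).trans (hb x)) _
  have hii : Integrable (fun x => ((f x).im - a.im) ^ (2 * p)) π := by
    refine integrable_of_bounded (M := (M + M) ^ (2 * p))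
      (Measurable.aestronglyMeasurable (by fun_prop)) fun x => ?_
    rw [norm_pow, ← Complex.sub_im]
    exact pow_le_pow_left₀ (norm_nonneg _) ((Complex.abs_im_le_norm _).trans (hb x)) _
  have hpt : ∀ x, ‖f x - a‖ ^ (2 * p)
      ≤ 2 ^ p * (((f x).re - a.re) ^ (2 * p) + ((f x).im - a.im) ^ (2 * p)) := by
    intro x
    rw [← Complex.sub_re, ← Complex.sub_im, pow_mul, ← Complex.normSq_eq_norm_sq,
      Complex.normSq_apply, pow_mul, pow_mul, ← pow_two, ← pow_two]
    exact add_pow_le_two_pow_mul (sq_nonneg _) (sq_nonneg _) p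
  calc _ ≤ ∫ x, 2 ^ p * (((f x).re - a.re) ^ (2 * p) + ((f x).im - a.im) ^ (2 * p)) ∂π := by
        refine integral_mono ?_ ((hir.add hii).const_mul _) hpt
        refine integrable_of_bounded (M := (M + M) ^ (2 * p))
          (Measurable.aestronglyMeasurable (by fun_prop)) fun x => ?_
        rw [norm_pow, norm_norm]
        exact pow_le_pow_left₀ (norm_nonneg _) (hb x) _
    _ ≤ 2 ^ p * (4 * (2 * p).factorial * (Fintype.card J * c ^ 2) ^ p
        + 4 * (2 * p).factorial * (Fintype.card J * c ^ 2) ^ p) := by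
        rw [integral_const_mul, integral_add hir hii]
        gcongr
    _ = _ := by ring

end BoundedDifference

/-! ### Second moments of quadratic and bilinear forms in independent entries -/

section SecondMoments

/-- A random linear combination of functions that are orthogonal up to an involution. -/
theorem integral_norm_sq_sum_le {Q X : Type*} [Fintype Q] [DecidableEq Q] [MeasurableSpace X]
    {P : Measure X} (f : Q → X → ℂ) (σ : Q ≃ Q) {K : ℝ}
    (hf : ∀ p, MemLp (f p) 2 P) (hK : ∀ p, ∫ x, ‖f p x‖ ^ 2 ∂P ≤ K) (hK0 : 0 ≤ K)
    (h0 : ∀ p q, q ≠ p → q ≠ σ p → ∫ x, f p x * star (f q x) ∂P = 0) (B : Q → ℂ) :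
    ∫ x, ‖∑ p, B p * f p x‖ ^ 2 ∂P ≤ 2 * K * ∑ p, ‖B p‖ ^ 2 := by
  have hint : ∀ p q, Integrable (fun x => f p x * star (f q x)) P := fun p q =>
    (hf p).integrable_mul (hf q).star
  have hsq : ∀ p, Integrable (fun x => ‖f p x‖ ^ 2) P := fun p => (hf p).integrable_norm_pow two_ne_zero
  have h1 : ((∫ x, ‖∑ p, B p * f p x‖ ^ 2 ∂P : ℝ) : ℂ)
      = ∑ p, ∑ q, B p * star (B q) * ∫ x, f p x * star (f q x) ∂P := by
    rw [← integral_complex_ofReal]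
    have h2 : ∀ x, ((‖∑ p, B p * f p x‖ ^ 2 : ℝ) : ℂ)
        = ∑ p, ∑ q, B p * star (B q) * (f p x * star (f q x)) := by
      intro x
      rw [Complex.ofReal_pow, ← Complex.mul_conj', map_sum, Finset.sum_mul_sum]
      refine Finset.sum_congr rfl fun p _ => Finset.sum_congr rfl fun q _ => ?_
      rw [map_mul]
      simp only [RCLike.star_def]
      ring
    simp only [h2]
    rw [integral_finsetSum _ fun p _ => integrable_finsetSum _ fun q _ => (hint p q).const_mul _]
    refine Finset.sum_congr rfl fun p _ => ?_
    rw [integral_finsetSum _ fun q _ => (hint p q).const_mul _]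
    refine Finset.sum_congr rfl fun q _ => ?_
    rw [integral_const_mul]
  have h3 : ∀ p q, ‖∫ x, f p x * star (f q x) ∂P‖ ≤ K := by
    intro p q
    refine (norm_integral_le_integral_norm _).trans ?_
    calc _ ≤ ∫ x, (‖f p x‖ ^ 2 + ‖f q x‖ ^ 2) / 2 ∂P := by
          refine integral_mono (hint p q).norm (((hsq p).add (hsq q)).div_const 2) fun x => ?_
          rw [norm_mul, norm_star]
          linarith [two_mul_le_add_sq ‖f p x‖ ‖f q x‖]
      _ = ((∫ x, ‖f p x‖ ^ 2 ∂P) + ∫ x, ‖f q x‖ ^ 2 ∂P) / 2 := by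
          rw [integral_div, integral_add (hsq p) (hsq q)]
      _ ≤ K := by linarith [hK p, hK q]
  have h4 : ∫ x, ‖∑ p, B p * f p x‖ ^ 2 ∂P
      ≤ ‖((∫ x, ‖∑ p, B p * f p x‖ ^ 2 ∂P : ℝ) : ℂ)‖ := by
    rw [Complex.norm_real]; exact le_abs_self _
  refine h4.trans ?_
  rw [h1]
  -- Only the pairs q = p and q = σ p survive. Each family contributes at most K ∑ |B|², since σ
  -- permutes the indices; hence the factor 2.
  have h5 : ∀ p q, ‖B p * star (B q) * ∫ x, f p x * star (f q x) ∂P‖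
      ≤ (if q = p then K * (‖B p‖ ^ 2) else 0)
        + (if q = σ p then K * ((‖B p‖ ^ 2 + ‖B (σ p)‖ ^ 2) / 2) else 0) := by
    intro p q
    by_cases hq : q = p ∨ q = σ p
    · have h6 : ‖B p * star (B q) * ∫ x, f p x * star (f q x) ∂P‖
          ≤ (‖B p‖ ^ 2 + ‖B q‖ ^ 2) / 2 * K := by
        rw [norm_mul, norm_mul, norm_star]
        gcongr
        · linarith [two_mul_le_add_sq ‖B p‖ ‖B q‖]
        · exact h3 p q
      refine h6.trans ?_
      have e1 : 0 ≤ K * ‖B p‖ ^ 2 := by positivity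
      have e2 : 0 ≤ K * ((‖B p‖ ^ 2 + ‖B (σ p)‖ ^ 2) / 2) := by positivity
      by_cases hqp : q = p
      · subst hqp
        rw [if_pos rfl]
        split_ifs <;> nlinarith
      · have hqs := hq.resolve_left hqp
        rw [if_neg hqp, if_pos hqs, hqs]
        linarith
    · push Not at hq
      rw [h0 p q hq.1 hq.2]
      simp [hq.1, hq.2]
  refine (norm_sum_le _ _).trans ((Finset.sum_le_sum fun p _ => (norm_sum_le _ _).trans
    (Finset.sum_le_sum fun q _ => h5 p q)).trans ?_)
  simp only [Finset.sum_add_distrib, Finset.sum_ite_eq', Finset.mem_univ, if_true]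
  rw [← Finset.mul_sum, ← Finset.mul_sum, ← Finset.sum_div, Finset.sum_add_distrib,
    Equiv.sum_comp σ fun p => ‖B p‖ ^ 2]
  linarith

variable {I : Type*} [Fintype I] [DecidableEq I] {μ : Measure ℂ} [IsProbabilityMeasure μ]

omit [DecidableEq I] in
theorem memLp_eval {q : ENNReal} (h : MemLp id q μ) (i : I) :
    MemLp (fun x : I → ℂ => x i) q (Measure.pi fun _ : I => μ) :=
  h.comp_measurePreserving (measurePreserving_eval (fun _ : I => μ) i)

theorem memLp_mul_two {X : Type*} [MeasurableSpace X] {P : Measure X} {f g : X → ℂ}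
    (hf : MemLp f 4 P) (hg : MemLp g 4 P) : MemLp (fun x => f x * g x) 2 P := by
  have : ENNReal.HolderTriple 4 4 2 := ⟨by
    rw [show (4 : ENNReal) = 2 * 2 by norm_num, ENNReal.mul_inv (by simp) (by simp), ← mul_add,
      ENNReal.inv_two_add_inv_two, mul_one]⟩
  exact MemLp.mul (p := 4) (q := 4) hg hf

variable (h4 : MemLp id 4 μ) (h1 : ∫ t, t ∂μ = 0) (h2 : ∫ t, ‖t‖ ^ 2 ∂μ = 1)

-- Expand (|t|² - 1)² ≥ 0. The bound is used throughout to absorb moment-free error terms into the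
-- fourth moment.
include h4 h2 in
theorem one_le_fourth_moment : 1 ≤ ∫ t, ‖t‖ ^ 4 ∂μ := by
  have i4 : Integrable (fun t : ℂ => ‖t‖ ^ 4) μ := h4.integrable_norm_pow (by norm_num)
  have i2 : Integrable (fun t : ℂ => ‖t‖ ^ 2) μ :=
    (h4.mono_exponent (by norm_num : (2 : ENNReal) ≤ 4)).integrable_norm_pow two_ne_zero
  have : ∫ t, (2 * ‖t‖ ^ 2 - 1) ∂μ ≤ ∫ t, ‖t‖ ^ 4 ∂μ := by
    refine integral_mono ((i2.const_mul 2).sub (integrable_const _)) i4 fun t => ?_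
    simp only
    nlinarith [sq_nonneg (‖t‖ ^ 2 - 1)]
  rw [integral_sub (i2.const_mul 2) (integrable_const _), integral_const_mul, h2] at this
  simp at this
  linarith

-- The centered products x_j x̄_l are orthogonal except for a pair and its transpose, whose
-- correlation involves the unrestricted moment E ξ². Hence the involution is the swap. The
-- individual second moments are E|ξ|⁴ - 1 or 1, both at most E|ξ|⁴.
include h4 h1 h2 in
theorem integral_norm_sq_quadratic_le {L : Type*} [Fintype L] [DecidableEq L] (e : L → I)
    (he : Function.Injective e) (B : L → L → ℂ) :
    ∫ x, ‖∑ j, ∑ l, B j l * (x (e j) * star (x (e l)) - if j = l then 1 else 0)‖ ^ 2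
      ∂(Measure.pi fun _ : I => μ) ≤ 2 * (∫ t, ‖t‖ ^ 4 ∂μ) * ∑ j, ∑ l, ‖B j l‖ ^ 2 := by
  set π := Measure.pi fun _ : I => μ with hπ
  have h41 := one_le_fourth_moment h4 h2
  have hM : ∀ i : I, MemLp (fun x : I → ℂ => x i) 4 π := fun i => memLp_eval h4 i
  have i4 : Integrable (fun t : ℂ => ‖t‖ ^ 4) μ := h4.integrable_norm_pow (by norm_num)
  have i2 : Integrable (fun t : ℂ => ‖t‖ ^ 2) μ :=
    (h4.mono_exponent (by norm_num : (2 : ENNReal) ≤ 4)).integrable_norm_pow two_ne_zero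
  have i1 : Integrable (fun t : ℂ => t) μ := h4.integrable (by norm_num)
  set f : L × L → (I → ℂ) → ℂ := fun p x =>
    x (e p.1) * star (x (e p.2)) - if p.1 = p.2 then 1 else 0 with hf
  have hfm : ∀ p, MemLp (f p) 2 π := fun p =>
    (memLp_mul_two (hM _) (hM _).star).sub (memLp_const _)
  have hmeas : ∀ p, Measurable (f p) := fun p => by
    simp only [hf, RCLike.star_def]
    exact ((measurable_pi_apply _).mul
      (Complex.continuous_conj.measurable.comp (measurable_pi_apply _))).sub_const _
  have hsplit : ∀ x, ∑ j, ∑ l, B j l * (x (e j) * star (x (e l)) - if j = l then 1 else 0)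
      = ∑ p : L × L, B p.1 p.2 * f p x := fun x => by
    rw [Fintype.sum_prod_type]
  simp only [hsplit]
  rw [← Fintype.sum_prod_type' fun j l => ‖B j l‖ ^ 2]
  have hmean : ∀ (p : L × L) (a : L), (a = p.1 ∨ a = p.2) → ∀ x,
      ∫ t, f p (Function.update x (e a) t) ∂μ = 0 := by
    intro p a ha x
    by_cases hp : p.1 = p.2
    · have ha1 : a = p.1 := by rcases ha with h | h <;> simp [h, hp]
      have : ∀ t, f p (Function.update x (e a) t) = ((‖t‖ ^ 2 : ℝ) : ℂ) - 1 := by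
        intro t
        simp only [hf, ← hp, ha1, Function.update_self, if_true, RCLike.star_def,
          Complex.mul_conj']
        push_cast; rfl
      simp only [this]
      rw [integral_sub i2.ofReal (integrable_const _), integral_complex_ofReal, h2]
      simp
    · have hp' : e p.1 ≠ e p.2 := fun h => hp (he h)
      rcases ha with ha | ha
      · have : ∀ t, f p (Function.update x (e a) t) = t * star (x (e p.2)) := by
          intro t
          simp only [hf, ha, Function.update_self, hp, if_false, sub_zero,
            Function.update_of_ne hp'.symm]
        simp only [this]
        rw [integral_mul_const, h1, zero_mul]
      · have : ∀ t, f p (Function.update x (e a) t) = x (e p.1) * star t := by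
          intro t
          simp only [hf, ha, Function.update_self, hp, if_false, sub_zero,
            Function.update_of_ne hp']
        simp only [this]
        rw [integral_const_mul]
        have h3 : ∫ t : ℂ, star t ∂μ = 0 := by
          simp only [RCLike.star_def]
          rw [integral_conj, h1, map_zero]
        rw [h3, mul_zero]
  have hconst : ∀ (q : L × L) (a : L), a ≠ q.1 → a ≠ q.2 → ∀ x t,
      f q (Function.update x (e a) t) = f q x := by
    intro q a h1 h2 x t
    simp only [hf, Function.update_of_ne (fun h => h1 (he h).symm : e q.1 ≠ e a),
      Function.update_of_ne (fun h => h2 (he h).symm : e q.2 ≠ e a)]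
  have hvan : ∀ (p q : L × L) (a : L), (a = p.1 ∨ a = p.2) → a ≠ q.1 → a ≠ q.2 →
      ∫ x, f p x * star (f q x) ∂π = 0 := by
    intro p q a ha hq1 hq2
    refine integral_eq_zero_of_update (e a) ?_ fun x => ?_
    · exact (hmeas p).mul (Complex.continuous_conj.measurable.comp (hmeas q))
    · simp only [hconst q a hq1 hq2]
      rw [integral_mul_const, hmean p a ha, zero_mul]
  refine integral_norm_sq_sum_le f (Equiv.prodComm L L) hfm ?_ (by linarith) ?_ _
  · intro p
    by_cases hp : p.1 = p.2
    · have : ∀ x, ‖f p x‖ ^ 2 = (fun t : ℂ => ‖t‖ ^ 4 - (2 * ‖t‖ ^ 2 - 1)) (x (e p.1)) := by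
        intro x
        have h3 : f p x = ((‖x (e p.1)‖ ^ 2 - 1 : ℝ) : ℂ) := by
          simp only [hf, ← hp, if_true, RCLike.star_def, Complex.mul_conj']
          push_cast; rfl
        rw [h3, Complex.norm_real, Real.norm_eq_abs, sq_abs]
        ring
      simp only [this]
      rw [integral_eval (g := fun t : ℂ => ‖t‖ ^ 4 - (2 * ‖t‖ ^ 2 - 1))
        (Measurable.stronglyMeasurable (by fun_prop)),
        integral_sub (g := fun t : ℂ => 2 * ‖t‖ ^ 2 - 1) i4 ((i2.const_mul 2).sub (integrable_const _)),
        integral_sub (i2.const_mul 2) (integrable_const _), integral_const_mul, h2]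
      simp
    · have h3 : ∀ x, ‖f p x‖ ^ 2 = ‖x (e p.1)‖ ^ 2 * ‖x (e p.2)‖ ^ 2 := by
        intro x
        simp only [hf, hp, if_false, sub_zero, norm_mul, norm_star, mul_pow]
      simp only [h3]
      have hp' : e p.2 ≠ e p.1 := fun h => hp (he h).symm
      have hi : Integrable (fun x : I → ℂ => ‖x (e p.1)‖ ^ 2 * ‖x (e p.2)‖ ^ 2) π := by
        have := (hfm p).integrable_norm_pow two_ne_zero
        simpa only [h3] using this
      rw [integral_resample {e p.1} hi]
      have h5 : ∀ x : I → ℂ, ∫ y, ‖({e p.1} : Finset I).piecewise y x (e p.1)‖ ^ 2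
          * ‖({e p.1} : Finset I).piecewise y x (e p.2)‖ ^ 2 ∂π = ‖x (e p.2)‖ ^ 2 := by
        intro x
        simp only [Finset.piecewise_singleton, Function.update_self, Function.update_of_ne hp']
        rw [integral_mul_const, integral_eval (g := fun t : ℂ => ‖t‖ ^ 2)
          (Measurable.stronglyMeasurable (by fun_prop)), h2, one_mul]
      refine (integral_congr_ae (Filter.Eventually.of_forall h5)).trans_le ?_
      rw [integral_eval (g := fun t : ℂ => ‖t‖ ^ 2)
          (Measurable.stronglyMeasurable (by fun_prop)), h2]
      exact h41
  · intro p q hqp hqs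
    -- Unless the pairs agree up to order, one of them contains an index absent from the other, and
    -- integrating that coordinate first gives zero.
    have hcase : (∃ a, (a = p.1 ∨ a = p.2) ∧ a ≠ q.1 ∧ a ≠ q.2) ∨
        (∃ a, (a = q.1 ∨ a = q.2) ∧ a ≠ p.1 ∧ a ≠ p.2) := by
      by_contra! hc
      obtain ⟨hc1, hc2⟩ := hc
      obtain ⟨p1, p2⟩ := p
      obtain ⟨q1, q2⟩ := q
      have a1 := hc1 p1 (Or.inl rfl)
      have a2 := hc1 p2 (Or.inr rfl)
      have b1 := hc2 q1 (Or.inl rfl)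
      have b2 := hc2 q2 (Or.inr rfl)
      simp only [ne_eq, Prod.mk.injEq, Equiv.prodComm_apply, Prod.swap_prod_mk] at *
      grind
    rcases hcase with ⟨a, ha, hb, hc⟩ | ⟨a, ha, hb, hc⟩
    · exact hvan p q a ha hb hc
    · have h3 := hvan q p a ha hb hc
      have h5 : ∀ x, f p x * star (f q x) = (starRingEnd ℂ) (f q x * star (f p x)) := by
        intro x
        simp only [RCLike.star_def, map_mul, Complex.conj_conj]
        ring
      simp only [h5]
      rw [integral_conj, h3, map_zero]

-- For two disjoint families of entries the products x_j x_l are orthonormal: neither E ξ² nor the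
-- fourth moment enters, and the involution is the identity.
include h4 h1 h2 in
theorem integral_norm_sq_bilinear_le {L L' : Type*} [Fintype L] [DecidableEq L] [Fintype L']
    [DecidableEq L'] (e : L → I) (e' : L' → I)
    (he : Function.Injective e) (he' : Function.Injective e') (hd : ∀ j l, e j ≠ e' l)
    (B : L → L' → ℂ) :
    ∫ x, ‖∑ j, ∑ l, B j l * (x (e j) * x (e' l))‖ ^ 2
      ∂(Measure.pi fun _ : I => μ) ≤ 2 * ∑ j, ∑ l, ‖B j l‖ ^ 2 := by
  set π := Measure.pi fun _ : I => μ with hπ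
  have hM : ∀ i : I, MemLp (fun x : I → ℂ => x i) 4 π := fun i => memLp_eval h4 i
  set f : L × L' → (I → ℂ) → ℂ := fun p x => x (e p.1) * x (e' p.2) with hf
  have hfm : ∀ p, MemLp (f p) 2 π := fun p => memLp_mul_two (hM _) (hM _)
  have hmeas : ∀ p, Measurable (f p) := fun p =>
    (measurable_pi_apply _).mul (measurable_pi_apply _)
  have hsplit : ∀ x, ∑ j, ∑ l, B j l * (x (e j) * x (e' l))
      = ∑ p : L × L', B p.1 p.2 * f p x := fun x => by
    rw [Fintype.sum_prod_type]
  simp only [hsplit]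
  rw [← Fintype.sum_prod_type' fun j l => ‖B j l‖ ^ 2]
  have := integral_norm_sq_sum_le (P := π) f (Equiv.refl _) (K := 1) hfm ?_ zero_le_one ?_
    fun p => B p.1 p.2
  · simpa using this
  · intro p
    have h3 : ∀ x, ‖f p x‖ ^ 2 = ‖x (e p.1)‖ ^ 2 * ‖x (e' p.2)‖ ^ 2 := by
      intro x
      simp only [hf, norm_mul, mul_pow]
    simp only [h3]
    have hi : Integrable (fun x : I → ℂ => ‖x (e p.1)‖ ^ 2 * ‖x (e' p.2)‖ ^ 2) π := by
      have := (hfm p).integrable_norm_pow two_ne_zero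
      simpa only [h3] using this
    rw [integral_resample {e p.1} hi]
    have h5 : ∀ x : I → ℂ, ∫ y, ‖({e p.1} : Finset I).piecewise y x (e p.1)‖ ^ 2
        * ‖({e p.1} : Finset I).piecewise y x (e' p.2)‖ ^ 2 ∂π = ‖x (e' p.2)‖ ^ 2 := by
      intro x
      simp only [Finset.piecewise_singleton, Function.update_self,
        Function.update_of_ne (hd p.1 p.2).symm]
      rw [integral_mul_const, integral_eval (g := fun t : ℂ => ‖t‖ ^ 2)
        (Measurable.stronglyMeasurable (by fun_prop)), h2, one_mul]
    refine (integral_congr_ae (Filter.Eventually.of_forall h5)).trans_le ?_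
    rw [integral_eval (g := fun t : ℂ => ‖t‖ ^ 2)
        (Measurable.stronglyMeasurable (by fun_prop)), h2]
  · intro p q hqp _
    have hm : Measurable fun x => f p x * star (f q x) :=
      (hmeas p).mul (Complex.continuous_conj.measurable.comp (hmeas q))
    by_cases hq1 : q.1 = p.1
    · have hq2 : q.2 ≠ p.2 := fun h => hqp (Prod.ext hq1 h)
      refine integral_eq_zero_of_update (e' p.2) hm fun x => ?_
      simp only [hf, Function.update_self, Function.update_of_ne (hd _ _),
        Function.update_of_ne (fun h => hq2 (he' h) : e' q.2 ≠ e' p.2)]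
      rw [integral_mul_const, integral_const_mul, h1, mul_zero, zero_mul]
    · refine integral_eq_zero_of_update (e p.1) hm fun x => ?_
      simp only [hf, Function.update_self, Function.update_of_ne (hd _ _).symm,
        Function.update_of_ne (fun h => hq1 (he h) : e q.1 ≠ e p.1)]
      rw [integral_mul_const, integral_mul_const, h1, zero_mul, zero_mul]

end SecondMoments

/-! ### The same forms with random coefficients independent of the entries -/

section SecondMomentsResample

variable {I : Type*} [Fintype I] [DecidableEq I] {μ : Measure ℂ} [IsProbabilityMeasure μ]

theorem memLp_bounded_mul {X : Type*} [MeasurableSpace X] {P : Measure X} {f g : X → ℂ}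
    (hf : Measurable f) {M : ℝ} (hM : ∀ x, ‖f x‖ ≤ M) (hg : MemLp g 2 P) :
    MemLp (fun x => f x * g x) 2 P := by
  have : MemLp f ⊤ P := memLp_top_of_bound hf.aestronglyMeasurable M (Filter.Eventually.of_forall hM)
  exact hg.mul this

variable (h4 : MemLp id 4 μ) (h1 : ∫ t, t ∂μ = 0) (h2 : ∫ t, ‖t‖ ^ 2 ∂μ = 1) (T : Finset I)

omit [DecidableEq I] in
include h4 in
theorem memLp_quadratic {L : Type*} [Fintype L] [DecidableEq L] (e : L → I)
    (B : (I → ℂ) → L → L → ℂ) (hm : ∀ j l, Measurable fun x => B x j l) {M : ℝ}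
    (hM : ∀ x j l, ‖B x j l‖ ≤ M) :
    MemLp (fun x => ∑ j, ∑ l, B x j l * (x (e j) * star (x (e l)) - if j = l then 1 else 0)) 2
      (Measure.pi fun _ : I => μ) := by
  refine memLp_finsetSum _ fun j _ => memLp_finsetSum _ fun l _ => ?_
  refine memLp_bounded_mul (hm j l) (fun x => hM x j l) ?_
  exact (memLp_mul_two (memLp_eval h4 _) (memLp_eval h4 _).star).sub (memLp_const _)

omit [DecidableEq I] in
include h4 in
theorem memLp_bilinear {L L' : Type*} [Fintype L] [Fintype L'] (e : L → I) (e' : L' → I)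
    (B : (I → ℂ) → L → L' → ℂ) (hm : ∀ j l, Measurable fun x => B x j l) {M : ℝ}
    (hM : ∀ x j l, ‖B x j l‖ ≤ M) :
    MemLp (fun x => ∑ j, ∑ l, B x j l * (x (e j) * x (e' l))) 2
      (Measure.pi fun _ : I => μ) := by
  refine memLp_finsetSum _ fun j _ => memLp_finsetSum _ fun l _ => ?_
  refine memLp_bounded_mul (hm j l) (fun x => hM x j l) ?_
  exact memLp_mul_two (memLp_eval h4 _) (memLp_eval h4 _)

-- The coefficients do not see the coordinates in `T` and the form sees only those, so conditioning
-- on the rest reduces to deterministic coefficients with a uniform bound.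
include h4 h1 h2 in
theorem integral_norm_sq_quadratic_resample_le {L : Type*} [Fintype L] [DecidableEq L] (e : L → I)
    (he : Function.Injective e) (heT : ∀ j, e j ∈ T)
    (B : (I → ℂ) → L → L → ℂ) (hm : ∀ j l, Measurable fun x => B x j l) {M : ℝ}
    (hM : ∀ x j l, ‖B x j l‖ ≤ M) (hB : ∀ x y, B (T.piecewise y x) = B x)
    {b : ℝ} (hb : ∀ x, ∑ j, ∑ l, ‖B x j l‖ ^ 2 ≤ b) :
    ∫ x, ‖∑ j, ∑ l, B x j l * (x (e j) * star (x (e l)) - if j = l then 1 else 0)‖ ^ 2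
      ∂(Measure.pi fun _ : I => μ) ≤ 2 * (∫ t, ‖t‖ ^ 4 ∂μ) * b := by
  have hi := (memLp_quadratic h4 e B hm hM).integrable_norm_pow two_ne_zero
  have hω := one_le_fourth_moment h4 h2
  rw [integral_resample T hi]
  have hle : ∀ x : I → ℂ, _ := fun x => integral_norm_sq_quadratic_le (μ := μ) h4 h1 h2 e he (B x)
  refine (integral_mono (g := fun _ => 2 * (∫ t, ‖t‖ ^ 4 ∂μ) * b)
    (integrable_resample T hi).integral_prod_left (integrable_const _) fun x => ?_).trans_eq
    (by simp)
  simp only [hB, Finset.piecewise_eq_of_mem _ _ _ (heT _)]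
  refine (hle x).trans ?_
  gcongr
  exact hb x

include h4 h1 h2 in
theorem integral_norm_sq_bilinear_resample_le {L L' : Type*} [Fintype L] [DecidableEq L]
    [Fintype L'] [DecidableEq L'] (e : L → I) (e' : L' → I)
    (he : Function.Injective e) (he' : Function.Injective e') (hd : ∀ j l, e j ≠ e' l)
    (heT : ∀ j, e j ∈ T) (heT' : ∀ j, e' j ∈ T)
    (B : (I → ℂ) → L → L' → ℂ) (hm : ∀ j l, Measurable fun x => B x j l) {M : ℝ}
    (hM : ∀ x j l, ‖B x j l‖ ≤ M) (hB : ∀ x y, B (T.piecewise y x) = B x)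
    {b : ℝ} (hb : ∀ x, ∑ j, ∑ l, ‖B x j l‖ ^ 2 ≤ b) :
    ∫ x, ‖∑ j, ∑ l, B x j l * (x (e j) * x (e' l))‖ ^ 2
      ∂(Measure.pi fun _ : I => μ) ≤ 2 * b := by
  have hi := (memLp_bilinear h4 e e' B hm hM).integrable_norm_pow two_ne_zero
  rw [integral_resample T hi]
  have hle : ∀ x : I → ℂ, _ := fun x =>
    integral_norm_sq_bilinear_le (μ := μ) h4 h1 h2 e e' he he' hd (B x)
  refine (integral_mono (g := fun _ => 2 * b)
    (integrable_resample T hi).integral_prod_left (integrable_const _) fun x => ?_).trans_eq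
    (by simp)
  simp only [hB, Finset.piecewise_eq_of_mem _ _ _ (heT _), Finset.piecewise_eq_of_mem _ _ _ (heT' _)]
  refine (hle x).trans ?_
  gcongr
  exact hb x

end SecondMomentsResample

/-! ### Perturbation of the 2 × 2 Schur complement -/

section TwoByTwo

/-- Perturbation of the first column of the inverse of a `2 × 2` matrix. -/
theorem norm_sub_fixMap_le_of_two_by_two {z w s a b k11 k12 k21 k22 : ℂ} {h : ℝ}
    (hu : 0 < (w + s).im) (ha : ‖a‖ ≤ 1 / h) (hb : ‖b‖ ≤ 1 / h)
    (e1 : k11 * a + k12 * b = 1) (e2 : k21 * a + k22 * b = 0) {e : ℝ}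
    (he : ‖k11 + w + s‖ + ‖k12 + z‖ + ‖k21 + star z‖ + ‖k22 + w + s‖ = e) :
    ‖a - fixMap z w s‖ ≤ rowSq z w s * (e + e ^ 2 / h) := by
  have hD := sq_sub_norm_sq_ne_zero hu z
  have hzz : (‖z‖ : ℂ) ^ 2 = z * star z := (Complex.mul_conj' z).symm
  set D := (w + s) ^ 2 - (‖z‖ : ℂ) ^ 2 with hDdef
  set q := Real.sqrt (rowSq z w s) with hq
  have hq2 : q ^ 2 = rowSq z w s := Real.sq_sqrt rowSq_nonneg
  have hq0 : 0 ≤ q := Real.sqrt_nonneg _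
  have hv1 : ‖(w + s) / D‖ ≤ q := by
    refine Real.le_sqrt_of_sq_le ?_
    rw [norm_div, div_pow, rowSq]
    gcongr
    linarith [sq_nonneg ‖z‖]
  have hv2 : ‖z / D‖ ≤ q := by
    refine Real.le_sqrt_of_sq_le ?_
    rw [norm_div, div_pow, rowSq]
    gcongr
    linarith [sq_nonneg ‖w + s‖]
  have hv3 : ‖star z / D‖ ≤ q := by rw [norm_div, norm_star, ← norm_div]; exact hv2
  set r1 := (k11 + w + s) * a + (k12 + z) * b with hr1
  set r2 := (k21 + star z) * a + (k22 + w + s) * b with hr2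
  have ha' : a = -((w + s) / D) + (w + s) / D * r1 - z / D * r2 := by
    field_simp
    rw [hr1, hr2, hDdef, hzz]
    linear_combination (-(w + s)) * e1 + z * e2
  have hb' : b = star z / D - star z / D * r1 + (w + s) / D * r2 := by
    field_simp
    rw [hr1, hr2, hDdef, hzz]
    linear_combination (star z) * e1 - (w + s) * e2
  have he0 : 0 ≤ e := by rw [← he]; positivity
  have hr : ∀ t, ‖a‖ ≤ t → ‖b‖ ≤ t → ‖r1‖ + ‖r2‖ ≤ e * t := by
    intro t hat hbt
    calc ‖r1‖ + ‖r2‖ ≤ (‖k11 + w + s‖ * ‖a‖ + ‖k12 + z‖ * ‖b‖)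
          + (‖k21 + star z‖ * ‖a‖ + ‖k22 + w + s‖ * ‖b‖) := by
          rw [hr1, hr2, ← norm_mul, ← norm_mul, ← norm_mul, ← norm_mul]
          exact add_le_add (norm_add_le _ _) (norm_add_le _ _)
      _ ≤ (‖k11 + w + s‖ * t + ‖k12 + z‖ * t)
          + (‖k21 + star z‖ * t + ‖k22 + w + s‖ * t) := by gcongr
      _ = e * t := by rw [← he]; ring
  have hcomb : ∀ {α β : ℂ}, ‖α‖ ≤ q → ‖β‖ ≤ q → ‖α * r1‖ + ‖β * r2‖ ≤ q * (‖r1‖ + ‖r2‖) := by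
    intro α β h1 h2
    rw [norm_mul, norm_mul, mul_add]
    gcongr
  have hr0 := hr _ ha hb
  -- Bootstrap: the crude bound 1 / h, used once in the residuals, shows that a and b are themselves
  -- of size q. Feeding this back into the residuals supplies the second factor q, so that the error
  -- is relative to q² = `rowSq z w s`.
  have hat : ‖a‖ ≤ q + q * (e / h) := by
    rw [ha']
    refine (norm_sub_le _ _).trans ?_
    have h1 := norm_add_le (-((w + s) / D)) ((w + s) / D * r1)
    rw [norm_neg] at h1
    have h2 := hcomb hv1 hv2
    have h3 : q * (‖r1‖ + ‖r2‖) ≤ q * (e / h) := by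
      rw [div_eq_mul_one_div]; gcongr
    linarith
  have hbt : ‖b‖ ≤ q + q * (e / h) := by
    rw [hb']
    refine (norm_add_le _ _).trans ?_
    have h1 := norm_sub_le (star z / D) (star z / D * r1)
    have h2 := hcomb hv3 hv1
    have h3 : q * (‖r1‖ + ‖r2‖) ≤ q * (e / h) := by
      rw [div_eq_mul_one_div]; gcongr
    linarith
  have hr3 := hr _ hat hbt
  have h5 : a - fixMap z w s = (w + s) / D * r1 - z / D * r2 := by
    rw [fixMap, ← hDdef, neg_div]
    linear_combination ha'
  rw [h5, ← hq2]
  refine (norm_sub_le _ _).trans ((hcomb hv1 hv2).trans ?_)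
  calc q * (‖r1‖ + ‖r2‖) ≤ q * (e * (q + q * (e / h))) := by gcongr
    _ = _ := by ring

end TwoByTwo

/-! ### Relabelling indices and changing one row and column -/

section Reindex

variable {N N' : Type*} [Fintype N] [DecidableEq N] [Fintype N'] [DecidableEq N']

theorem green_submatrix (H : Matrix N N ℂ) (w : ℂ) (e : N' ≃ N) :
    green (H.submatrix e e) w = (green H w).submatrix e e := by
  rw [green, green, ← Matrix.inv_submatrix_equiv]
  congr 1
  ext i j
  simp [Matrix.one_apply]

/-- Changing one row and column of a Hermitian matrix moves the diagonal of the resolvent by a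
bounded amount in total. -/
theorem sum_norm_green_diag_sub_le {H H' : Matrix N N ℂ} (hH : H.IsHermitian)
    (hH' : H'.IsHermitian) {w : ℂ} (hw : 0 < w.im) (k : N)
    (h : zeroOut {k} H = zeroOut {k} H') :
    ∑ j, ‖green H w j j - green H' w j j‖ ≤ 4 / w.im := by
  rw [← Finset.add_sum_erase _ _ (Finset.mem_univ k)]
  have h1 : ‖green H w k k - green H' w k k‖ ≤ 1 / w.im + 1 / w.im :=
    (norm_sub_le _ _).trans (add_le_add (norm_green_diag_le hH hw k) (norm_green_diag_le hH' hw k))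
  have h2 := sum_norm_green_zeroOut_sub_le hH hw k
  have h3 := sum_norm_green_zeroOut_sub_le hH' hw k
  have h4 : ∑ j ∈ Finset.univ.erase k, ‖green H w j j - green H' w j j‖
      ≤ 1 / w.im + 1 / w.im := by
    refine le_trans ?_ (add_le_add h2 h3)
    rw [← Finset.sum_add_distrib]
    refine Finset.sum_le_sum fun j _ => ?_
    rw [h, norm_sub_rev (green (zeroOut {k} H') w j j) (green H w j j)]
    exact norm_sub_le_norm_sub_add_norm_sub _ _ _
  have : 4 / w.im = 1 / w.im + 1 / w.im + (1 / w.im + 1 / w.im) := by ring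
  linarith

end Reindex

/-! ### The Hermitization and the empirical Stieltjes transform -/

section Hermitization

variable {ι : Type*} [Fintype ι] [DecidableEq ι]

/-- The Hermitization of a square matrix. -/
def hermitization (B : Matrix ι ι ℂ) : Matrix (ι ⊕ ι) (ι ⊕ ι) ℂ := Matrix.fromBlocks 0 B Bᴴ 0

section Entries

variable {ι : Type*} (B : Matrix ι ι ℂ) (i j : ι)

@[simp] theorem hermitization_inl_inl : hermitization B (Sum.inl i) (Sum.inl j) = 0 := rfl
@[simp] theorem hermitization_inl_inr : hermitization B (Sum.inl i) (Sum.inr j) = B i j := rfl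
@[simp] theorem hermitization_inr_inl :
    hermitization B (Sum.inr i) (Sum.inl j) = star (B j i) := rfl
@[simp] theorem hermitization_inr_inr : hermitization B (Sum.inr i) (Sum.inr j) = 0 := rfl

end Entries

omit [Fintype ι] [DecidableEq ι] in
theorem isHermitian_hermitization (B : Matrix ι ι ℂ) : (hermitization B).IsHermitian := by
  rw [Matrix.IsHermitian, hermitization, Matrix.fromBlocks_conjTranspose]
  simp

/-- This reflects that BB* and B*B have the same spectrum. The diagonals of G(H - w) = 1 and (H -
w)G = 1 express both traces through the same off-diagonal block of G. -/
theorem sum_green_inl_eq_sum_green_inr (B : Matrix ι ι ℂ) {w : ℂ} (hw : 0 < w.im) :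
    ∑ i, green (hermitization B) w (Sum.inl i) (Sum.inl i)
      = ∑ i, green (hermitization B) w (Sum.inr i) (Sum.inr i) := by
  have hH := isHermitian_hermitization B
  have hw0 : w ≠ 0 := fun h => by simp [h] at hw
  set G := green (hermitization B) w
  have h1 : ∀ i, ∑ j, G (Sum.inl i) (Sum.inr j) * star (B i j) - w * G (Sum.inl i) (Sum.inl i)
      = 1 := by
    intro i
    have := congrFun (congrFun (green_mul_sub hH hw) (Sum.inl i)) (Sum.inl i)
    rw [mul_sub, Matrix.sub_apply, Matrix.mul_smul, mul_one, Matrix.smul_apply, Matrix.mul_apply,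
      Matrix.one_apply_eq, Fintype.sum_sum_type] at this
    simpa using this
  have h2 : ∀ j, ∑ i, star (B i j) * G (Sum.inl i) (Sum.inr j) - w * G (Sum.inr j) (Sum.inr j)
      = 1 := by
    intro j
    have := sum_mul_green hH hw (Sum.inr j) (Sum.inr j)
    rw [Fintype.sum_sum_type] at this
    simpa using this
  have h3 := Finset.sum_congr (rfl : (Finset.univ : Finset ι) = _) fun i _ => h1 i
  have h4 := Finset.sum_congr (rfl : (Finset.univ : Finset ι) = _) fun i _ => h2 i
  rw [Finset.sum_sub_distrib, ← Finset.mul_sum] at h3 h4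
  rw [Finset.sum_comm] at h4
  simp only [mul_comm (star (B _ _))] at h4
  apply mul_left_cancel₀ hw0
  linear_combination h4 - h3

/-- Eliminating the lower left block of G from the two block equations leaves the equation for w
(BB* - w²)⁻¹. -/
theorem green_hermitization_inl (B : Matrix ι ι ℂ) {w : ℂ} (hw : 0 < w.im) :
    (B * Bᴴ - w ^ 2 • 1) * Matrix.of (fun i j => green (hermitization B) w (Sum.inl i) (Sum.inl j))
      = w • 1 := by
  have hH := isHermitian_hermitization B
  have h1 := sub_mul_green hH hw
  set G := green (hermitization B) w
  obtain ⟨G11, G12, G21, G22, hG⟩ : ∃ a b c d, G = Matrix.fromBlocks a b c d :=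
    ⟨_, _, _, _, (Matrix.fromBlocks_toBlocks G).symm⟩
  have e1 : Matrix.of (fun i j => G (Sum.inl i) (Sum.inl j)) = G11 := by
    ext i j; simp [hG]
  rw [e1]
  rw [sub_mul, Matrix.smul_mul, one_mul, hG, hermitization, Matrix.fromBlocks_multiply,
    Matrix.fromBlocks_smul, sub_eq_iff_eq_add, ← Matrix.fromBlocks_one, Matrix.fromBlocks_add,
    Matrix.fromBlocks_inj] at h1
  obtain ⟨h11, -, h21, -⟩ := h1
  simp only [zero_mul, zero_add, add_zero] at h11 h21
  rw [sub_mul, mul_assoc, h21, Matrix.mul_smul, h11, smul_add, Matrix.smul_mul, one_mul, smul_smul,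
    pow_two, add_sub_cancel_right]

open scoped ComplexOrder in
/-- The Stieltjes transform of the empirical measure is the normalized trace of a block of the
resolvent of the Hermitization. -/
theorem empiricalStieltjes_sq_eq (B : Matrix ι ι ℂ) {w : ℂ} (hw : 0 < w.im) :
    w * empiricalStieltjes B (w ^ 2)
      = (Fintype.card ι : ℂ)⁻¹ * ∑ i, green (hermitization B) w (Sum.inl i) (Sum.inl i) := by
  set M : Matrix ι ι ℂ := Matrix.of
    (fun i j => green (hermitization B) w (Sum.inl i) (Sum.inl j)) with hM
  have h1 : (B * Bᴴ - w ^ 2 • 1) * M = w • 1 := green_hermitization_inl B hw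
  have hA := Matrix.isHermitian_mul_conjTranspose_self B
  -- Eigenvalues of BB* are nonnegative, so λ = w² would make w = ±√λ real.
  have hne : ∀ i, ((hA.eigenvalues i : ℂ) - w ^ 2) ≠ 0 := by
    intro i h
    have hps : 0 ≤ hA.eigenvalues i :=
      (Matrix.posSemidef_self_mul_conjTranspose B).eigenvalues_nonneg i
    have h2 : w ^ 2 - ((Real.sqrt (hA.eigenvalues i) : ℝ) : ℂ) ^ 2 = 0 := by
      rw [← Complex.ofReal_pow, Real.sq_sqrt hps]
      linear_combination -h
    rw [sq_sub_sq] at h2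
    rcases mul_eq_zero.mp h2 with h3 | h3 <;>
    · have := congrArg Complex.im h3
      simp at this
      linarith
  set U : Matrix ι ι ℂ := (hA.eigenvectorUnitary : Matrix ι ι ℂ) with hU
  have hUU : U * star U = 1 := by simp [hU]
  have hUU' : star U * U = 1 := by simp [hU]
  have hspec : B * Bᴴ = U * Matrix.diagonal (fun i => (hA.eigenvalues i : ℂ)) * star U := by
    have := hA.spectral_theorem
    rw [Unitary.conjStarAlgAut_apply] at this
    exact this
  have h3 : Matrix.diagonal (fun i => (hA.eigenvalues i : ℂ) - w ^ 2) * (star U * M * U)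
      = w • 1 := by
    have h4 : Matrix.diagonal (fun i => (hA.eigenvalues i : ℂ) - w ^ 2)
        = star U * (B * Bᴴ - w ^ 2 • 1) * U := by
      have h : star U * (B * Bᴴ - w ^ 2 • 1) * U = star U *
          (U * Matrix.diagonal (fun i => (hA.eigenvalues i : ℂ)) * star U - w ^ 2 • 1) * U := by
        rw [← hspec]
      rw [h, mul_sub, sub_mul, Matrix.mul_smul, Matrix.smul_mul, mul_one, hUU',
        mul_assoc, mul_assoc, hUU', mul_one, ← mul_assoc, hUU', one_mul]
      ext i j
      by_cases hij : i = j
      · subst hij; simp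
      · simp [hij]
    rw [h4]
    calc _ = star U * ((B * Bᴴ - w ^ 2 • 1) * (U * star U) * M) * U := by
          simp only [mul_assoc]
      _ = w • 1 := by
          rw [hUU, mul_one, h1, Matrix.mul_smul, Matrix.smul_mul, mul_one, hUU']
  have h5 : ∀ i, (star U * M * U) i i = w * ((hA.eigenvalues i : ℂ) - w ^ 2)⁻¹ := by
    intro i
    have := congrFun (congrFun h3 i) i
    rw [Matrix.diagonal_mul] at this
    simp only [Matrix.smul_apply, Matrix.one_apply_eq, smul_eq_mul, mul_one] at this
    rw [eq_mul_inv_iff_mul_eq₀ (hne i), mul_comm]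
    exact this
  have h6 : ∑ i, green (hermitization B) w (Sum.inl i) (Sum.inl i) = M.trace := by
    simp [Matrix.trace, hM]
  have h7 : M.trace = (star U * M * U).trace := by
    rw [mul_assoc, Matrix.trace_mul_comm, mul_assoc, hUU, mul_one]
  rw [h6, h7, empiricalStieltjes, Matrix.trace]
  simp only [Matrix.diag_apply, h5]
  rw [← Finset.mul_sum]
  ring

/-- The Schur complement formula for the pair of indices of the Hermitization belonging to `k`. -/
theorem hermitization_schur (B : Matrix ι ι ℂ) {w : ℂ} (hw : 0 < w.im) (k : ι)
    {R : Matrix (ι ⊕ ι) (ι ⊕ ι) ℂ}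
    (hR : R = green (zeroOut {Sum.inl k, Sum.inr k} (hermitization B)) w) :
    (-w - ∑ i : {i // i ≠ k}, ∑ j : {j // j ≠ k},
        B k i * R (Sum.inr i) (Sum.inr j) * star (B k j))
          * green (hermitization B) w (Sum.inl k) (Sum.inl k)
      + (B k k - ∑ i : {i // i ≠ k}, ∑ j : {j // j ≠ k},
        B k i * R (Sum.inr i) (Sum.inl j) * B j k)
          * green (hermitization B) w (Sum.inr k) (Sum.inl k) = 1 ∧
    (star (B k k) - ∑ i : {i // i ≠ k}, ∑ j : {j // j ≠ k},
        star (B i k) * R (Sum.inl i) (Sum.inr j) * star (B k j))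
          * green (hermitization B) w (Sum.inl k) (Sum.inl k)
      + (-w - ∑ i : {i // i ≠ k}, ∑ j : {j // j ≠ k},
        star (B i k) * R (Sum.inl i) (Sum.inl j) * B j k)
          * green (hermitization B) w (Sum.inr k) (Sum.inl k) = 0 := by
  have hH := isHermitian_hermitization B
  have hsum : ∀ F : ι ⊕ ι → ℂ, ∑ p ∈ ({Sum.inl k, Sum.inr k} : Finset (ι ⊕ ι))ᶜ, F p
      = ∑ i : {i // i ≠ k}, F (Sum.inl i) + ∑ i : {i // i ≠ k}, F (Sum.inr i) := by
    intro F
    have h1 : ∀ f : ι → ℂ, ∑ i : {i // i ≠ k}, f i = ∑ i, if i = k then 0 else f i := by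
      intro f
      rw [← Finset.sum_subtype (Finset.univ.filter fun i => i ≠ k) (by simp) f, Finset.sum_filter]
      exact Finset.sum_congr rfl fun i _ => by by_cases h : i = k <;> simp [h]
    have h2 := Fintype.sum_sum_type (Sum.elim (fun i => if i = k then 0 else F (Sum.inl i))
        (fun i => if i = k then 0 else F (Sum.inr i)))
    simp only [Sum.elim_inl, Sum.elim_inr] at h2
    rw [h1 fun i => F (Sum.inl i), h1 fun i => F (Sum.inr i), ← h2,
      ← Finset.sum_add_sum_compl {Sum.inl k, Sum.inr k}]
    rw [Finset.sum_eq_zero (s := {Sum.inl k, Sum.inr k}), zero_add]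
    · refine Finset.sum_congr rfl fun p hp => ?_
      rcases p with i | i
      · have : i ≠ k := by simpa using hp
        simp [this]
      · have : i ≠ k := by simpa using hp
        simp [this]
    · intro p hp
      simp only [Finset.mem_insert, Finset.mem_singleton] at hp
      rcases hp with rfl | rfl <;> simp
  have hne : (Sum.inl k : ι ⊕ ι) ∉ ({Sum.inr k} : Finset (ι ⊕ ι)) := by simp
  constructor
  · have := schur_complement hH hw {Sum.inl k, Sum.inr k} (p := Sum.inl k) (a := Sum.inl k)
      (by simp) (by simp)
    rw [Finset.sum_insert hne, Finset.sum_singleton, ← hR] at this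
    simp only [hsum] at this
    simpa using this
  · have := schur_complement hH hw {Sum.inl k, Sum.inr k} (p := Sum.inr k) (a := Sum.inl k)
      (by simp) (by simp)
    rw [Finset.sum_insert hne, Finset.sum_singleton, ← hR] at this
    simp only [hsum] at this
    simpa using this

end Hermitization

/-! ### Masked matrices with independent entries: independence, concentration, symmetry -/

section Model

/-- A subfamily of an i.i.d. family, in any order, is i.i.d. This serves both the relabelling
symmetry of the model and the passage from a full array to the entries inside the band. -/
theorem measurePreserving_precomp {I K E : Type*} [Fintype I] [Fintype K] [MeasurableSpace E]
    (μ : Measure E) [IsProbabilityMeasure μ] {e : K → I} (he : Function.Injective e) :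
    MeasurePreserving (fun (x : I → E) k => x (e k)) (Measure.pi fun _ : I => μ)
      (Measure.pi fun _ : K => μ) := by
  have hm : ∀ i : I, Measurable fun x : I → E => x i := fun i => measurable_pi_apply i
  refine ⟨measurable_pi_lambda _ fun k => hm _, ?_⟩
  have h1 : iIndepFun (fun (i : I) (x : I → E) => x i) (Measure.pi fun _ : I => μ) :=
    iIndepFun_pi (X := fun _ t => t) fun _ => aemeasurable_id
  have h2 := (iIndepFun_iff_map_fun_eq_pi_map (fun k => (hm (e k)).aemeasurable)).mp
    (h1.precomp he)
  rw [h2]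
  congr 1
  funext k
  exact (measurePreserving_eval (fun _ : I => μ) (e k)).map_eq

variable {ι : Type*} [Fintype ι] [DecidableEq ι]

/-- A vertex-transitive zero pattern with `c` positions in each row and each column. -/
structure RegularMask (adj : ι → ι → Prop) [DecidableRel adj] (c : ℕ) : Prop where
  row : ∀ i, (Finset.univ.filter fun j => adj i j).card = c
  col : ∀ j, (Finset.univ.filter fun i => adj i j).card = c
  trans : ∀ i j, ∃ τ : Equiv.Perm ι, τ i = j ∧ ∀ a b, adj (τ a) (τ b) ↔ adj a b

/-- The matrix with the entries `x` at the positions allowed by the mask, scaled and shifted. -/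
noncomputable def maskedMatrix (adj : ι → ι → Prop) [DecidableRel adj] (c : ℕ) (z : ℂ)
    (x : ι × ι → ℂ) : Matrix ι ι ℂ :=
  Matrix.of fun i j =>
    (if adj i j then ((Real.sqrt c : ℝ) : ℂ)⁻¹ * x (i, j) else 0) - if i = j then z else 0

/-- The resolvent of the Hermitization of the masked matrix. -/
noncomputable def maskedGreen (adj : ι → ι → Prop) [DecidableRel adj] (c : ℕ) (z w : ℂ)
    (x : ι × ι → ℂ) : Matrix (ι ⊕ ι) (ι ⊕ ι) ℂ :=
  green (hermitization (maskedMatrix adj c z x)) w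

/-- The resolvent after removal of the two indices belonging to `k`. -/
noncomputable def removedGreen (adj : ι → ι → Prop) [DecidableRel adj] (c : ℕ) (z w : ℂ) (k : ι)
    (x : ι × ι → ℂ) : Matrix (ι ⊕ ι) (ι ⊕ ι) ℂ :=
  green (zeroOut {Sum.inl k, Sum.inr k} (hermitization (maskedMatrix adj c z x))) w

/-- The matrix entries in row `k` or column `k`. -/
def cross (k : ι) : Finset (ι × ι) := Finset.univ.filter fun p => p.1 = k ∨ p.2 = k

variable {adj : ι → ι → Prop} [DecidableRel adj] {c : ℕ} {z w : ℂ}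

omit [Fintype ι] in
theorem continuous_hermitization_maskedMatrix :
    Continuous fun x => hermitization (maskedMatrix adj c z x) := by
  refine continuous_matrix fun p q => ?_
  rcases p with i | i <;> rcases q with j | j <;> simp only [hermitization_inl_inl,
    hermitization_inl_inr, hermitization_inr_inl, hermitization_inr_inr, maskedMatrix,
    Matrix.of_apply]
  · exact continuous_const
  · by_cases h : adj i j <;> simp only [h, if_true, if_false] <;> fun_prop
  · by_cases h : adj j i <;> simp only [h, if_true, if_false, RCLike.star_def] <;> fun_prop
  · exact continuous_const

theorem continuous_maskedGreen (hw : 0 < w.im) (p q : ι ⊕ ι) :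
    Continuous fun x => maskedGreen adj c z w x p q :=
  continuous_green continuous_hermitization_maskedMatrix
    (fun _ => isHermitian_hermitization _) hw p q

theorem continuous_removedGreen (hw : 0 < w.im) (k : ι) (p q : ι ⊕ ι) :
    Continuous fun x => removedGreen adj c z w k x p q := by
  refine continuous_green ?_ (fun _ => isHermitian_zeroOut (isHermitian_hermitization _) _) hw p q
  refine continuous_matrix fun i j => ?_
  simp only [zeroOut, Matrix.of_apply]
  split_ifs
  · exact continuous_const
  · exact continuous_hermitization_maskedMatrix.matrix_elem i j

theorem norm_maskedGreen_le (hw : 0 < w.im) (x : ι × ι → ℂ) (p q : ι ⊕ ι) :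
    ‖maskedGreen adj c z w x p q‖ ≤ 1 / w.im :=
  norm_green_le (isHermitian_hermitization _) hw p q

theorem norm_removedGreen_le (hw : 0 < w.im) (k : ι) (x : ι × ι → ℂ) (p q : ι ⊕ ι) :
    ‖removedGreen adj c z w k x p q‖ ≤ 1 / w.im :=
  norm_green_le (isHermitian_zeroOut (isHermitian_hermitization _) _) hw p q

/-- The independence behind the Schur complement: deleting both indices of `k` removes every entry
of row and column `k` from the matrix. -/
theorem removedGreen_piecewise (k : ι) (x y : ι × ι → ℂ) :
    removedGreen adj c z w k ((cross k).piecewise y x) = removedGreen adj c z w k x := by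
  unfold removedGreen
  congr 1
  ext p q
  simp only [zeroOut, Matrix.of_apply, Finset.mem_insert, Finset.mem_singleton]
  have h : ∀ i j, i ≠ k → j ≠ k →
      maskedMatrix adj c z ((cross k).piecewise y x) i j = maskedMatrix adj c z x i j := by
    intro i j hi hj
    have : (i, j) ∉ cross k := by simp [cross, hi, hj]
    simp [maskedMatrix, Finset.piecewise_eq_of_notMem _ _ _ this]
  rcases p with i | i <;> rcases q with j | j
  · simp
  · by_cases hi : i = k <;> by_cases hj : j = k <;> simp [hi, hj, h]
  · by_cases hi : i = k <;> by_cases hj : j = k <;> simp [hi, hj, h]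
  · simp

section Diag

/-- The removal of the two indices of `k` moves the diagonal of the resolvent by a bounded amount
in total. -/
theorem sum_norm_removedGreen_sub_le (hw : 0 < w.im) (k : ι) (x : ι × ι → ℂ) {F : ι → ι ⊕ ι}
    (hF : Function.Injective F) (hFk : ∀ i, i ≠ k → F i ≠ Sum.inl k ∧ F i ≠ Sum.inr k) :
    ∑ i : {i // i ≠ k}, ‖removedGreen adj c z w k x (F i) (F i)
      - maskedGreen adj c z w x (F i) (F i)‖ ≤ 2 / w.im := by
  set H := hermitization (maskedMatrix adj c z x)
  have hH : H.IsHermitian := isHermitian_hermitization _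
  have hH1 := isHermitian_zeroOut hH {Sum.inr k}
  have h1 := sum_norm_green_zeroOut_sub_le hH hw (Sum.inr k)
  have h2 := sum_norm_green_zeroOut_sub_le hH1 hw (Sum.inl k)
  have hz : zeroOut {Sum.inl k, Sum.inr k} H = zeroOut {Sum.inl k} (zeroOut {Sum.inr k} H) :=
    zeroOut_insert _ _ _
  have hsub : ∀ (f : ι ⊕ ι → ℝ) (p : ι ⊕ ι), (∀ q, 0 ≤ f q) → (p = Sum.inl k ∨ p = Sum.inr k) →
      ∑ i : {i // i ≠ k}, f (F i) ≤ ∑ q ∈ Finset.univ.erase p, f q := by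
    intro f p hf hp
    rw [← Finset.sum_image (f := f) (s := (Finset.univ : Finset {i // i ≠ k}))
      (g := fun i : {i // i ≠ k} => F i) (fun a _ b _ h => Subtype.ext (hF h))]
    refine Finset.sum_le_sum_of_subset_of_nonneg ?_ fun q _ _ => hf q
    intro q hq
    obtain ⟨i, -, rfl⟩ := Finset.mem_image.mp hq
    refine Finset.mem_erase.mpr ⟨?_, Finset.mem_univ _⟩
    rcases hp with rfl | rfl
    · exact (hFk i i.2).1
    · exact (hFk i i.2).2
  have h3 := hsub (fun q => ‖green (zeroOut {Sum.inr k} H) w q q - green H w q q‖) (Sum.inr k)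
    (fun q => norm_nonneg _) (Or.inr rfl)
  have h4 := hsub (fun q => ‖green (zeroOut {Sum.inl k} (zeroOut {Sum.inr k} H)) w q q
    - green (zeroOut {Sum.inr k} H) w q q‖) (Sum.inl k) (fun q => norm_nonneg _) (Or.inl rfl)
  have h5 : ∑ i : {i // i ≠ k}, ‖removedGreen adj c z w k x (F i) (F i)
      - maskedGreen adj c z w x (F i) (F i)‖
      ≤ ∑ i : {i // i ≠ k}, (‖green (zeroOut {Sum.inl k} (zeroOut {Sum.inr k} H)) w (F i) (F i)
        - green (zeroOut {Sum.inr k} H) w (F i) (F i)‖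
        + ‖green (zeroOut {Sum.inr k} H) w (F i) (F i) - green H w (F i) (F i)‖) := by
    refine Finset.sum_le_sum fun i _ => ?_
    rw [removedGreen, hz]
    exact norm_sub_le_norm_sub_add_norm_sub _ _ _
  rw [Finset.sum_add_distrib] at h5
  have : 2 / w.im = 1 / w.im + 1 / w.im := by ring
  linarith

variable {μ : Measure ℂ} [IsProbabilityMeasure μ]

theorem integrable_maskedGreen (hw : 0 < w.im) (p q : ι ⊕ ι) :
    Integrable (fun x => maskedGreen adj c z w x p q) (Measure.pi fun _ : ι × ι => μ) :=
  integrable_of_bounded (continuous_maskedGreen hw p q).measurable.aestronglyMeasurable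
    fun x => norm_maskedGreen_le hw x p q

/-- Concentration of weighted sums of diagonal entries of the resolvent. -/
theorem integral_norm_pow_sum_maskedGreen_le [Nonempty ι] (hw : 0 < w.im) {F : ι → ι ⊕ ι}
    (hF : Function.Injective F) (a : ι → ℂ) {α : ℝ} (hα : 0 < α) (ha : ∀ i, ‖a i‖ ≤ α) (p : ℕ) :
    ∫ x, ‖∑ i, a i * maskedGreen adj c z w x (F i) (F i)
        - ∑ i, a i * ∫ y, maskedGreen adj c z w y (F i) (F i) ∂(Measure.pi fun _ : ι × ι => μ)‖
          ^ (2 * p) ∂(Measure.pi fun _ : ι × ι => μ)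
      ≤ 8 * 2 ^ p * (2 * p).factorial * (Fintype.card ι * (4 * α / w.im) ^ 2) ^ p := by
  have hm : Measurable fun x => ∑ i, a i * maskedGreen adj c z w x (F i) (F i) :=
    Finset.measurable_sum _ fun i _ => (continuous_maskedGreen hw _ _).measurable.const_mul _
  have hb : ∀ x, ‖∑ i, a i * maskedGreen adj c z w x (F i) (F i)‖
      ≤ ∑ _i : ι, α * (1 / w.im) := fun x => by
    refine (norm_sum_le _ _).trans (Finset.sum_le_sum fun i _ => ?_)
    rw [norm_mul]
    gcongr
    · exact ha i
    · exact norm_maskedGreen_le hw x _ _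
  have key := integral_norm_pow_le_of_bounded_difference (μ := μ) (Prod.snd : ι × ι → ι)
    (c := 4 * α / w.im) (by positivity) hm hb ?_ p
  · have h1 : ∫ y, ∑ i, a i * maskedGreen adj c z w y (F i) (F i) ∂(Measure.pi fun _ : ι × ι => μ)
        = ∑ i, a i * ∫ y, maskedGreen adj c z w y (F i) (F i) ∂(Measure.pi fun _ : ι × ι => μ) := by
      rw [integral_finsetSum _ fun i _ => (integrable_maskedGreen hw _ _).const_mul _]
      exact Finset.sum_congr rfl fun i _ => integral_const_mul _ _
    rw [h1] at key
    exact key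
  -- Entries are grouped by columns of B. Column `k` enters the Hermitization only through row and
  -- column `Sum.inr k`.
  · intro k x y hxy
    have hz : zeroOut {Sum.inr k} (hermitization (maskedMatrix adj c z x))
        = zeroOut {Sum.inr k} (hermitization (maskedMatrix adj c z y)) := by
      have h : ∀ i j, j ≠ k → maskedMatrix adj c z x i j = maskedMatrix adj c z y i j := by
        intro i j hj
        simp [maskedMatrix, hxy (i, j) hj]
      ext p q
      rcases p with i | i <;> rcases q with j | j <;> simp only [zeroOut, Matrix.of_apply,
        Finset.mem_singleton, hermitization_inl_inl, hermitization_inl_inr, hermitization_inr_inl,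
        hermitization_inr_inr]
      · by_cases hj : j = k
        · simp [hj]
        · rw [h i j hj]
      · by_cases hi : i = k
        · simp [hi]
        · rw [h j i hi]
    have h1 := sum_norm_green_diag_sub_le (isHermitian_hermitization (maskedMatrix adj c z x))
      (isHermitian_hermitization (maskedMatrix adj c z y)) hw (Sum.inr k) hz
    rw [← Finset.sum_sub_distrib]
    calc _ ≤ ∑ i, α * ‖maskedGreen adj c z w x (F i) (F i)
            - maskedGreen adj c z w y (F i) (F i)‖ := by
          refine (norm_sum_le _ _).trans (Finset.sum_le_sum fun i _ => ?_)
          rw [← mul_sub, norm_mul]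
          gcongr
          exact ha i
      _ ≤ α * ∑ p, ‖maskedGreen adj c z w x p p - maskedGreen adj c z w y p p‖ := by
          rw [← Finset.mul_sum, ← Finset.sum_image (f := fun p => ‖maskedGreen adj c z w x p p
            - maskedGreen adj c z w y p p‖) (s := Finset.univ) (g := F) (fun a _ b _ h => hF h)]
          gcongr
          exact Finset.subset_univ _
      _ ≤ α * (4 / w.im) := by gcongr; exact h1
      _ = _ := by ring

theorem maskedGreen_comp_perm (τ : Equiv.Perm ι) (hτ : ∀ a b, adj (τ a) (τ b) ↔ adj a b)
    (x : ι × ι → ℂ) :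
    maskedGreen adj c z w (fun p => x (τ p.1, τ p.2))
      = (maskedGreen adj c z w x).submatrix (Equiv.sumCongr τ τ) (Equiv.sumCongr τ τ) := by
  rw [maskedGreen, maskedGreen, ← green_submatrix]
  congr 1
  ext p q
  rcases p with i | i <;> rcases q with j | j <;> simp [maskedMatrix, hτ]

variable (hmask : RegularMask adj c)

-- Relabelling rows and columns by an automorphism of the mask preserves the law of the i.i.d. array
-- and permutes the diagonal; automorphisms act transitively.
include hmask in
theorem integral_maskedGreen_eq (hw : 0 < w.im) (i j : ι) :
    ∫ x, maskedGreen adj c z w x (Sum.inl i) (Sum.inl i) ∂(Measure.pi fun _ : ι × ι => μ)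
      = ∫ x, maskedGreen adj c z w x (Sum.inl j) (Sum.inl j) ∂(Measure.pi fun _ : ι × ι => μ) ∧
    ∫ x, maskedGreen adj c z w x (Sum.inr i) (Sum.inr i) ∂(Measure.pi fun _ : ι × ι => μ)
      = ∫ x, maskedGreen adj c z w x (Sum.inr j) (Sum.inr j) ∂(Measure.pi fun _ : ι × ι => μ) := by
  obtain ⟨τ, hij, hτ⟩ := hmask.trans i j
  have hmp := measurePreserving_precomp μ (e := fun p : ι × ι => (τ p.1, τ p.2))
    (fun p q h => by
      rw [Prod.mk.injEq] at h
      exact Prod.ext (τ.injective h.1) (τ.injective h.2))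
  have hcomp : ∀ p, ∫ x, maskedGreen adj c z w x p p ∂(Measure.pi fun _ : ι × ι => μ)
      = ∫ x, maskedGreen adj c z w (fun p => x (τ p.1, τ p.2)) p p
        ∂(Measure.pi fun _ : ι × ι => μ) := fun p => by
    have := integral_map (f := fun x => maskedGreen adj c z w x p p) hmp.measurable.aemeasurable
      (by rw [hmp.map_eq]; exact (integrable_maskedGreen hw p p).aestronglyMeasurable)
    rw [hmp.map_eq] at this
    exact this
  constructor
  · rw [hcomp]
    simp only [maskedGreen_comp_perm τ hτ, Matrix.submatrix_apply, Equiv.sumCongr_apply,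
      Sum.map_inl, hij]
  · rw [hcomp]
    simp only [maskedGreen_comp_perm τ hτ, Matrix.submatrix_apply, Equiv.sumCongr_apply,
      Sum.map_inr, hij]

-- The two block traces agree pathwise, and within each block all expected diagonal entries agree;
-- dividing by the dimension identifies the two values.
include hmask in
theorem integral_maskedGreen_inr (hw : 0 < w.im) (i j : ι) :
    ∫ x, maskedGreen adj c z w x (Sum.inr i) (Sum.inr i) ∂(Measure.pi fun _ : ι × ι => μ)
      = ∫ x, maskedGreen adj c z w x (Sum.inl j) (Sum.inl j) ∂(Measure.pi fun _ : ι × ι => μ) := by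
  have h : ∫ x, ∑ i, maskedGreen adj c z w x (Sum.inl i) (Sum.inl i)
        ∂(Measure.pi fun _ : ι × ι => μ)
      = ∫ x, ∑ i, maskedGreen adj c z w x (Sum.inr i) (Sum.inr i)
        ∂(Measure.pi fun _ : ι × ι => μ) :=
    integral_congr_ae (Filter.Eventually.of_forall fun x => sum_green_inl_eq_sum_green_inr _ hw)
  rw [integral_finsetSum _ fun i _ => integrable_maskedGreen hw _ _,
    integral_finsetSum _ fun i _ => integrable_maskedGreen hw _ _,
    Finset.sum_congr rfl fun a _ => (integral_maskedGreen_eq hmask hw a j).1,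
    Finset.sum_congr rfl fun a _ => (integral_maskedGreen_eq hmask hw a i).2,
    Finset.sum_const, Finset.sum_const, nsmul_eq_mul, nsmul_eq_mul] at h
  have hn : ((Finset.univ : Finset ι).card : ℂ) ≠ 0 := by
    have : (Finset.univ : Finset ι).card ≠ 0 := Finset.card_ne_zero_of_mem (Finset.mem_univ i)
    exact_mod_cast this
  exact (mul_left_cancel₀ hn h).symm

end Diag

end Model

/-! ### Second moments of the errors in the Schur complement -/

section SelfConsistent

variable {ι : Type*} [Fintype ι] [DecidableEq ι]
variable {adj : ι → ι → Prop} [DecidableRel adj] {c : ℕ} {z w : ℂ} {k : ι}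

/-- The normalized entries of the resolvent after removal of `k`, restricted to the indices
selected by `nb` and `nb'`. -/
noncomputable def removedCoeff (adj : ι → ι → Prop) [DecidableRel adj] (c : ℕ) (z w : ℂ) (k : ι)
    (nb nb' : ι → Prop) [DecidablePred nb] [DecidablePred nb'] (F F' : ι → ι ⊕ ι)
    (x : ι × ι → ℂ) (i j : {i // i ≠ k}) : ℂ :=
  if nb i ∧ nb' j then (c : ℂ)⁻¹ * removedGreen adj c z w k x (F i) (F' j) else 0

variable {nb nb' : ι → Prop} [DecidablePred nb] [DecidablePred nb'] {F F' : ι → ι ⊕ ι}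

theorem measurable_removedCoeff (hw : 0 < w.im) (i j : {i // i ≠ k}) :
    Measurable fun x => removedCoeff adj c z w k nb nb' F F' x i j := by
  unfold removedCoeff
  split_ifs
  · exact (continuous_removedGreen hw k _ _).measurable.const_mul _
  · exact measurable_const

theorem norm_removedCoeff_le (hw : 0 < w.im) (x : ι × ι → ℂ) (i j : {i // i ≠ k}) :
    ‖removedCoeff adj c z w k nb nb' F F' x i j‖ ≤ ‖(c : ℂ)⁻¹‖ * (1 / w.im) := by
  unfold removedCoeff
  split_ifs
  · rw [norm_mul]
    gcongr
    exact norm_removedGreen_le hw k x _ _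
  · rw [norm_zero]; positivity

theorem removedCoeff_piecewise (x y : ι × ι → ℂ) :
    removedCoeff adj c z w k nb nb' F F' ((cross k).piecewise y x)
      = removedCoeff adj c z w k nb nb' F F' x := by
  funext i j
  rw [removedCoeff, removedGreen_piecewise, removedCoeff]

/-- At most c rows contribute, and Ward's identity bounds each by 1 / (Im w)² before the factor 1 /
c². -/
theorem sum_norm_sq_removedCoeff_le (hw : 0 < w.im) (hc : 0 < c)
    (hnb : (Finset.univ.filter nb).card = c) (hF' : Function.Injective F') (x : ι × ι → ℂ) :
    ∑ i, ∑ j, ‖removedCoeff adj c z w k nb nb' F F' x i j‖ ^ 2 ≤ 1 / (c * w.im ^ 2) := by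
  have hc' : (0 : ℝ) < c := by exact_mod_cast hc
  have h1 : ∀ i : {i // i ≠ k}, ∑ j, ‖removedCoeff adj c z w k nb nb' F F' x i j‖ ^ 2
      ≤ if nb i then ((c : ℝ) ^ 2)⁻¹ * (1 / w.im ^ 2) else 0 := by
    intro i
    by_cases hi : nb i
    · rw [if_pos hi]
      have h2 : ∑ p, ‖removedGreen adj c z w k x (F i) p‖ ^ 2 ≤ 1 / w.im ^ 2 :=
        sum_norm_sq_green_row_le (isHermitian_zeroOut (isHermitian_hermitization _) _) hw _
      calc _ ≤ ∑ j : {i // i ≠ k},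
            ((c : ℝ) ^ 2)⁻¹ * ‖removedGreen adj c z w k x (F i) (F' j)‖ ^ 2 := by
            refine Finset.sum_le_sum fun j _ => ?_
            unfold removedCoeff
            split_ifs
            · rw [norm_mul, mul_pow, norm_inv, Complex.norm_natCast, inv_pow]
            · rw [norm_zero, zero_pow two_ne_zero]; positivity
        _ ≤ ((c : ℝ) ^ 2)⁻¹ * ∑ p, ‖removedGreen adj c z w k x (F i) p‖ ^ 2 := by
            rw [← Finset.mul_sum, ← Finset.sum_image
              (f := fun p => ‖removedGreen adj c z w k x (F i) p‖ ^ 2) (s := Finset.univ)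
              (g := fun j : {i // i ≠ k} => F' j) (fun a _ b _ h => Subtype.ext (hF' h))]
            gcongr
            exact Finset.subset_univ _
        _ ≤ _ := by gcongr
    · simp [removedCoeff, hi]
  have h3 : ∑ i : {i // i ≠ k}, (if nb i then ((c : ℝ) ^ 2)⁻¹ * (1 / w.im ^ 2) else 0)
      ≤ ∑ i : ι, if nb i then ((c : ℝ) ^ 2)⁻¹ * (1 / w.im ^ 2) else 0 := by
    rw [← Finset.sum_subtype (Finset.univ.filter fun i => i ≠ k) (by simp)
      fun i => if nb i then ((c : ℝ) ^ 2)⁻¹ * (1 / w.im ^ 2) else 0]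
    refine Finset.sum_le_sum_of_subset_of_nonneg (Finset.filter_subset _ _) fun i _ _ => ?_
    split_ifs <;> positivity
  refine (Finset.sum_le_sum fun i _ => h1 i).trans (h3.trans_eq ?_)
  rw [← Finset.sum_filter, Finset.sum_const, hnb, nsmul_eq_mul]
  field_simp

variable {μ : Measure ℂ} [IsProbabilityMeasure μ]
variable (h4 : MemLp id 4 μ) (h1 : ∫ t, t ∂μ = 0) (h2 : ∫ t, ‖t‖ ^ 2 ∂μ = 1)

include h4 h1 h2 in
/-- The diagonal entries of the Schur complement are close to their averaged value. -/
theorem integral_norm_sq_diag_error_le (hw : 0 < w.im) (hc : 0 < c)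
    (hF : Function.Injective F) (hFk : ∀ i, i ≠ k → F i ≠ Sum.inl k ∧ F i ≠ Sum.inr k)
    (hnb : (Finset.univ.filter nb).card = c) {e : {i // i ≠ k} → ι × ι}
    (he : Function.Injective e) (heT : ∀ j, e j ∈ cross k) {s : ℂ}
    (hs : ∀ i, ∫ x, maskedGreen adj c z w x (F i) (F i) ∂(Measure.pi fun _ : ι × ι => μ) = s)
    {D : (ι × ι → ℂ) → {i // i ≠ k} → {i // i ≠ k} → ℂ}
    (hm : ∀ i j, Measurable fun x => D x i j) {M : ℝ} (hM : ∀ x i j, ‖D x i j‖ ≤ M)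
    (hD : ∀ x y, D ((cross k).piecewise y x) = D x)
    (hb : ∀ x, ∑ i, ∑ j, ‖D x i j‖ ^ 2 ≤ 1 / (c * w.im ^ 2))
    (hdiag : ∀ x i, D x i i = removedCoeff adj c z w k nb nb F F x i i) :
    MemLp (fun x => s - ∑ i, ∑ j, D x i j * (x (e i) * star (x (e j)))) 2
        (Measure.pi fun _ : ι × ι => μ) ∧
    ∫ x, ‖s - ∑ i, ∑ j, D x i j * (x (e i) * star (x (e j)))‖ ^ 2
        ∂(Measure.pi fun _ : ι × ι => μ)
      ≤ 1569 * ((∫ t, ‖t‖ ^ 4 ∂μ) * Fintype.card ι / (c : ℝ) ^ 2) / w.im ^ 2 := by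
  have : Nonempty ι := ⟨k⟩
  set π := Measure.pi fun _ : ι × ι => μ with hπ
  set ω := ∫ t, ‖t‖ ^ 4 ∂μ with hω
  have hω1 : 1 ≤ ω := one_le_fourth_moment h4 h2
  have hc' : (0 : ℝ) < c := by exact_mod_cast hc
  have hcC : (c : ℂ) ≠ 0 := by exact_mod_cast hc.ne'
  have hcn : (c : ℝ) ≤ Fintype.card ι := by
    rw [← hnb]
    exact_mod_cast Finset.card_le_univ _
  set a : ι → ℂ := fun i => if nb i then (c : ℂ)⁻¹ else 0 with ha
  have hasum : ∑ i, a i = 1 := by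
    rw [ha, ← Finset.sum_filter, Finset.sum_const, hnb, nsmul_eq_mul, mul_inv_cancel₀ hcC]
  have hale : ∀ i, ‖a i‖ ≤ (c : ℝ)⁻¹ := by
    intro i
    simp only [ha]
    split_ifs
    · simp
    · simp
  set A : (ι × ι → ℂ) → ℂ := fun x => ∑ i, a i * maskedGreen adj c z w x (F i) (F i)
  set Q : (ι × ι → ℂ) → ℂ := fun x =>
    ∑ i, ∑ j, D x i j * (x (e i) * star (x (e j)) - if i = j then 1 else 0)
  -- Concentration with weights 1 / c at p = 1; 512 = 8 · 2 · 2! · 4². Averaging over only c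
  -- neighbours while n columns fluctuate is the source of n / c².
  have hA : ∫ x, ‖A x - s‖ ^ 2 ∂π ≤ 512 * (Fintype.card ι / (c : ℝ) ^ 2) / w.im ^ 2 := by
    have := integral_norm_pow_sum_maskedGreen_le (adj := adj) (c := c) (z := z) (μ := μ) hw hF a
      (inv_pos.mpr hc') hale 1
    simp only [← hπ, hs, ← Finset.sum_mul, hasum, one_mul] at this
    refine this.trans_eq ?_
    norm_num [Nat.factorial]
    field_simp
    norm_num
  have hQ : ∫ x, ‖Q x‖ ^ 2 ∂π ≤ 2 * ω * (1 / (c * w.im ^ 2)) :=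
    integral_norm_sq_quadratic_resample_le h4 h1 h2 (cross k) e he heT D hm hM hD hb
  have hQL : MemLp Q 2 π := memLp_quadratic h4 e D hm hM
  have hAc : Measurable A :=
    Finset.measurable_sum _ fun i _ => (continuous_maskedGreen hw _ _).measurable.const_mul _
  have hAb : ∀ x, ‖A x‖ ≤ ∑ _i : ι, (c : ℝ)⁻¹ * (1 / w.im) := fun x => by
    refine (norm_sum_le _ _).trans (Finset.sum_le_sum fun i _ => ?_)
    rw [norm_mul]
    gcongr
    · exact hale i
    · exact norm_maskedGreen_le hw x _ _
  have hAL : MemLp A 2 π := MemLp.of_bound hAc.aestronglyMeasurable _ (Filter.Eventually.of_forall hAb)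
  set Dg : (ι × ι → ℂ) → ℂ := fun x => ∑ i, D x i i
  have hDL : MemLp Dg 2 π := memLp_finsetSum _ fun i _ =>
    MemLp.of_bound (hm i i).aestronglyMeasurable M (Filter.Eventually.of_forall fun x => hM x i i)
  have hsplit : ∀ x, s - ∑ i, ∑ j, D x i j * (x (e i) * star (x (e j)))
      = s - Dg x - Q x := by
    intro x
    have : Q x = ∑ i, ∑ j, D x i j * (x (e i) * star (x (e j))) - Dg x := by
      simp only [Q, Dg, mul_sub, Finset.sum_sub_distrib, mul_ite, mul_one, mul_zero,
        Finset.sum_ite_eq, Finset.mem_univ, if_true]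
    rw [this]; ring
  -- One unit accounts for the missing index `k` and two for the removal of its two rows and
  -- columns.
  have hAD : ∀ x, ‖A x - Dg x‖ ≤ 3 / (c * w.im) := by
    intro x
    have e1 : A x = a k * maskedGreen adj c z w x (F k) (F k)
        + ∑ i : {i // i ≠ k}, a i * maskedGreen adj c z w x (F i) (F i) := by
      simp only [A]
      rw [← Finset.add_sum_erase _ _ (Finset.mem_univ k)]
      congr 1
      exact Finset.sum_subtype _ (by simp) fun i => a i * maskedGreen adj c z w x (F i) (F i)
    have e2 : Dg x = ∑ i : {i // i ≠ k}, a i * removedGreen adj c z w k x (F i) (F i) := by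
      simp only [Dg]
      refine Finset.sum_congr rfl fun i _ => ?_
      rw [hdiag, removedCoeff]
      by_cases hi : nb i <;> simp [ha, hi]
    rw [e1, e2, add_sub_assoc, ← Finset.sum_sub_distrib]
    have e3 := sum_norm_removedGreen_sub_le (adj := adj) (c := c) (z := z) hw k x hF hFk
    calc _ ≤ (c : ℝ)⁻¹ * (1 / w.im) + ∑ i : {i // i ≠ k},
          (c : ℝ)⁻¹ * ‖removedGreen adj c z w k x (F i) (F i)
            - maskedGreen adj c z w x (F i) (F i)‖ := by
          refine (norm_add_le _ _).trans (add_le_add ?_ ((norm_sum_le _ _).trans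
            (Finset.sum_le_sum fun i _ => ?_)))
          · rw [norm_mul]
            gcongr
            · exact hale k
            · exact norm_maskedGreen_le hw x _ _
          · rw [← mul_sub, norm_mul, norm_sub_rev]
            gcongr
            exact hale i
      _ ≤ (c : ℝ)⁻¹ * (1 / w.im) + (c : ℝ)⁻¹ * (2 / w.im) := by
          rw [← Finset.mul_sum]
          gcongr
      _ = _ := by field_simp; norm_num
  have hL : MemLp (fun x => s - Dg x - Q x) 2 π := ((memLp_const s).sub hDL).sub hQL
  simp only [hsplit]
  refine ⟨hL, ?_⟩
  have iA : Integrable (fun x => ‖A x - s‖ ^ 2) π :=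
    (hAL.sub (memLp_const s)).integrable_norm_pow two_ne_zero
  have iQ : Integrable (fun x => ‖Q x‖ ^ 2) π := hQL.integrable_norm_pow two_ne_zero
  -- Three errors: `A - s` is concentration, `A - Dg` is the removal of `k`, and `Q` is the centered
  -- quadratic form.
  have hpt : ∀ x, ‖s - Dg x - Q x‖ ^ 2
      ≤ 3 * (‖A x - s‖ ^ 2 + (3 / (c * w.im)) ^ 2 + ‖Q x‖ ^ 2) := by
    intro x
    have e1 : ‖s - Dg x - Q x‖ ≤ ‖A x - s‖ + 3 / (c * w.im) + ‖Q x‖ := by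
      have : s - Dg x - Q x = (A x - Dg x) - (A x - s) - Q x := by ring
      rw [this]
      refine (norm_sub_le _ _).trans ?_
      gcongr
      refine (norm_sub_le _ _).trans ?_
      linarith [hAD x]
    have e2 : ‖s - Dg x - Q x‖ ^ 2 ≤ (‖A x - s‖ + 3 / (c * w.im) + ‖Q x‖) ^ 2 := by gcongr
    refine e2.trans ?_
    nlinarith [sq_nonneg (‖A x - s‖ - 3 / (c * w.im)), sq_nonneg (‖A x - s‖ - ‖Q x‖),
      sq_nonneg (3 / (c * w.im) - ‖Q x‖)]
  calc _ ≤ ∫ x, 3 * (‖A x - s‖ ^ 2 + (3 / (c * w.im)) ^ 2 + ‖Q x‖ ^ 2) ∂π :=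
        integral_mono (hL.integrable_norm_pow two_ne_zero)
          (((iA.add (integrable_const _)).add iQ).const_mul 3) hpt
    _ = 3 * ((∫ x, ‖A x - s‖ ^ 2 ∂π) + (3 / (c * w.im)) ^ 2 + ∫ x, ‖Q x‖ ^ 2 ∂π) := by
        rw [integral_const_mul, integral_add
          (f := fun x => ‖A x - s‖ ^ 2 + (3 / (c * w.im)) ^ 2) (iA.add (integrable_const _)) iQ,
          integral_add iA (integrable_const _)]
        simp
    _ ≤ 3 * (512 * (Fintype.card ι / (c : ℝ) ^ 2) / w.im ^ 2 + (3 / (c * w.im)) ^ 2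
        + 2 * ω * (1 / (c * w.im ^ 2))) := by gcongr
    _ = 3 * (512 * Fintype.card ι + 9 + 2 * ω * c) / ((c : ℝ) ^ 2 * w.im ^ 2) := by
        field_simp; ring
    -- Since 1 ≤ ω and c ≤ n, every term is at most a multiple of ω n; 1569 = 3 (512 + 9 + 2).
    _ ≤ 3 * (512 * (ω * Fintype.card ι) + 9 * (ω * Fintype.card ι) + 2 * (ω * Fintype.card ι))
          / ((c : ℝ) ^ 2 * w.im ^ 2) := by
        have hn1 : (1 : ℝ) ≤ Fintype.card ι := le_trans (by exact_mod_cast hc) hcn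
        have : (Fintype.card ι : ℝ) ≤ ω * Fintype.card ι := by nlinarith
        have : 2 * ω * c ≤ 2 * (ω * Fintype.card ι) := by nlinarith
        gcongr ?_ / _
        linarith
    _ = _ := by field_simp; ring

include h4 h1 h2 in
/-- The off-diagonal entries of the Schur complement are small. -/
theorem integral_norm_sq_offDiag_error_le (hw : 0 < w.im) (hc : 0 < c)
    (hcn : (c : ℝ) ≤ Fintype.card ι) {e e' : {i // i ≠ k} → ι × ι}
    (he : Function.Injective e) (he' : Function.Injective e') (hd : ∀ j l, e j ≠ e' l)
    (heT : ∀ j, e j ∈ cross k) (heT' : ∀ j, e' j ∈ cross k) (P : Prop) [Decidable P]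
    {D : (ι × ι → ℂ) → {i // i ≠ k} → {i // i ≠ k} → ℂ}
    (hm : ∀ i j, Measurable fun x => D x i j) {M : ℝ} (hM : ∀ x i j, ‖D x i j‖ ≤ M)
    (hD : ∀ x y, D ((cross k).piecewise y x) = D x)
    (hb : ∀ x, ∑ i, ∑ j, ‖D x i j‖ ^ 2 ≤ 1 / (c * w.im ^ 2)) :
    MemLp (fun x => (if P then ((Real.sqrt c : ℝ) : ℂ)⁻¹ * x (k, k) else 0)
        - ∑ i, ∑ j, D x i j * (x (e i) * x (e' j))) 2 (Measure.pi fun _ : ι × ι => μ) ∧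
    ∫ x, ‖(if P then ((Real.sqrt c : ℝ) : ℂ)⁻¹ * x (k, k) else 0)
        - ∑ i, ∑ j, D x i j * (x (e i) * x (e' j))‖ ^ 2 ∂(Measure.pi fun _ : ι × ι => μ)
      ≤ 4 * (1 + 1 / w.im ^ 2) * ((∫ t, ‖t‖ ^ 4 ∂μ) * Fintype.card ι / (c : ℝ) ^ 2) := by
  set π := Measure.pi fun _ : ι × ι => μ with hπ
  set ω := ∫ t, ‖t‖ ^ 4 ∂μ with hω
  have hω1 : 1 ≤ ω := one_le_fourth_moment h4 h2
  have hc' : (0 : ℝ) < c := by exact_mod_cast hc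
  set X : (ι × ι → ℂ) → ℂ := fun x => if P then ((Real.sqrt c : ℝ) : ℂ)⁻¹ * x (k, k) else 0
  set Q : (ι × ι → ℂ) → ℂ := fun x => ∑ i, ∑ j, D x i j * (x (e i) * x (e' j))
  have hQ : ∫ x, ‖Q x‖ ^ 2 ∂π ≤ 2 * (1 / (c * w.im ^ 2)) :=
    integral_norm_sq_bilinear_resample_le h4 h1 h2 (cross k) e e' he he' hd heT heT' D hm hM hD hb
  have hQL : MemLp Q 2 π := memLp_bilinear h4 e e' D hm hM
  have hx2 : MemLp (fun x : ι × ι → ℂ => x (k, k)) 2 π :=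
    memLp_eval (h4.mono_exponent (by norm_num)) _
  have hXL : MemLp X 2 π := by
    by_cases hP : P
    · simp only [X, hP, if_true]
      exact hx2.const_mul _
    · simp only [X, hP, if_false]
      exact memLp_const 0
  have hX : ∫ x, ‖X x‖ ^ 2 ∂π ≤ 1 / c := by
    by_cases hP : P
    · have : ∀ x, ‖X x‖ ^ 2 = (c : ℝ)⁻¹ * ‖x (k, k)‖ ^ 2 := by
        intro x
        simp only [X, hP, if_true]
        rw [norm_mul, mul_pow, norm_inv, Complex.norm_real, Real.norm_eq_abs, inv_pow, sq_abs,
          Real.sq_sqrt hc'.le]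
      simp only [this]
      rw [integral_const_mul, integral_eval (g := fun t : ℂ => ‖t‖ ^ 2)
        (Measurable.stronglyMeasurable (by fun_prop)), h2]
      simp
    · simp only [X, hP, if_false]
      simp
  refine ⟨hXL.sub hQL, ?_⟩
  have iX := hXL.integrable_norm_pow two_ne_zero
  have iQ := hQL.integrable_norm_pow two_ne_zero
  calc _ ≤ ∫ x, 2 * (‖X x‖ ^ 2 + ‖Q x‖ ^ 2) ∂π := by
        refine integral_mono ((hXL.sub hQL).integrable_norm_pow two_ne_zero)
          ((iX.add iQ).const_mul 2) fun x => ?_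
        have e1 : ‖X x - Q x‖ ^ 2 ≤ (‖X x‖ + ‖Q x‖) ^ 2 := by
          gcongr
          exact norm_sub_le _ _
        refine e1.trans ?_
        nlinarith [sq_nonneg (‖X x‖ - ‖Q x‖)]
    _ ≤ 2 * (1 / c + 2 * (1 / (c * w.im ^ 2))) := by
        rw [integral_const_mul, integral_add iX iQ]
        gcongr
    _ ≤ 4 * (1 + 1 / w.im ^ 2) * (1 / c) := by
        have e1 : 1 / (c * w.im ^ 2) = 1 / w.im ^ 2 * (1 / c) := by field_simp
        rw [e1]
        have : 0 < 1 / (c : ℝ) := by positivity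
        nlinarith
    _ ≤ _ := by
        refine mul_le_mul_of_nonneg_left ?_ (by positivity)
        rw [div_le_div_iff₀ hc' (by positivity)]
        have : (c : ℝ) ≤ ω * Fintype.card ι := by nlinarith
        nlinarith

end SelfConsistent

/-! ### The approximate fixed point equation for the expected resolvent -/

section SelfConsistent

variable {ι : Type*} [Fintype ι] [DecidableEq ι]
variable {adj : ι → ι → Prop} [DecidableRel adj] {c : ℕ} {z w : ℂ} {k : ι}
variable {μ : Measure ℂ} [IsProbabilityMeasure μ]

theorem im_integral_maskedGreen_pos (hw : 0 < w.im) (p : ι ⊕ ι) :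
    0 < (∫ x, maskedGreen adj c z w x p p ∂(Measure.pi fun _ : ι × ι => μ)).im := by
  have hi := integrable_maskedGreen (adj := adj) (c := c) (z := z) (μ := μ) hw p p
  have h : (∫ x, maskedGreen adj c z w x p p ∂(Measure.pi fun _ : ι × ι => μ)).im
      = ∫ x, (maskedGreen adj c z w x p p).im ∂(Measure.pi fun _ : ι × ι => μ) :=
    (integral_im hi).symm
  have hpos : ∀ x, 0 < (maskedGreen adj c z w x p p).im := fun x =>
    im_green_diag_pos (isHermitian_hermitization _) hw p
  rw [h, integral_pos_iff_support_of_nonneg (fun x => (hpos x).le) hi.im]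
  have : Function.support (fun x => (maskedGreen adj c z w x p p).im) = Set.univ := by
    ext x; simp [(hpos x).ne']
  rw [this]
  simp

theorem integral_le_sqrt_of_integral_sq_le {X : Type*} [MeasurableSpace X] {P : Measure X}
    [IsProbabilityMeasure P] {f : X → ℝ} (hf : Integrable f P)
    (hf2 : Integrable (fun x => f x ^ 2) P) {Z : ℝ} (hZ : 0 < Z) (h : ∫ x, f x ^ 2 ∂P ≤ Z) :
    ∫ x, f x ∂P ≤ Real.sqrt Z := by
  have ht : 0 < Real.sqrt Z := Real.sqrt_pos.mpr hZ
  have h1 : ∫ x, f x ∂P ≤ ∫ x, (f x ^ 2 / (2 * Real.sqrt Z) + Real.sqrt Z / 2) ∂P := by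
    refine integral_mono hf ((hf2.div_const _).add (integrable_const _)) fun x => ?_
    simp only
    rw [div_add_div _ _ (by positivity) (by positivity), le_div_iff₀ (by positivity)]
    nlinarith [sq_nonneg (f x - Real.sqrt Z)]
  rw [integral_add (hf2.div_const _) (integrable_const _), integral_div] at h1
  simp only [integral_const, probReal_univ, one_smul] at h1
  refine h1.trans ?_
  rw [div_add_div _ _ (by positivity) (by positivity), div_le_iff₀ (by positivity)]
  nlinarith [Real.sq_sqrt hZ.le]

variable (h4 : MemLp id 4 μ) (h1 : ∫ t, t ∂μ = 0) (h2 : ∫ t, ‖t‖ ^ 2 ∂μ = 1)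

include h4 h1 h2 in
/-- The expected diagonal entry of the resolvent is an approximate fixed point. -/
theorem norm_integral_maskedGreen_sub_fixMap_le (hw : 0 < w.im) (hc : 0 < c)
    (hmask : RegularMask adj c) (k : ι) {s : ℂ}
    (hs : s = ∫ x, maskedGreen adj c z w x (Sum.inl k) (Sum.inl k)
      ∂(Measure.pi fun _ : ι × ι => μ)) {Z : ℝ}
    (hZ : Z = 12600 * (1 + 1 / w.im ^ 2) * ((∫ t, ‖t‖ ^ 4 ∂μ) * Fintype.card ι / (c : ℝ) ^ 2)) :
    ‖s - fixMap z w s‖ ≤ rowSq z w s * (Real.sqrt Z + Z / w.im) := by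
  have hne : Nonempty ι := ⟨k⟩
  have hω1 : 1 ≤ ∫ t, ‖t‖ ^ 4 ∂μ := one_le_fourth_moment h4 h2
  have hc' : (0 : ℝ) < c := by exact_mod_cast hc
  have hcn : (c : ℝ) ≤ Fintype.card ι := by
    rw [← hmask.row k]
    exact_mod_cast Finset.card_le_univ _
  set δ := (∫ t, ‖t‖ ^ 4 ∂μ) * Fintype.card ι / (c : ℝ) ^ 2 with hδ
  have hδ0 : 0 < δ := by
    have : 0 < (Fintype.card ι : ℝ) := hc'.trans_le hcn
    positivity
  set π := Measure.pi fun _ : ι × ι => μ with hπ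
  have hsl : ∀ i, ∫ x, maskedGreen adj c z w x (Sum.inl i) (Sum.inl i) ∂π = s := fun i => by
    rw [hs, (integral_maskedGreen_eq hmask hw i k).1]
  have hsr : ∀ i, ∫ x, maskedGreen adj c z w x (Sum.inr i) (Sum.inr i) ∂π = s := fun i => by
    rw [hs, integral_maskedGreen_inr hmask hw i k]
  set r : ℂ := ((Real.sqrt c : ℝ) : ℂ)⁻¹ with hr
  have hrr : r * r = (c : ℂ)⁻¹ := by
    rw [hr, ← mul_inv, ← Complex.ofReal_mul, Real.mul_self_sqrt hc'.le]; simp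
  have hsr' : star r = r := by
    rw [hr, RCLike.star_def, map_inv₀, Complex.conj_ofReal]
  have hinl : ∀ i, i ≠ k → (Sum.inl i : ι ⊕ ι) ≠ Sum.inl k ∧ (Sum.inl i : ι ⊕ ι) ≠ Sum.inr k :=
    fun i hi => ⟨fun h => hi (Sum.inl_injective h), by simp⟩
  have hinr : ∀ i, i ≠ k → (Sum.inr i : ι ⊕ ι) ≠ Sum.inl k ∧ (Sum.inr i : ι ⊕ ι) ≠ Sum.inr k :=
    fun i hi => ⟨by simp, fun h => hi (Sum.inr_injective h)⟩
  set er : {i // i ≠ k} → ι × ι := fun i => (k, i) with her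
  set ec : {i // i ≠ k} → ι × ι := fun i => (i, k) with hec
  have her_inj : Function.Injective er := fun i j h => Subtype.ext (Prod.mk.inj h).2
  have hec_inj : Function.Injective ec := fun i j h => Subtype.ext (Prod.mk.inj h).1
  have herT : ∀ i, er i ∈ cross k := fun i => by simp [er, cross]
  have hecT : ∀ i, ec i ∈ cross k := fun i => by simp [ec, cross]
  have hrc : ∀ i j, er i ≠ ec j := fun i j h => j.2 (Prod.mk.inj h).1.symm
  set B := fun x => maskedMatrix adj c z x with hB
  have hBkk : ∀ x, B x k k = (if adj k k then r * x (k, k) else 0) - z := fun x => by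
    simp [hB, maskedMatrix, hr]
  have hBr : ∀ x (i : {i // i ≠ k}), B x k i = if adj k i then r * x (er i) else 0 := fun x i => by
    simp [hB, maskedMatrix, hr, i.2.symm, er]
  have hBc : ∀ x (i : {i // i ≠ k}), B x i k = if adj i k then r * x (ec i) else 0 := fun x i => by
    simp [hB, maskedMatrix, hr, i.2, ec]
  set R := fun x => removedGreen adj c z w k x with hR
  set D11 := removedCoeff adj c z w k (fun i => adj k i) (fun i => adj k i) Sum.inr Sum.inr
  set D12 := removedCoeff adj c z w k (fun i => adj k i) (fun i => adj i k) Sum.inr Sum.inl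
  set D21 := removedCoeff adj c z w k (fun i => adj i k) (fun i => adj k i) Sum.inl Sum.inr
  set D22 := removedCoeff adj c z w k (fun i => adj i k) (fun i => adj i k) Sum.inl Sum.inl
  have t11 : ∀ x (i j : {i // i ≠ k}), B x k i * R x (Sum.inr i) (Sum.inr j) * star (B x k j)
      = D11 x i j * (x (er i) * star (x (er j))) := by
    intro x i j
    simp only [hBr, D11, removedCoeff, R]
    by_cases hi : adj k i <;> by_cases hj : adj k j <;> simp only [hi, hj, if_true, if_false,
      and_self, and_false, false_and, star_mul', star_zero, mul_zero, zero_mul, hsr', ← hrr]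
    ring
  have t12 : ∀ x (i j : {i // i ≠ k}), B x k i * R x (Sum.inr i) (Sum.inl j) * B x j k
      = D12 x i j * (x (er i) * x (ec j)) := by
    intro x i j
    simp only [hBr, hBc, D12, removedCoeff, R]
    by_cases hi : adj k i <;> by_cases hj : adj j k <;> simp only [hi, hj, if_true, if_false,
      and_self, and_false, false_and, mul_zero, zero_mul, ← hrr]
    ring
  -- Both entries are conjugated here, so the form is the conjugate of a bilinear form and the
  -- estimate for `t12` applies again.
  have t21 : ∀ x (i j : {i // i ≠ k}),
      star (B x i k) * R x (Sum.inl i) (Sum.inr j) * star (B x k j)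
      = star (star (D21 x i j) * (x (ec i) * x (er j))) := by
    intro x i j
    simp only [hBr, hBc, D21, removedCoeff, R]
    by_cases hi : adj i k <;> by_cases hj : adj k j <;> simp only [hi, hj, if_true, if_false,
      and_self, and_false, false_and, star_mul', star_zero, star_star, mul_zero, zero_mul, hsr',
      ← hrr]
    ring
  have t22 : ∀ x (i j : {i // i ≠ k}), star (B x i k) * R x (Sum.inl i) (Sum.inl j) * B x j k
      = D22 x i j * (x (ec j) * star (x (ec i))) := by
    intro x i j
    simp only [hBc, D22, removedCoeff, R]
    by_cases hi : adj i k <;> by_cases hj : adj j k <;> simp only [hi, hj, if_true, if_false,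
      and_self, and_false, false_and, star_mul', star_zero, mul_zero, zero_mul, hsr', ← hrr]
    ring
  set E11 : (ι × ι → ℂ) → ℂ := fun x => s - ∑ i, ∑ j, D11 x i j * (x (er i) * star (x (er j)))
  set E12 : (ι × ι → ℂ) → ℂ := fun x => (if adj k k then r * x (k, k) else 0)
    - ∑ i, ∑ j, D12 x i j * (x (er i) * x (ec j))
  set E21 : (ι × ι → ℂ) → ℂ := fun x => (if adj k k then r * x (k, k) else 0)
    - ∑ i, ∑ j, star (D21 x i j) * (x (ec i) * x (er j))
  set E22 : (ι × ι → ℂ) → ℂ := fun x => s - ∑ j, ∑ i, D22 x i j * (x (ec j) * star (x (ec i)))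
  obtain ⟨L11, b11⟩ := integral_norm_sq_diag_error_le (adj := adj) (z := z) (D := D11) h4 h1 h2 hw hc
    Sum.inr_injective hinr (hmask.row k) her_inj herT hsr
    (measurable_removedCoeff hw) (norm_removedCoeff_le hw) removedCoeff_piecewise
    (sum_norm_sq_removedCoeff_le hw hc (hmask.row k) Sum.inr_injective) fun x i => rfl
  obtain ⟨L22, b22⟩ := integral_norm_sq_diag_error_le (adj := adj) (z := z)
    (D := fun x j i => D22 x i j) h4 h1 h2 hw hc
    Sum.inl_injective hinl (hmask.col k) hec_inj hecT hsl
    (fun i j => measurable_removedCoeff hw j i) (fun x i j => norm_removedCoeff_le hw x j i)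
    (fun x y => by
      funext i j
      exact congrFun (congrFun (removedCoeff_piecewise x y) j) i)
    (fun x => by
      rw [Finset.sum_comm]
      exact sum_norm_sq_removedCoeff_le hw hc (hmask.col k) Sum.inl_injective x)
    fun x i => rfl
  obtain ⟨L12, b12⟩ := integral_norm_sq_offDiag_error_le (D := D12) h4 h1 h2 hw hc hcn
    her_inj hec_inj hrc herT hecT (adj k k)
    (measurable_removedCoeff hw) (norm_removedCoeff_le hw) removedCoeff_piecewise
    (sum_norm_sq_removedCoeff_le hw hc (hmask.row k) Sum.inl_injective)
  obtain ⟨L21, b21⟩ := integral_norm_sq_offDiag_error_le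
    (D := fun x i j => star (D21 x i j)) h4 h1 h2 hw hc hcn
    hec_inj her_inj (fun i j => (hrc j i).symm) hecT herT (adj k k)
    (fun i j => Complex.continuous_conj.measurable.comp (measurable_removedCoeff hw i j))
    (fun x i j => by rw [norm_star]; exact norm_removedCoeff_le hw x i j)
    (fun x y => by
      funext i j
      exact congrArg star (congrFun (congrFun (removedCoeff_piecewise x y) i) j))
    (fun x => by
      simp only [norm_star]
      exact sum_norm_sq_removedCoeff_le hw hc (hmask.col k) Sum.inr_injective x)
  set e : (ι × ι → ℂ) → ℝ := fun x => ‖E11 x‖ + ‖E12 x‖ + ‖E21 x‖ + ‖E22 x‖ with he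
  have hu : 0 < (w + s).im := by
    have := im_integral_maskedGreen_pos (adj := adj) (c := c) (z := z) (μ := μ) hw (Sum.inl k)
    rw [← hπ, ← hs] at this
    rw [Complex.add_im]; linarith
  -- The reference point s is deterministic, so the factor `rowSq z w s` leaves the expectation and
  -- only E e and E e² are needed.
  have hpt : ∀ x, ‖maskedGreen adj c z w x (Sum.inl k) (Sum.inl k) - fixMap z w s‖
      ≤ rowSq z w s * (e x + e x ^ 2 / w.im) := by
    intro x
    obtain ⟨q1, q2⟩ := hermitization_schur (B x) hw k (R := R x) rfl
    refine norm_sub_fixMap_le_of_two_by_two hu (norm_maskedGreen_le hw x _ _)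
      (norm_maskedGreen_le hw x _ _) q1 q2 ?_
    simp only [t11, t12, t21, t22, hBkk, he]
    congr 1
    · congr 1
      · congr 1
        · congr 1
          simp only [E11]; ring
        · congr 1
          simp only [E12]; ring
      · rw [← norm_star (E21 x)]
        congr 1
        simp only [E21, star_sub, ← star_sum]
        ring
    · congr 1
      simp only [E22]
      rw [Finset.sum_comm]; ring
  have i11 := L11.integrable_norm_pow two_ne_zero
  have i12 := L12.integrable_norm_pow two_ne_zero
  have i21 := L21.integrable_norm_pow two_ne_zero
  have i22 := L22.integrable_norm_pow two_ne_zero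
  have Le : MemLp e 2 π := ((L11.norm.add L12.norm).add L21.norm).add L22.norm
  have ie2 : Integrable (fun x => e x ^ 2) π := Le.integrable_sq
  have ie : Integrable e π := Le.integrable (by norm_num)
  have hZ0 : 0 < Z := by rw [hZ]; positivity
  -- The four entries give 4 (2 · 1569 + 2 · 4) = 12584 for the coefficient of 1 / (Im w)² and 32
  -- for the constant; 12600 covers both.
  have hb2 : ∫ x, e x ^ 2 ∂π ≤ Z := by
    calc _ ≤ ∫ x, 4 * ((‖E11 x‖ ^ 2 + ‖E12 x‖ ^ 2) + (‖E21 x‖ ^ 2 + ‖E22 x‖ ^ 2)) ∂π := by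
          refine integral_mono ie2 (((i11.add i12).add (i21.add i22)).const_mul 4) fun x => ?_
          simp only [he]
          nlinarith [sq_nonneg (‖E11 x‖ - ‖E12 x‖), sq_nonneg (‖E11 x‖ - ‖E21 x‖),
            sq_nonneg (‖E11 x‖ - ‖E22 x‖), sq_nonneg (‖E12 x‖ - ‖E21 x‖),
            sq_nonneg (‖E12 x‖ - ‖E22 x‖), sq_nonneg (‖E21 x‖ - ‖E22 x‖)]
      _ = 4 * (((∫ x, ‖E11 x‖ ^ 2 ∂π) + ∫ x, ‖E12 x‖ ^ 2 ∂π)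
            + ((∫ x, ‖E21 x‖ ^ 2 ∂π) + ∫ x, ‖E22 x‖ ^ 2 ∂π)) := by
          rw [integral_const_mul, integral_add (f := fun x => ‖E11 x‖ ^ 2 + ‖E12 x‖ ^ 2)
            (g := fun x => ‖E21 x‖ ^ 2 + ‖E22 x‖ ^ 2) (i11.add i12) (i21.add i22),
            integral_add i11 i12, integral_add i21 i22]
      _ ≤ 4 * ((1569 * δ / w.im ^ 2 + 4 * (1 + 1 / w.im ^ 2) * δ)
            + (4 * (1 + 1 / w.im ^ 2) * δ + 1569 * δ / w.im ^ 2)) := by gcongr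
      _ ≤ Z := by
          rw [hZ]
          have e1 : 1569 * δ / w.im ^ 2 = 1569 * (1 / w.im ^ 2 * δ) := by ring
          have e2 : 0 ≤ 1 / w.im ^ 2 * δ := by positivity
          rw [e1]
          nlinarith
  have hb1 := integral_le_sqrt_of_integral_sq_le ie ie2 hZ0 hb2
  have hfin : s - fixMap z w s
      = ∫ x, (maskedGreen adj c z w x (Sum.inl k) (Sum.inl k) - fixMap z w s) ∂π := by
    rw [integral_sub (integrable_maskedGreen hw _ _) (integrable_const _), ← hs]
    simp
  rw [hfin]
  calc _ ≤ ∫ x, ‖maskedGreen adj c z w x (Sum.inl k) (Sum.inl k) - fixMap z w s‖ ∂π :=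
        norm_integral_le_integral_norm _
    _ ≤ ∫ x, rowSq z w s * (e x + e x ^ 2 / w.im) ∂π :=
        integral_mono ((integrable_maskedGreen hw _ _).sub (integrable_const _)).norm
          ((ie.add (ie2.div_const _)).const_mul _) hpt
    _ = rowSq z w s * ((∫ x, e x ∂π) + (∫ x, e x ^ 2 ∂π) / w.im) := by
        rw [integral_const_mul, integral_add ie (ie2.div_const _), integral_div]
    _ ≤ _ := by
        gcongr
        exact rowSq_nonneg

end SelfConsistent

/-! ### Distance of the expected Stieltjes transform from the fixed point -/

section ExpectationBound

/-- Resolvent identity, with the arithmetic-geometric mean inequality weighted by Im w / Im w' so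
that each sum is exactly a Ward sum. -/
theorem norm_green_sub_green_le {N : Type*} [Fintype N] [DecidableEq N] {H : Matrix N N ℂ}
    (hH : H.IsHermitian) {w w' : ℂ} (hw : 0 < w.im) (hw' : 0 < w'.im)
    (hd : ‖w - w'‖ ≤ w'.im) (k : N) :
    ‖green H w k k - green H w' k k‖
      ≤ (green H w k k).im / 2 + w'.im / w.im * ((green H w' k k).im / 2) := by
  have h1 : green H w k k - green H w' k k = (w - w') * ∑ j, green H w k j * green H w' j k := by
    rw [← Matrix.sub_apply, green_sub_green hH hw hw', Matrix.smul_apply, Matrix.mul_apply,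
      smul_eq_mul]
  rw [h1, norm_mul]
  calc _ ≤ w'.im * ∑ j, (w.im / w'.im * (‖green H w k j‖ ^ 2 / 2)
        + w'.im / w.im * (‖green H w' j k‖ ^ 2 / 2)) := by
        gcongr
        refine (norm_sum_le _ _).trans (Finset.sum_le_sum fun j _ => ?_)
        rw [norm_mul]
        have e1 : w.im / w'.im * (‖green H w k j‖ ^ 2 / 2)
            + w'.im / w.im * (‖green H w' j k‖ ^ 2 / 2) - ‖green H w k j‖ * ‖green H w' j k‖
            = (w.im * ‖green H w k j‖ - w'.im * ‖green H w' j k‖) ^ 2 / (2 * w.im * w'.im) := by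
          field_simp
          ring
        have e2 : 0 ≤ (w.im * ‖green H w k j‖ - w'.im * ‖green H w' j k‖) ^ 2
            / (2 * w.im * w'.im) := by positivity
        linarith
    _ = (w.im * ∑ j, ‖green H w k j‖ ^ 2) / 2
        + w'.im / w.im * ((w'.im * ∑ j, ‖green H w' j k‖ ^ 2) / 2) := by
        rw [Finset.sum_add_distrib, ← Finset.mul_sum, ← Finset.mul_sum, ← Finset.sum_div,
          ← Finset.sum_div]
        field_simp
    _ = _ := by rw [sum_norm_sq_green_row hH hw, sum_norm_sq_green_col hH hw']

variable {ι : Type*} [Fintype ι] [DecidableEq ι]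
variable {adj : ι → ι → Prop} [DecidableRel adj] {c : ℕ} {z w : ℂ}
variable {μ : Measure ℂ} [IsProbabilityMeasure μ]

theorem norm_integral_maskedGreen_sub_le {w' : ℂ} (hw : 0 < w.im) (hw' : 0 < w'.im)
    (hd : ‖w - w'‖ ≤ w'.im) (p : ι ⊕ ι) :
    ‖∫ x, maskedGreen adj c z w x p p ∂(Measure.pi fun _ : ι × ι => μ)
      - ∫ x, maskedGreen adj c z w' x p p ∂(Measure.pi fun _ : ι × ι => μ)‖
    ≤ (∫ x, maskedGreen adj c z w x p p ∂(Measure.pi fun _ : ι × ι => μ)).im / 2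
      + w'.im / w.im *
        ((∫ x, maskedGreen adj c z w' x p p ∂(Measure.pi fun _ : ι × ι => μ)).im / 2) := by
  set π := Measure.pi fun _ : ι × ι => μ
  have hi : Integrable (fun x => maskedGreen adj c z w x p p) π := integrable_maskedGreen hw p p
  have hi' : Integrable (fun x => maskedGreen adj c z w' x p p) π := integrable_maskedGreen hw' p p
  have im1 : (∫ x, maskedGreen adj c z w x p p ∂π).im
      = ∫ x, (maskedGreen adj c z w x p p).im ∂π := (integral_im hi).symm
  have im2 : (∫ x, maskedGreen adj c z w' x p p ∂π).im
      = ∫ x, (maskedGreen adj c z w' x p p).im ∂π := (integral_im hi').symm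
  have hj : Integrable (fun x => (maskedGreen adj c z w x p p).im) π := hi.im
  have hj' : Integrable (fun x => (maskedGreen adj c z w' x p p).im) π := hi'.im
  rw [← integral_sub hi hi', im1, im2, ← integral_div, ← integral_div, ← integral_const_mul,
    ← integral_add (hj.div_const 2) ((hj'.div_const 2).const_mul _)]
  refine (norm_integral_le_integral_norm _).trans (integral_mono (hi.sub hi').norm
    ((hj.div_const 2).add ((hj'.div_const 2).const_mul _)) fun x => ?_)
  exact norm_green_sub_green_le (isHermitian_hermitization _) hw hw' hd p

variable (h4 : MemLp id 4 μ) (h1 : ∫ t, t ∂μ = 0) (h2 : ∫ t, ‖t‖ ^ 2 ∂μ = 1)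

include h4 h1 h2 in
/-- Closeness to the fixed point when the imaginary part is not too small. -/
theorem norm_sub_fixed_le_of_large_im (hw : 0 < w.im) (hc : 0 < c) (hmask : RegularMask adj c)
    (k : ι) {s t : ℂ}
    (hs : s = ∫ x, maskedGreen adj c z w x (Sum.inl k) (Sum.inl k)
      ∂(Measure.pi fun _ : ι × ι => μ))
    (ht : 0 < t.im) (hfix : t = fixMap z w t) {δ κ : ℝ} (hδ0 : 0 < δ)
    (hδ : δ ^ 2 = (∫ t, ‖t‖ ^ 4 ∂μ) * Fintype.card ι / (c : ℝ) ^ 2)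
    (hκ0 : 0 < κ) (hκ1 : κ ≤ 1) (hκw : κ ≤ w.im) (hδκ : 320 * δ ≤ κ ^ 2) :
    ‖s‖ ≤ 2 ∧ ‖s - t‖ ≤ 960 * δ / κ ^ 2 := by
  set Z := 12600 * (1 + 1 / w.im ^ 2) * ((∫ t, ‖t‖ ^ 4 ∂μ) * Fintype.card ι / (c : ℝ) ^ 2) with hZ
  have key := norm_integral_maskedGreen_sub_fixMap_le h4 h1 h2 hw hc hmask k hs hZ
  have hspos : 0 < s.im := by rw [hs]; exact im_integral_maskedGreen_pos hw _
  have hi1 : 1 / w.im ≤ 1 / κ := one_div_le_one_div_of_le hκ0 hκw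
  have hi2 : 1 ≤ 1 / κ := by rw [le_div_iff₀ hκ0]; linarith
  have hi3 : 1 / w.im ^ 2 ≤ 1 / κ ^ 2 := by
    apply one_div_le_one_div_of_le (by positivity)
    gcongr
  have hi4 : 1 ≤ 1 / κ ^ 2 := by
    rw [le_div_iff₀ (by positivity)]
    nlinarith
  -- Here 1 + 1 / (Im w)² ≤ 2 / κ², and 2 · 12600 ≤ 160².
  have hZle : Z ≤ (160 * δ / κ) ^ 2 := by
    rw [hZ, ← hδ]
    have : (160 * δ / κ) ^ 2 = 25600 * (1 / κ ^ 2) * δ ^ 2 := by ring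
    rw [this]
    gcongr ?_ * _
    linarith
  have hZ0 : 0 ≤ Z := by rw [hZ, ← hδ]; positivity
  have hsq : Real.sqrt Z ≤ 160 * δ / κ := Real.sqrt_le_iff.mpr ⟨by positivity, hZle⟩
  have hZw : Z / w.im ≤ 80 * δ / κ := by
    calc Z / w.im = Z * (1 / w.im) := by ring
      _ ≤ (160 * δ / κ) ^ 2 * (1 / κ) := by gcongr
      _ = 80 * δ / κ * ((320 * δ) / κ ^ 2) := by field_simp; norm_num
      _ ≤ 80 * δ / κ * 1 := by
          gcongr
          rw [div_le_one (by positivity)]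
          exact hδκ
      _ = _ := mul_one _
  set F := Real.sqrt Z + Z / w.im with hF
  have hF0 : 0 ≤ F := by positivity
  have hFle : F ≤ 240 * δ / κ := by
    have : 240 * δ / κ = 160 * δ / κ + 80 * δ / κ := by ring
    linarith
  have hFκ : F ≤ κ := by
    refine hFle.trans ?_
    rw [div_le_iff₀ hκ0]
    nlinarith
  constructor
  · have := norm_le_of_approx hw hspos hF0 key (hFκ.trans hκw)
    linarith
  · refine (norm_sub_le_of_approx hw hspos hF0 key (hFκ.trans hκw) ht hfix).trans ?_
    calc 2 * F * (1 + 1 / w.im) ≤ 2 * (240 * δ / κ) * (1 / κ + 1 / κ) := by gcongr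
      _ = _ := by field_simp; norm_num

-- Below the height (320 δ)^(1/2) the approximate equation gives nothing. There |s| and |t| are
-- bounded by a multiple of the ratio of that height to Im w, and this ratio exceeds 1, so its
-- square already dominates |s - t|.
include h4 h1 h2 in
theorem norm_sub_fixed_le (hw : 0 < w.im) (hc : 0 < c) (hmask : RegularMask adj c)
    (k : ι) (hfix : ∀ w : ℂ, 0 < w.im → ∃ t : ℂ, 0 < t.im ∧ t = fixMap z w t) {s t : ℂ}
    (hs : s = ∫ x, maskedGreen adj c z w x (Sum.inl k) (Sum.inl k)
      ∂(Measure.pi fun _ : ι × ι => μ))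
    (ht : 0 < t.im) (htfix : t = fixMap z w t) {δ : ℝ} (hδ0 : 0 < δ)
    (hδ : δ ^ 2 = (∫ t, ‖t‖ ^ 4 ∂μ) * Fintype.card ι / (c : ℝ) ^ 2) (hδ1 : 320 * δ < 1) :
    ‖s - t‖ ≤ 2240 * δ / (min 1 w.im) ^ 2 := by
  have hκ0 : 0 < min 1 w.im := lt_min one_pos hw
  rcases le_or_gt (320 * δ) ((min 1 w.im) ^ 2) with hgood | hbad
  · refine (norm_sub_fixed_le_of_large_im h4 h1 h2 hw hc hmask k hs ht htfix hδ0 hδ hκ0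
      (min_le_left _ _) (min_le_right _ _) hgood).2.trans ?_
    gcongr
    norm_num
  · have hmin : min 1 w.im = w.im := by
      rcases min_cases 1 w.im with ⟨h, _⟩ | ⟨h, _⟩
      · rw [h] at hbad; linarith
      · exact h
    rw [hmin] at hbad ⊢
    -- The lowest height at which the large imaginary part estimate applies with κ equal to the
    -- height.
    set h' := Real.sqrt (320 * δ) with hh'
    have hh2 : h' ^ 2 = 320 * δ := Real.sq_sqrt (by positivity)
    have hh0 : 0 < h' := Real.sqrt_pos.mpr (by positivity)
    have hlt : w.im < h' := by
      rw [← hh2] at hbad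
      exact lt_of_pow_lt_pow_left₀ 2 hh0.le hbad
    have hh1 : h' ≤ 1 := by
      by_contra! hcon
      nlinarith
    set w' : ℂ := ⟨w.re, h'⟩ with hw'
    have hwim : w'.im = h' := rfl
    have hw'0 : 0 < w'.im := hh0
    have hd : ‖w - w'‖ ≤ w'.im := by
      have : w - w' = ((w.im - h' : ℝ) : ℂ) * Complex.I := by
        apply Complex.ext <;> simp [hw']
      rw [this, norm_mul, Complex.norm_I, mul_one, Complex.norm_real, Real.norm_eq_abs, abs_le, hwim]
      constructor <;> linarith
    obtain ⟨t', ht', hfix'⟩ := hfix w' hw'0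
    obtain ⟨hs2, -⟩ := norm_sub_fixed_le_of_large_im h4 h1 h2 hw'0 hc hmask k rfl ht' hfix' hδ0 hδ
      hh0 hh1 le_rfl hh2.ge
    have hcmp := norm_integral_maskedGreen_sub_le (adj := adj) (c := c) (z := z) (μ := μ) hw hw'0 hd
      (Sum.inl k)
    rw [← hs] at hcmp
    set s' := ∫ x, maskedGreen adj c z w' x (Sum.inl k) (Sum.inl k)
      ∂(Measure.pi fun _ : ι × ι => μ)
    have hρ : 1 ≤ h' / w.im := by rw [le_div_iff₀ hw]; linarith
    have e1 : s.im ≤ ‖s‖ := (le_abs_self _).trans (Complex.abs_im_le_norm _)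
    have e2 : s'.im ≤ ‖s'‖ := (le_abs_self _).trans (Complex.abs_im_le_norm _)
    have e3 : ‖s‖ ≤ ‖s - s'‖ + ‖s'‖ := by simpa using norm_add_le (s - s') s'
    have e4 : h' / w.im * (s'.im / 2) ≤ h' / w.im * 1 := by gcongr; linarith
    rw [hwim] at hcmp
    -- With ρ = h' / Im w ≥ 1 and |s'| ≤ 2, the comparison gives |s| ≤ |s| / 2 + ρ + 2, and the
    -- first term is absorbed.
    have e5 : ‖s‖ ≤ 6 * (h' / w.im) := by linarith
    have e6 : ‖t‖ ≤ 1 := norm_le_one_of_fixed hw ht htfix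
    have e7 : ‖s - t‖ ≤ 7 * (h' / w.im) := (norm_sub_le _ _).trans (by linarith)
    refine e7.trans ?_
    have e8 : 2240 * δ / w.im ^ 2 = 7 * (h' / w.im) * (h' / w.im) := by
      have : 2240 * δ = 7 * h' ^ 2 := by rw [hh2]; ring
      rw [this]; ring
    rw [e8]
    nlinarith

include h4 h1 h2 in
/-- The distance of the expected Stieltjes transform to its limit. -/
theorem norm_sub_div_le (hw : 0 < w.im) (hc : 0 < c) (hmask : RegularMask adj c)
    (k : ι) (hfix : ∀ w : ℂ, 0 < w.im → ∃ t : ℂ, 0 < t.im ∧ t = fixMap z w t) {s t : ℂ}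
    (hs : s = ∫ x, maskedGreen adj c z w x (Sum.inl k) (Sum.inl k)
      ∂(Measure.pi fun _ : ι × ι => μ))
    (ht : 0 < t.im) (htfix : t = fixMap z w t) {δ : ℝ} (hδ0 : 0 < δ)
    (hδ : δ ^ 2 = (∫ t, ‖t‖ ^ 4 ∂μ) * Fintype.card ι / (c : ℝ) ^ 2)
    {A : ℝ} (hA : 1 < A) (hre : |(w ^ 2).re| < A) (him : 0 < (w ^ 2).im) (him1 : (w ^ 2).im < 1)
    (hs1 : ‖s‖ / ‖w‖ ≤ 1 / (w ^ 2).im) (ht1 : ‖t‖ / ‖w‖ ≤ 1 / (w ^ 2).im) :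
    ‖s - t‖ / ‖w‖ ≤ 17920 * Real.sqrt A * δ / (w ^ 2).im ^ 2 := by
  set η := (w ^ 2).im with hη
  have hw0 : 0 < ‖w‖ := norm_pos_iff.mpr fun h => by simp [h] at hw
  have hA1 : 1 ≤ Real.sqrt A := by rw [Real.one_le_sqrt]; exact hA.le
  have hη2 : 1 / η ≤ 1 / η ^ 2 := by
    apply one_div_le_one_div_of_le (by positivity)
    nlinarith
  have hη3 : 1 ≤ 1 / η ^ 2 := by
    rw [le_div_iff₀ (by positivity)]; nlinarith
  -- For δ bounded below, the a priori bounds 1 / η on both transforms suffice.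
  rcases le_or_gt 1 (320 * δ) with hbig | hsmall
  · calc ‖s - t‖ / ‖w‖ ≤ (‖s‖ + ‖t‖) / ‖w‖ := by gcongr; exact norm_sub_le _ _
      _ ≤ 2 * (1 / η) := by rw [add_div]; linarith
      _ ≤ 17920 * Real.sqrt A * δ * (1 / η ^ 2) := by
          gcongr
          nlinarith
      _ = _ := by ring
  · have key := norm_sub_fixed_le h4 h1 h2 hw hc hmask k hfix hs ht htfix hδ0 hδ hsmall
    have hstep : ∀ Y : ℝ, 1 / ((min 1 w.im) ^ 2 * ‖w‖) ≤ Y → ‖s - t‖ / ‖w‖ ≤ 2240 * δ * Y := by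
      intro Y hY
      calc ‖s - t‖ / ‖w‖ ≤ 2240 * δ / (min 1 w.im) ^ 2 / ‖w‖ := by gcongr
        _ = 2240 * δ * (1 / ((min 1 w.im) ^ 2 * ‖w‖)) := by
            rw [div_div, mul_one_div]
        _ ≤ _ := by gcongr
    -- The change of variable costs η ≤ 2 |w| Im w and |w| ≤ 2 √A, whence the factor 8 √A; 17920 = 8
    -- · 2240.
    have hY := hstep (8 * Real.sqrt A / η ^ 2) ?_
    · refine hY.trans_eq ?_
      ring
    rcases min_cases 1 w.im with ⟨hm, hm'⟩ | ⟨hm, hm'⟩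
    · rw [hm, one_pow, one_mul]
      have e1 : 1 ≤ ‖w‖ := hm'.trans ((le_abs_self _).trans (Complex.abs_im_le_norm _))
      calc 1 / ‖w‖ ≤ 1 := by rw [div_le_one hw0]; exact e1
        _ ≤ 1 / η ^ 2 := hη3
        _ ≤ _ := by gcongr; linarith
    · rw [hm]
      have e1 : η ≤ 2 * ‖w‖ * w.im := by
        have : η = 2 * w.re * w.im := by rw [hη, pow_two, Complex.mul_im]; ring
        rw [this]
        have := (le_abs_self _).trans (Complex.abs_re_le_norm w)
        gcongr
      have e2 : ‖w‖ ≤ 2 * Real.sqrt A := by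
        have h5 : ‖w‖ ^ 2 ≤ 2 * A := by
          rw [← norm_pow]
          refine (Complex.norm_le_abs_re_add_abs_im _).trans ?_
          rw [← hη, abs_of_pos him]
          linarith
        have h6 : (2 * Real.sqrt A) ^ 2 = 4 * A := by
          rw [mul_pow, Real.sq_sqrt (by linarith)]; norm_num
        exact le_of_sq_le_sq (by rw [h6]; linarith) (by positivity)
      rw [div_le_div_iff₀ (by positivity) (by positivity), one_mul]
      calc η ^ 2 ≤ (2 * ‖w‖ * w.im) ^ 2 := by gcongr
        _ = 4 * ‖w‖ * (w.im ^ 2 * ‖w‖) := by ring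
        _ ≤ 4 * (2 * Real.sqrt A) * (w.im ^ 2 * ‖w‖) := by gcongr
        _ = _ := by ring

end ExpectationBound

/-! ### Periodic block band matrices as masked matrices -/

section BlockBand

instance : DecidableEq BandPart := fun a b => by
  cases a <;> cases b <;> first | exact isTrue rfl | exact isFalse (fun h => nomatch h)

instance : Fintype BandPart where
  elems := {BandPart.D, BandPart.U, BandPart.T}
  complete x := by cases x <;> simp

variable {m b : ℕ}

/-- The positions of the nonzero blocks of a periodic block band matrix. -/
def blockAdj (m b : ℕ) (r s : ZMod m × Fin b) : Prop :=
  s.1 = r.1 ∨ s.1 = r.1 + 1 ∨ s.1 + 1 = r.1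

instance : DecidableRel (blockAdj m b) := fun r s => by unfold blockAdj; infer_instance

theorem zmod_one_ne_zero (hm : 3 ≤ m) : (1 : ZMod m) ≠ 0 := by
  have : Fact (1 < m) := ⟨by omega⟩
  exact one_ne_zero

theorem zmod_two_ne_zero (hm : 3 ≤ m) : (1 + 1 : ZMod m) ≠ 0 := by
  intro h
  have h2 : ((2 : ℕ) : ZMod m) = 0 := by push_cast; rw [← h]; norm_num
  rw [ZMod.natCast_eq_zero_iff] at h2
  have := Nat.le_of_dvd (by norm_num) h2
  omega

theorem card_three_zmod (hm : 3 ≤ m) (i : ZMod m) : ({i, i + 1, i - 1} : Finset (ZMod m)).card = 3 := by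
  have h1 := zmod_one_ne_zero hm
  have h2 := zmod_two_ne_zero hm
  refine Finset.card_eq_three.mpr ⟨i, i + 1, i - 1, ?_, ?_, ?_, rfl⟩
  · intro h; apply h1; linear_combination -h
  · intro h; apply h1; linear_combination h
  · intro h; apply h2; linear_combination h

/-- For m ≥ 3 the residues i, i + 1, i - 1 are distinct, which gives 3b positions per line.
Translating the blocks while swapping two positions inside all blocks carries any index to any
other. -/
theorem regularMask_blockAdj [NeZero m] (hm : 3 ≤ m) : RegularMask (blockAdj m b) (3 * b) where
  row r := by
    have : (Finset.univ.filter fun s => blockAdj m b r s)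
        = ({r.1, r.1 + 1, r.1 - 1} : Finset (ZMod m)) ×ˢ (Finset.univ : Finset (Fin b)) := by
      ext s
      rw [Finset.mem_filter]
      simp only [blockAdj, Finset.mem_univ, true_and, Finset.mem_product,
        Finset.mem_insert, Finset.mem_singleton, and_true, eq_sub_iff_add_eq]
    rw [this, Finset.card_product, card_three_zmod hm, Finset.card_univ, Fintype.card_fin]
  col s := by
    have : (Finset.univ.filter fun r => blockAdj m b r s)
        = ({s.1, s.1 + 1, s.1 - 1} : Finset (ZMod m)) ×ˢ (Finset.univ : Finset (Fin b)) := by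
      ext r
      rw [Finset.mem_filter]
      simp only [blockAdj, Finset.mem_univ, true_and, Finset.mem_product,
        Finset.mem_insert, Finset.mem_singleton, and_true, eq_sub_iff_add_eq]
      constructor
      · rintro (h | h | h)
        · exact Or.inl h.symm
        · exact Or.inr (Or.inr h.symm)
        · exact Or.inr (Or.inl h.symm)
      · rintro (h | h | h)
        · exact Or.inl h.symm
        · exact Or.inr (Or.inr h.symm)
        · exact Or.inr (Or.inl h.symm)
    rw [this, Finset.card_product, card_three_zmod hm, Finset.card_univ, Fintype.card_fin]
  trans r s := by
    refine ⟨Equiv.prodCongr (Equiv.addRight (s.1 - r.1)) (Equiv.swap r.2 s.2), ?_, ?_⟩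
    · ext <;> simp
    · intro p q
      simp only [blockAdj, Equiv.prodCongr_apply, Prod.map_fst, Equiv.coe_addRight]
      refine or_congr (by simp) (or_congr ?_ ?_)
      · rw [add_right_comm, add_left_inj]
      · rw [add_right_comm, add_left_inj]

/-- The matrix position of an entry of a block. -/
def blockPosition (k : BandPart × ZMod m × Fin b × Fin b) :
    (ZMod m × Fin b) × (ZMod m × Fin b) :=
  ((match k.1 with
    | BandPart.D => k.2.1
    | BandPart.U => k.2.1 - 1
    | BandPart.T => k.2.1 + 1, k.2.2.1), (k.2.1, k.2.2.2))

theorem blockPosition_injective (hm : 3 ≤ m) :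
    Function.Injective (blockPosition (m := m) (b := b)) := by
  have h1 := zmod_one_ne_zero hm
  have h2 := zmod_two_ne_zero hm
  rintro ⟨p, j, a, d⟩ ⟨p', j', a', d'⟩ h
  simp only [blockPosition, Prod.mk.injEq] at h
  obtain ⟨⟨h3, rfl⟩, rfl, rfl⟩ := h
  have : p = p' := by
    cases p <;> cases p' <;> first | rfl | (exfalso; simp only at h3)
    · apply h1; linear_combination h3
    · apply h1; linear_combination -h3
    · apply h1; linear_combination -h3
    · apply h2; linear_combination -h3
    · apply h1; linear_combination h3
    · apply h2; linear_combination h3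
  rw [this]

theorem shiftedScaled_periodicBlockBand (hm : 3 ≤ m) (z : ℂ)
    (x : (ZMod m × Fin b) × (ZMod m × Fin b) → ℂ) :
    shiftedScaled (periodicBlockBand fun s j => Matrix.of fun a d => x (blockPosition (s, j, a, d))) z
      = maskedMatrix (blockAdj m b) (3 * b) z x := by
  have h1 := zmod_one_ne_zero hm
  have h2 := zmod_two_ne_zero hm
  ext ⟨i, a⟩ ⟨j, d⟩
  have hz : (z • (1 : Matrix (ZMod m × Fin b) (ZMod m × Fin b) ℂ)) (i, a) (j, d)
      = if (i, a) = (j, d) then z else 0 := by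
    rw [Matrix.smul_apply, Matrix.one_apply]; simp
  rw [shiftedScaled, Matrix.sub_apply, hz, Matrix.smul_apply, periodicBlockBand, Matrix.of_apply,
    maskedMatrix, Matrix.of_apply]
  congr 1
  simp only [blockAdj, Matrix.of_apply, smul_eq_mul, blockPosition, Nat.cast_mul, Nat.cast_ofNat]
  by_cases e1 : j = i
  · simp [e1]
  · by_cases e2 : j = i + 1
    · simp [e2, h1]
    · by_cases e3 : j + 1 = i
      · simp [e1, e2, e3]
      · simp [e1, e2, e3]

variable {Ω₀ Ω : Type*} [MeasurableSpace Ω₀] [MeasurableSpace Ω]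

/-- Expectations with respect to a periodic block band matrix are integrals over an array of
independent entries of which the positions outside the band are ignored. -/
theorem IsPeriodicBlockBand.integral_eq [NeZero m] (hm : 3 ≤ m) {ξ : Ω₀ → ℂ} {P₀ : Measure Ω₀}
    [IsProbabilityMeasure P₀] {Xt : Ω → Matrix (ZMod m × Fin b) (ZMod m × Fin b) ℂ}
    {P : Measure Ω} [IsProbabilityMeasure P] (hξ : AEMeasurable ξ P₀)
    (h : IsPeriodicBlockBand ξ P₀ Xt P) (z : ℂ)
    {G : Type*} [NormedAddCommGroup G] [NormedSpace ℝ G]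
    (f : Matrix (ZMod m × Fin b) (ZMod m × Fin b) ℂ → G)
    (hf : StronglyMeasurable fun x : BandPart × ZMod m × Fin b × Fin b → ℂ =>
      f (shiftedScaled (periodicBlockBand fun s j => Matrix.of fun a d => x (s, j, a, d)) z)) :
    (AEStronglyMeasurable (fun ω => f (shiftedScaled (Xt ω) z)) P) ∧
    ∫ ω, f (shiftedScaled (Xt ω) z) ∂P
      = ∫ x, f (maskedMatrix (blockAdj m b) (3 * b) z x)
        ∂(Measure.pi fun _ : (ZMod m × Fin b) × (ZMod m × Fin b) => P₀.map ξ) := by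
  obtain ⟨Y, hind, hid, hX⟩ := h
  have : IsProbabilityMeasure (P₀.map ξ) := Measure.isProbabilityMeasure_map hξ
  have hYm : ∀ k, AEMeasurable (Y k) P := fun k => (hid k).aemeasurable_fst
  have hYa : AEMeasurable (fun ω k => Y k ω) P := aemeasurable_pi_lambda _ hYm
  have hlaw : P.map (fun ω k => Y k ω)
      = Measure.pi fun _ : BandPart × ZMod m × Fin b × Fin b => P₀.map ξ := by
    rw [(iIndepFun_iff_map_fun_eq_pi_map hYm).mp hind]
    congr 1
    funext k
    exact (hid k).map_eq
  have hmp := measurePreserving_precomp (P₀.map ξ) (blockPosition_injective (m := m) (b := b) hm)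
  have e1 : ∀ ω, f (shiftedScaled (Xt ω) z) = f (shiftedScaled (periodicBlockBand
      fun s j => Matrix.of fun a d => (fun k => Y k ω) (s, j, a, d)) z) := by
    intro ω
    rw [hX ω]
  have e2 : ∀ x, f (maskedMatrix (blockAdj m b) (3 * b) z x) = f (shiftedScaled (periodicBlockBand
      fun s j => Matrix.of fun a d => (fun k => x (blockPosition k)) (s, j, a, d)) z) := by
    intro x
    rw [← shiftedScaled_periodicBlockBand hm]
  simp only [e1, e2]
  generalize hg : (fun x : BandPart × ZMod m × Fin b × Fin b → ℂ =>
    f (shiftedScaled (periodicBlockBand fun s j => Matrix.of fun a d => x (s, j, a, d)) z)) = g at hf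
  have hg' : ∀ x : BandPart × ZMod m × Fin b × Fin b → ℂ,
      f (shiftedScaled (periodicBlockBand fun s j => Matrix.of fun a d => x (s, j, a, d)) z) = g x :=
    fun x => congrFun hg x
  have e3 : ∀ ω, f (shiftedScaled (periodicBlockBand
      fun s j => Matrix.of fun a d => Y (s, j, a, d) ω) z) = g (fun k => Y k ω) := fun ω => hg' (fun k => Y k ω)
  have e4 : ∀ x : (ZMod m × Fin b) × (ZMod m × Fin b) → ℂ, f (shiftedScaled (periodicBlockBand
      fun s j => Matrix.of fun a d => x (blockPosition (s, j, a, d))) z)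
        = g (fun k => x (blockPosition k)) := fun x => hg' (fun k => x (blockPosition k))
  simp only [e3, e4]
  refine ⟨hf.aestronglyMeasurable.comp_aemeasurable hYa, ?_⟩
  -- The band entries of the given model and those read off the full i.i.d. array have the same
  -- product law.
  calc ∫ ω, g (fun k => Y k ω) ∂P = ∫ x, g x ∂(P.map fun ω k => Y k ω) :=
        (integral_map hYa hf.aestronglyMeasurable).symm
    _ = ∫ x, g x ∂((Measure.pi fun _ : (ZMod m × Fin b) × (ZMod m × Fin b) => P₀.map ξ).map
          fun x k => x (blockPosition k)) := by rw [hlaw, hmp.map_eq]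
    _ = _ := integral_map hmp.measurable.aemeasurable hf.aestronglyMeasurable

end BlockBand

/-! ### Stieltjes transforms of probability measures on the half line -/

section Stieltjes

variable {ν : Measure ℝ}

theorem ae_nonneg_of_measure_Iio (h : ν (Set.Iio 0) = 0) : ∀ᵐ x ∂ν, 0 ≤ x := by
  rw [ae_iff]
  simpa [Set.Iio] using h

theorem norm_inv_sub_le_inv_im {ζ : ℂ} (hζ : 0 < ζ.im) (x : ℝ) :
    ‖((x : ℂ) - ζ)⁻¹‖ ≤ 1 / ζ.im := by
  rw [norm_inv, ← one_div]
  apply one_div_le_one_div_of_le hζ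
  have := Complex.abs_im_le_norm ((x : ℂ) - ζ)
  rw [Complex.sub_im, Complex.ofReal_im, zero_sub, abs_neg, abs_of_pos hζ] at this
  exact this

/-- Factor x - w² as (√x + w)(√x - w); both factors have imaginary part ±Im w. Unlike a bound by Im
w², this one also covers negative real w². -/
theorem sq_im_le_norm_sub_sq {w : ℂ} (hw : 0 < w.im) {x : ℝ} (hx : 0 ≤ x) :
    w.im ^ 2 ≤ ‖(x : ℂ) - w ^ 2‖ := by
  have h : (x : ℂ) - w ^ 2 = (((Real.sqrt x : ℝ) : ℂ) + w) * (((Real.sqrt x : ℝ) : ℂ) - w) := by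
    rw [← sq_sub_sq, ← Complex.ofReal_pow, Real.sq_sqrt hx]
  have h1 := Complex.abs_im_le_norm (((Real.sqrt x : ℝ) : ℂ) + w)
  have h2 := Complex.abs_im_le_norm (((Real.sqrt x : ℝ) : ℂ) - w)
  rw [Complex.add_im, Complex.ofReal_im, zero_add, abs_of_pos hw] at h1
  rw [Complex.sub_im, Complex.ofReal_im, zero_sub, abs_neg, abs_of_pos hw] at h2
  rw [h, norm_mul, pow_two]
  gcongr

theorem measurable_inv_sub (ζ : ℂ) : Measurable fun x : ℝ => ((x : ℂ) - ζ)⁻¹ :=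
  (Complex.measurable_ofReal.sub_const ζ).inv

variable [IsProbabilityMeasure ν]

theorem integrable_inv_sub_sq (h : ν (Set.Iio 0) = 0) {w : ℂ} (hw : 0 < w.im) :
    Integrable (fun x : ℝ => ((x : ℂ) - w ^ 2)⁻¹) ν := by
  refine Integrable.of_bound (measurable_inv_sub _).aestronglyMeasurable (w.im ^ 2)⁻¹ ?_
  filter_upwards [ae_nonneg_of_measure_Iio h] with x hx
  rw [norm_inv]
  exact inv_anti₀ (by positivity) (sq_im_le_norm_sub_sq hw hx)

theorem integral_pos_of_ae_pos {X : Type*} [MeasurableSpace X] {P : Measure X}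
    [IsProbabilityMeasure P] {f : X → ℝ} (hf : Integrable f P) (h : ∀ᵐ x ∂P, 0 < f x) :
    0 < ∫ x, f x ∂P := by
  rw [integral_pos_iff_support_of_nonneg_ae (h.mono fun x hx => hx.le) hf]
  have : P (Function.support f) = 1 := by
    rw [prob_compl_eq_zero_iff₀ ?_ |>.symm]
    · refine measure_mono_null ?_ (ae_iff.mp h)
      intro x hx
      simp only [Set.mem_compl_iff, Function.mem_support, not_not] at hx
      simp [hx]
    · exact hf.1.nullMeasurableSet_support
  rw [this]
  exact one_pos

/-- The integrand has imaginary part Im w (x + |w|²) / |x - w²|², positive for x ≥ 0. -/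
theorem im_mul_stieltjes_sq_pos (h : ν (Set.Iio 0) = 0) {w : ℂ} (hw : 0 < w.im) :
    0 < (w * stieltjes ν (w ^ 2)).im := by
  have hi : Integrable (fun x : ℝ => w * ((x : ℂ) - w ^ 2)⁻¹) ν :=
    (integrable_inv_sub_sq h hw).const_mul w
  have h1 : (w * stieltjes ν (w ^ 2)).im = ∫ x : ℝ, (w * ((x : ℂ) - w ^ 2)⁻¹).im ∂ν := by
    rw [stieltjes, ← integral_const_mul]
    exact (integral_im hi).symm
  rw [h1]
  have hi' : Integrable (fun x : ℝ => (w * ((x : ℂ) - w ^ 2)⁻¹).im) ν := hi.im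
  refine integral_pos_of_ae_pos hi' ?_
  filter_upwards [ae_nonneg_of_measure_Iio h] with x hx
  have hn : 0 < ‖(x : ℂ) - w ^ 2‖ := lt_of_lt_of_le (by positivity) (sq_im_le_norm_sub_sq hw hx)
  have hns : 0 < Complex.normSq ((x : ℂ) - w ^ 2) := by
    rw [Complex.normSq_eq_norm_sq]; positivity
  rw [← div_eq_mul_inv, Complex.div_im, ← sub_div]
  refine div_pos ?_ hns
  simp only [Complex.sub_re, Complex.sub_im, Complex.ofReal_re, Complex.ofReal_im, pow_two,
    Complex.mul_re, Complex.mul_im]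
  have : w.im * (x - (w.re * w.re - w.im * w.im)) - w.re * (0 - (w.re * w.im + w.im * w.re))
      = w.im * (x + w.re ^ 2 + w.im ^ 2) := by ring
  rw [this]
  positivity

theorem im_stieltjes_pos {ζ : ℂ} (hζ : 0 < ζ.im) : 0 < (stieltjes ν ζ).im := by
  have hi : Integrable (fun x : ℝ => ((x : ℂ) - ζ)⁻¹) ν :=
    integrable_of_bounded (measurable_inv_sub ζ).aestronglyMeasurable (norm_inv_sub_le_inv_im hζ)
  have h1 : (stieltjes ν ζ).im = ∫ x : ℝ, (((x : ℂ) - ζ)⁻¹).im ∂ν := (integral_im hi).symm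
  rw [h1]
  have hi' : Integrable (fun x : ℝ => (((x : ℂ) - ζ)⁻¹).im) ν := hi.im
  refine integral_pos_of_ae_pos hi' (Filter.Eventually.of_forall fun x => ?_)
  have hne : (x : ℂ) - ζ ≠ 0 := fun h => by
    have := congrArg Complex.im h
    simp at this
    linarith
  rw [Complex.inv_im]
  have := Complex.normSq_pos.mpr hne
  have : (x - ζ : ℂ).im = -ζ.im := by simp
  rw [this, neg_neg]
  positivity

theorem norm_stieltjes_le {ζ : ℂ} (hζ : 0 < ζ.im) : ‖stieltjes ν ζ‖ ≤ 1 / ζ.im := by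
  have := norm_integral_le_of_norm_le_const (μ := ν)
    (Filter.Eventually.of_forall (norm_inv_sub_le_inv_im hζ))
  simpa [stieltjes] using this

end Stieltjes

/-! ### Averaged laws -/

section MeanMeasure

/-- The law of a uniformly chosen member of a finite family of random variables. -/
theorem exists_mean_measure {X ι : Type*} [MeasurableSpace X] (ρ : Measure X)
    [IsProbabilityMeasure ρ] [Fintype ι] [Nonempty ι] {l : ι → X → ℝ}
    (hl : ∀ i, Measurable (l i)) :
    ∃ ν : Measure ℝ, IsProbabilityMeasure ν ∧
      (∀ f : ℝ → ENNReal, Measurable f →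
        ∫⁻ x, f x ∂ν = (Fintype.card ι : ENNReal)⁻¹ * ∑ i, ∫⁻ a, f (l i a) ∂ρ) ∧
      ∀ f : ℝ → ℂ, Measurable f → (∀ i, Integrable (fun a => f (l i a)) ρ) →
        ∫ x, f x ∂ν = (Fintype.card ι : ℂ)⁻¹ * ∑ i, ∫ a, f (l i a) ∂ρ := by
  have hL : ∀ f : ℝ → ENNReal, Measurable f →
      ∫⁻ x, f x ∂((Fintype.card ι : ENNReal)⁻¹ • ∑ i, ρ.map (l i))
        = (Fintype.card ι : ENNReal)⁻¹ * ∑ i, ∫⁻ a, f (l i a) ∂ρ := by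
    intro f hf
    rw [lintegral_smul_measure, lintegral_finsetSum_measure, smul_eq_mul]
    congr 1
    exact Finset.sum_congr rfl fun i _ => lintegral_map hf (hl i)
  refine ⟨(Fintype.card ι : ENNReal)⁻¹ • ∑ i, ρ.map (l i), ⟨?_⟩, hL, ?_⟩
  · have := hL (fun _ => 1) measurable_const
    simp only [lintegral_const, measure_univ, one_mul, mul_one, Finset.sum_const, Finset.card_univ,
      nsmul_eq_mul] at this
    rw [this]
    exact ENNReal.inv_mul_cancel (by simp) (by simp)
  · intro f hf hi
    rw [integral_smul_measure, integral_finsetSum_measure]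
    · rw [ENNReal.toReal_inv, ENNReal.toReal_natCast, Complex.real_smul]
      push_cast
      congr 1
      exact Finset.sum_congr rfl fun i _ => integral_map (hl i).aemeasurable hf.aestronglyMeasurable
    · intro i _
      exact (integrable_map_measure hf.aestronglyMeasurable (hl i).aemeasurable).mpr (hi i)

end MeanMeasure

/-! ### Random signs as a concrete atom variable -/

section Signs

/-- A fair coin. -/
noncomputable def coin : Measure Bool :=
  (2 : ENNReal)⁻¹ • (Measure.dirac true + Measure.dirac false)

instance : IsProbabilityMeasure coin := ⟨by
  simp only [coin, Measure.smul_apply, Measure.add_apply, measure_univ, smul_eq_mul]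
  rw [one_add_one_eq_two]
  exact ENNReal.inv_mul_cancel (by simp) (by simp)⟩

/-- The sign of a coin. -/
def coinSign (a : Bool) : ℂ := if a then 1 else -1

theorem norm_coinSign (a : Bool) : ‖coinSign a‖ = 1 := by
  cases a <;> simp [coinSign]

theorem measurable_coinSign : Measurable coinSign := measurable_of_finite _

instance : IsProbabilityMeasure (coin.map coinSign) :=
  Measure.isProbabilityMeasure_map measurable_coinSign.aemeasurable

theorem integral_coin {G : Type*} [NormedAddCommGroup G] [NormedSpace ℝ G] (f : Bool → G)
    [CompleteSpace G] : ∫ a, f a ∂coin = (2 : ℝ)⁻¹ • (f true + f false) := by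
  have hi : ∀ P : Measure Bool, IsFiniteMeasure P → Integrable f P := fun P _ => Integrable.of_finite
  rw [coin, integral_smul_measure, integral_add_measure (hi _ inferInstance) (hi _ inferInstance),
    integral_dirac, integral_dirac]
  simp

theorem memLp_coinSign : MemLp id 4 (coin.map coinSign) := by
  rw [memLp_map_measure_iff aestronglyMeasurable_id measurable_coinSign.aemeasurable]
  exact MemLp.of_bound measurable_coinSign.aestronglyMeasurable 1
    (Filter.Eventually.of_forall fun a => (norm_coinSign a).le)

theorem integral_id_coinSign : ∫ t, t ∂(coin.map coinSign) = 0 := by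
  rw [integral_map (f := fun t => t) measurable_coinSign.aemeasurable
    measurable_id.aestronglyMeasurable, integral_coin]
  simp [coinSign]

theorem integral_norm_pow_coinSign (p : ℕ) : ∫ t, ‖t‖ ^ p ∂(coin.map coinSign) = 1 := by
  rw [integral_map (f := fun t => ‖t‖ ^ p) measurable_coinSign.aemeasurable
    (Measurable.aestronglyMeasurable (by fun_prop))]
  simp only [norm_coinSign, one_pow, integral_const, probReal_univ, one_smul]

end Signs

/-! ### The expected spectral measure of the sign model -/

section SpectralMeasure

variable {ι : Type*} [Fintype ι] [DecidableEq ι]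
variable {adj : ι → ι → Prop} [DecidableRel adj] {c : ℕ}

/-- The sum of the eigenvalues is bounded when all entries are bounded by one. -/
theorem sum_eigenvalues_maskedMatrix_le (hc : 0 < c) (hmask : RegularMask adj c) (z : ℂ)
    {x : ι × ι → ℂ} (hx : ∀ p, ‖x p‖ ≤ 1) :
    ∑ i, (Matrix.isHermitian_mul_conjTranspose_self (maskedMatrix adj c z x)).eigenvalues i
      ≤ Fintype.card ι * (2 * (1 + ‖z‖ ^ 2)) := by
  set B := maskedMatrix adj c z x with hB
  have hc' : (0 : ℝ) < c := by exact_mod_cast hc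
  have h1 := (Matrix.isHermitian_mul_conjTranspose_self B).trace_eq_sum_eigenvalues
  have h2 : (B * Bᴴ).trace = ((∑ i, ∑ j, ‖B i j‖ ^ 2 : ℝ) : ℂ) := by
    rw [Matrix.trace]
    push_cast
    refine Finset.sum_congr rfl fun i _ => ?_
    rw [Matrix.diag_apply, Matrix.mul_apply]
    refine Finset.sum_congr rfl fun j _ => ?_
    rw [Matrix.conjTranspose_apply, RCLike.star_def, Complex.mul_conj']
  rw [h2] at h1
  have h3 : (∑ i, ∑ j, ‖B i j‖ ^ 2 : ℝ)
      = ∑ i, (Matrix.isHermitian_mul_conjTranspose_self B).eigenvalues i := by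
    apply Complex.ofReal_injective
    rw [h1]
    push_cast
    rfl
  rw [← h3]
  have h4 : ∀ i j, ‖B i j‖ ^ 2 ≤ 2 * ((if adj i j then (c : ℝ)⁻¹ else 0)
      + if i = j then ‖z‖ ^ 2 else 0) := by
    intro i j
    have e1 : ‖B i j‖ ≤ ‖(if adj i j then ((Real.sqrt c : ℝ) : ℂ)⁻¹ * x (i, j) else 0)‖
        + ‖if i = j then z else 0‖ := norm_sub_le _ _
    have e2 : ‖(if adj i j then ((Real.sqrt c : ℝ) : ℂ)⁻¹ * x (i, j) else 0)‖ ^ 2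
        ≤ if adj i j then (c : ℝ)⁻¹ else 0 := by
      split_ifs
      · rw [norm_mul, mul_pow, norm_inv, Complex.norm_real, Real.norm_eq_abs, inv_pow, sq_abs,
          Real.sq_sqrt hc'.le]
        have := pow_le_one₀ (n := 2) (norm_nonneg _) (hx (i, j))
        have h0 : 0 < (c : ℝ)⁻¹ := by positivity
        nlinarith
      · simp
    have e3 : ‖if i = j then z else 0‖ ^ 2 = if i = j then ‖z‖ ^ 2 else 0 := by
      split_ifs <;> simp
    have e4 : ‖B i j‖ ^ 2 ≤ (‖(if adj i j then ((Real.sqrt c : ℝ) : ℂ)⁻¹ * x (i, j) else 0)‖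
        + ‖if i = j then z else 0‖) ^ 2 := by gcongr
    rw [← e3]
    nlinarith [sq_nonneg (‖(if adj i j then ((Real.sqrt c : ℝ) : ℂ)⁻¹ * x (i, j) else 0)‖
        - ‖if i = j then z else 0‖)]
  refine (Finset.sum_le_sum fun i _ => Finset.sum_le_sum fun j _ => h4 i j).trans_eq ?_
  simp only [← Finset.mul_sum, Finset.sum_add_distrib, Finset.sum_ite_eq, Finset.mem_univ, if_true]
  have h5 : ∀ i, ∑ j, (if adj i j then (c : ℝ)⁻¹ else 0) = 1 := fun i => by
    rw [← Finset.sum_filter, Finset.sum_const, hmask.row i, nsmul_eq_mul, mul_inv_cancel₀ hc'.ne']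
  simp only [h5, Finset.sum_const, Finset.card_univ, nsmul_eq_mul]
  ring

open scoped ComplexOrder in
/-- The expected spectral measure of the model with random signs. -/
theorem exists_expected_spectral_measure (hc : 0 < c) (hmask : RegularMask adj c) (z : ℂ) (k : ι) :
    ∃ ν : Measure ℝ, IsProbabilityMeasure ν ∧ ν (Set.Iio 0) = 0 ∧
      ∫⁻ x, ENNReal.ofReal |x| ∂ν ≤ ENNReal.ofReal (2 * (1 + ‖z‖ ^ 2)) ∧
      ∀ w : ℂ, 0 < w.im → w * stieltjes ν (w ^ 2)
        = ∫ x, maskedGreen adj c z w x (Sum.inl k) (Sum.inl k)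
          ∂(Measure.pi fun _ : ι × ι => coin.map coinSign) := by
  have hne : Nonempty ι := ⟨k⟩
  set ρ : Measure (ι × ι → Bool) := Measure.pi fun _ => coin with hρ
  set sg : (ι × ι → Bool) → ι × ι → ℂ := fun a p => coinSign (a p) with hsg
  set l : ι → (ι × ι → Bool) → ℝ := fun i a =>
    (Matrix.isHermitian_mul_conjTranspose_self (maskedMatrix adj c z (sg a))).eigenvalues i with hl
  -- There are finitely many sign arrays, so measurability and integrability of eigenvalues are
  -- automatic.
  have hlm : ∀ i, Measurable (l i) := fun i => measurable_of_finite _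
  have hl0 : ∀ i a, 0 ≤ l i a := fun i a =>
    (Matrix.posSemidef_self_mul_conjTranspose _).eigenvalues_nonneg i
  have hsum : ∀ a, ∑ i, l i a ≤ Fintype.card ι * (2 * (1 + ‖z‖ ^ 2)) := fun a =>
    sum_eigenvalues_maskedMatrix_le hc hmask z fun p => (norm_coinSign _).le
  obtain ⟨ν, hν, hν1, hν2⟩ := exists_mean_measure ρ hlm
  have hn0 : (Fintype.card ι : ENNReal) ≠ 0 := by simp
  refine ⟨ν, hν, ?_, ?_, ?_⟩
  · have h1 := hν1 (Set.indicator (Set.Iio 0) 1) (measurable_one.indicator measurableSet_Iio)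
    rw [lintegral_indicator_one measurableSet_Iio] at h1
    rw [h1]
    have : ∀ i a, Set.indicator (Set.Iio (0 : ℝ)) (1 : ℝ → ENNReal) (l i a) = 0 := fun i a =>
      Set.indicator_of_notMem (by simpa using hl0 i a) _
    simp [this]
  · rw [hν1 _ (by fun_prop), ← lintegral_finsetSum _ (fun i _ => by
      exact ENNReal.measurable_ofReal.comp ((hlm i).abs))]
    have h1 : ∀ a, ∑ i, ENNReal.ofReal |l i a|
        ≤ ENNReal.ofReal (Fintype.card ι * (2 * (1 + ‖z‖ ^ 2))) := by
      intro a
      simp only [abs_of_nonneg (hl0 _ a)]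
      rw [← ENNReal.ofReal_sum_of_nonneg fun i _ => hl0 i a]
      exact ENNReal.ofReal_le_ofReal (hsum a)
    calc _ ≤ (Fintype.card ι : ENNReal)⁻¹ * ∫⁻ _a : ι × ι → Bool,
          ENNReal.ofReal (Fintype.card ι * (2 * (1 + ‖z‖ ^ 2))) ∂ρ := by
          gcongr with a
          exact h1 a
      _ = _ := by
          rw [lintegral_const, measure_univ, mul_one, ENNReal.ofReal_mul (by positivity),
            ENNReal.ofReal_natCast, ← mul_assoc, ENNReal.inv_mul_cancel hn0 (by simp), one_mul]
  · intro w hw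
    have hpi : Measure.pi (fun _ : ι × ι => coin.map coinSign) = ρ.map sg :=
      (Measure.pi_map_pi fun _ => measurable_coinSign.aemeasurable).symm
    have hsgm : Measurable sg := measurable_of_finite _
    have h1 : stieltjes ν (w ^ 2)
        = ∫ a, empiricalStieltjes (maskedMatrix adj c z (sg a)) (w ^ 2) ∂ρ := by
      rw [stieltjes, hν2 _ (measurable_inv_sub _) fun i => Integrable.of_finite]
      simp only [empiricalStieltjes]
      rw [integral_const_mul, integral_finsetSum _ fun i _ => Integrable.of_finite]
    rw [h1, ← integral_const_mul]
    simp only [empiricalStieltjes_sq_eq _ hw]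
    rw [integral_const_mul, integral_finsetSum _ fun i _ => Integrable.of_finite]
    have h2 : ∀ i, ∫ a, green (hermitization (maskedMatrix adj c z (sg a))) w (Sum.inl i) (Sum.inl i) ∂ρ
        = ∫ x, maskedGreen adj c z w x (Sum.inl k) (Sum.inl k)
          ∂(Measure.pi fun _ : ι × ι => coin.map coinSign) := by
      intro i
      rw [← (integral_maskedGreen_eq (μ := coin.map coinSign) hmask hw i k).1, hpi,
        integral_map hsgm.aemeasurable
          (continuous_maskedGreen hw _ _).measurable.aestronglyMeasurable]
      rfl
    simp only [h2, Finset.sum_const, Finset.card_univ, nsmul_eq_mul]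
    rw [inv_mul_cancel_left₀]
    simp

end SpectralMeasure

/-! ### The limiting measure as a weak limit point -/

section Limit

open Filter Topology

/-- Probability measures with bounded first absolute moments have a weak limit point. -/
theorem exists_ultrafilter_tendsto {κ : ℕ → ProbabilityMeasure ℝ} {K : ENNReal} (hK : K ≠ ⊤)
    (h : ∀ N, ∫⁻ x, ENNReal.ofReal |x| ∂(κ N : Measure ℝ) ≤ K) :
    ∃ (U : Ultrafilter ℕ) (ν : ProbabilityMeasure ℝ), (U : Filter ℕ) ≤ atTop ∧
      Tendsto κ U (𝓝 ν) := by
  have htight : IsTightMeasureSet {x : Measure ℝ | ∃ μ ∈ Set.range κ, (μ : Measure ℝ) = x} := by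
    refine isTightMeasureSet_of_tendsto_measure_norm_gt ?_
    -- Markov's inequality bounds the mass outside [-r, r] by K / r.
    have hlim : Tendsto (fun r : ℝ => K / ENNReal.ofReal r) atTop (𝓝 0) := by
      have := ENNReal.Tendsto.const_div (a := K) ENNReal.tendsto_ofReal_atTop (Or.inr hK)
      simpa using this
    refine tendsto_of_tendsto_of_tendsto_of_le_of_le' tendsto_const_nhds hlim
      (Eventually.of_forall fun _ => zero_le) ?_
    filter_upwards [eventually_gt_atTop 0] with r hr
    refine iSup₂_le ?_
    rintro _ ⟨_, ⟨N, rfl⟩, rfl⟩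
    have h1 := meas_ge_le_lintegral_div (μ := (κ N : Measure ℝ))
      (f := fun x => ENNReal.ofReal |x|) (by fun_prop) (ε := ENNReal.ofReal r)
      (by simpa using hr) ENNReal.ofReal_ne_top
    refine le_trans (measure_mono ?_) (h1.trans (ENNReal.div_le_div_right (h N) _))
    intro x hx
    exact ENNReal.ofReal_le_ofReal (le_of_lt hx)
  have hcomp := isCompact_closure_of_isTightMeasureSet htight
  obtain ⟨ν, -, hν⟩ := hcomp.ultrafilter_le_nhds ((hyperfilter ℕ).map κ) (by
    rw [Ultrafilter.coe_map, le_principal_iff, mem_map]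
    exact univ_mem' fun N => subset_closure ⟨N, rfl⟩)
  exact ⟨hyperfilter ℕ, ν, by rw [← Nat.cofinite_eq_atTop]; exact hyperfilter_le_cofinite, hν⟩

theorem measure_Iio_eq_zero_of_tendsto {κ : ℕ → ProbabilityMeasure ℝ} {ν : ProbabilityMeasure ℝ}
    {U : Filter ℕ} [U.NeBot] (h : Tendsto κ U (𝓝 ν))
    (h0 : ∀ N, (κ N : Measure ℝ) (Set.Iio 0) = 0) : (ν : Measure ℝ) (Set.Iio 0) = 0 := by
  have := ProbabilityMeasure.le_liminf_measure_open_of_tendsto h (isOpen_Iio (a := (0 : ℝ)))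
  simpa [h0] using this

theorem tendsto_stieltjes_sq {κ : ℕ → ProbabilityMeasure ℝ} {ν : ProbabilityMeasure ℝ}
    {U : Filter ℕ} [U.NeBot] (h : Tendsto κ U (𝓝 ν))
    (h0 : ∀ N, (κ N : Measure ℝ) (Set.Iio 0) = 0) {w : ℂ} (hw : 0 < w.im) :
    Tendsto (fun N => stieltjes (κ N : Measure ℝ) (w ^ 2)) U
      (𝓝 (stieltjes (ν : Measure ℝ) (w ^ 2))) := by
  have hne : ∀ x : ℝ, ((|x| : ℝ) : ℂ) - w ^ 2 ≠ 0 := fun x =>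
    norm_pos_iff.mp (lt_of_lt_of_le (by positivity) (sq_im_le_norm_sub_sq hw (abs_nonneg x)))
  -- Replacing x by |x| makes the kernel bounded and continuous on the whole line without changing
  -- it on the support of the measures.
  let f : BoundedContinuousFunction ℝ ℂ := BoundedContinuousFunction.ofNormedAddCommGroup
    (fun x : ℝ => (((|x| : ℝ) : ℂ) - w ^ 2)⁻¹)
    (Continuous.inv₀ (by fun_prop) hne) (w.im ^ 2)⁻¹ fun x => by
      rw [norm_inv]
      exact inv_anti₀ (by positivity) (sq_im_le_norm_sub_sq hw (abs_nonneg x))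
  have hf : ∀ {ρ : Measure ℝ}, ρ (Set.Iio 0) = 0 → ∫ x, f x ∂ρ = stieltjes ρ (w ^ 2) := by
    intro ρ hρ
    refine integral_congr_ae ?_
    filter_upwards [ae_nonneg_of_measure_Iio hρ] with x hx
    simp [f, abs_of_nonneg hx]
  have := (ProbabilityMeasure.tendsto_iff_forall_integral_rclike_tendsto ℂ).mp h f
  rw [hf (measure_Iio_eq_zero_of_tendsto h h0)] at this
  simpa only [hf (h0 _)] using this

/-- The limiting spectral measure, as a limit point of expected spectral measures. -/
theorem exists_limit_spectral_measure (z : ℂ) :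
    ∃ ν : Measure ℝ, IsProbabilityMeasure ν ∧ ν (Set.Iio 0) = 0 ∧
      ∀ w : ℂ, 0 < w.im →
        w * stieltjes ν (w ^ 2) = fixMap z w (w * stieltjes ν (w ^ 2)) := by
  -- With m = 3 every block is filled, so n = c = 3(N + 1) and n / c² = 1 / (3(N + 1)) tends to 0.
  have hex := fun N : ℕ => exists_expected_spectral_measure (c := 3 * (N + 1)) (by positivity)
    (regularMask_blockAdj (m := 3) (b := N + 1) le_rfl) z (0, 0)
  choose κ hκ hκ0 hκ1 hκ2 using hex
  obtain ⟨U, ν, hU, hν⟩ := exists_ultrafilter_tendsto (κ := fun N => ⟨κ N, hκ N⟩)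
    ENNReal.ofReal_ne_top hκ1
  have hν0 := measure_Iio_eq_zero_of_tendsto hν hκ0
  refine ⟨ν, inferInstance, hν0, fun w hw => ?_⟩
  set s : ℕ → ℂ := fun N => w * stieltjes (κ N) (w ^ 2) with hs
  have hlim : Tendsto s U (𝓝 (w * stieltjes ν (w ^ 2))) :=
    (tendsto_stieltjes_sq hν hκ0 hw).const_mul w
  set t := w * stieltjes ν (w ^ 2) with ht
  have ht0 : 0 < t.im := im_mul_stieltjes_sq_pos hν0 hw
  have hu : 0 < (w + t).im := by rw [Complex.add_im]; positivity
  have hcont : Tendsto (fun N => ‖s N - fixMap z w (s N)‖) U (𝓝 ‖t - fixMap z w t‖) := by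
    refine (hlim.sub ?_).norm
    exact ((hlim.const_add w).neg).div ((((hlim.const_add w).pow 2)).sub_const _)
      (sq_sub_norm_sq_ne_zero hu z)
  set Z : ℕ → ℝ := fun N => 12600 * (1 + 1 / w.im ^ 2) * (1 / (3 * ((N : ℝ) + 1))) with hZ
  have hZlim : Tendsto Z atTop (𝓝 0) := by
    have : Tendsto (fun N : ℕ => 12600 * (1 + 1 / w.im ^ 2) * (1 / 3) * (1 / ((N : ℝ) + 1)))
        atTop (𝓝 (12600 * (1 + 1 / w.im ^ 2) * (1 / 3) * 0)) :=
      tendsto_one_div_add_atTop_nhds_zero_nat.const_mul _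
    rw [mul_zero] at this
    refine this.congr fun N => ?_
    simp only [hZ]
    field_simp
  have hFlim : Tendsto (fun N => √(Z N) + Z N / w.im) atTop (𝓝 0) := by
    have := (hZlim.sqrt).add (hZlim.div_const w.im)
    simpa using this
  have hZ0 : ∀ N, 0 ≤ Z N := fun N => by positivity
  have hle : ∀ᶠ N in (U : Filter ℕ), ‖s N - fixMap z w (s N)‖ ≤ √(Z N) + Z N / w.im := by
    -- The factor `rowSq` can be discarded once the error is at most Im w, which holds eventually.
    filter_upwards [hU (hFlim.eventually (ge_mem_nhds hw))] with N hN
    have : IsProbabilityMeasure (κ N) := hκ N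
    refine norm_sub_fixMap_le_of_approx hw (im_mul_stieltjes_sq_pos (hκ0 N) hw)
      (by have := hZ0 N; positivity) ?_ hN
    refine norm_integral_maskedGreen_sub_fixMap_le memLp_coinSign integral_id_coinSign
      (integral_norm_pow_coinSign 2) hw (c := 3 * (N + 1)) (by positivity)
      (regularMask_blockAdj (m := 3) (b := N + 1) le_rfl) (0, 0) (hκ2 N w hw) ?_
    rw [integral_norm_pow_coinSign]
    simp only [hZ, Fintype.card_prod, ZMod.card, Fintype.card_fin]
    push_cast
    field_simp
  have h0 : ‖t - fixMap z w t‖ ≤ 0 := le_of_tendsto_of_tendsto hcont (hFlim.mono_left hU) hle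
  exact sub_eq_zero.mp (norm_le_zero_iff.mp h0)

end Limit

/-! ### Square roots in the upper half plane -/

section FixedPoint

theorem exists_sq_eq_of_notMem {ζ : ℂ} (hζ : ¬(ζ.im = 0 ∧ 0 ≤ ζ.re)) :
    ∃ w : ℂ, 0 < w.im ∧ w ^ 2 = ζ := by
  obtain ⟨w, hw⟩ := IsAlgClosed.exists_pow_nat_eq ζ (n := 2) (by norm_num)
  rcases lt_trichotomy w.im 0 with h | h | h
  · exact ⟨-w, by simpa using h, by rw [neg_sq, hw]⟩
  · refine absurd ⟨?_, ?_⟩ hζ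
    · rw [← hw, pow_two, Complex.mul_im, h]; ring
    · rw [← hw, pow_two, Complex.mul_re, h, mul_zero, sub_zero]; exact mul_self_nonneg _
  · exact ⟨w, h, hw⟩

end FixedPoint

/-! ### Moments of the empirical Stieltjes transform of a masked matrix -/

section MomentBound

theorem norm_empiricalStieltjes_le {ι : Type*} [Fintype ι] [DecidableEq ι] (B : Matrix ι ι ℂ)
    {ζ : ℂ} (hζ : 0 < ζ.im) : ‖empiricalStieltjes B ζ‖ ≤ 1 / ζ.im := by
  rw [empiricalStieltjes, norm_mul, norm_inv, Complex.norm_natCast]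
  rcases Nat.eq_zero_or_pos (Fintype.card ι) with h | h
  · rw [h, Nat.cast_zero, inv_zero, zero_mul]; positivity
  rw [inv_mul_le_iff₀ (by exact_mod_cast h)]
  refine (norm_sum_le_of_le _ fun i _ => norm_inv_sub_le_inv_im hζ _).trans_eq ?_
  rw [Finset.sum_const, Finset.card_univ, nsmul_eq_mul]

theorem im_sq_le_two_mul (w : ℂ) (hw : 0 < w.im) : (w ^ 2).im ≤ 2 * (w.im * ‖w‖) := by
  have h1 := Complex.re_le_norm w
  rw [pow_two, Complex.mul_im]
  nlinarith

variable {ι : Type*} [Fintype ι] [DecidableEq ι]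
variable {adj : ι → ι → Prop} [DecidableRel adj] {c : ℕ} {z w : ℂ}

theorem empiricalStieltjes_maskedMatrix (hw : 0 < w.im) (x : ι × ι → ℂ) :
    empiricalStieltjes (maskedMatrix adj c z x) (w ^ 2)
      = ∑ i, (w * Fintype.card ι)⁻¹ * maskedGreen adj c z w x (Sum.inl i) (Sum.inl i) := by
  have hw0 : w ≠ 0 := fun h => by simp [h] at hw
  rw [← mul_right_inj' hw0, empiricalStieltjes_sq_eq _ hw, ← Finset.mul_sum, mul_inv]
  simp only [maskedGreen]
  field_simp

theorem continuous_empiricalStieltjes_maskedMatrix (hw : 0 < w.im) :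
    Continuous fun x => empiricalStieltjes (maskedMatrix adj c z x) (w ^ 2) := by
  simp only [empiricalStieltjes_maskedMatrix hw]
  exact continuous_finsetSum _ fun i _ => (continuous_maskedGreen hw _ _).const_mul _

variable {μ : Measure ℂ} [IsProbabilityMeasure μ]

/-- Moments of the distance of the empirical Stieltjes transform to a solution of the fixed-point
equation. -/
theorem integral_norm_empiricalStieltjes_sub_le [Nonempty ι] (h4 : MemLp id 4 μ)
    (h1 : ∫ t, t ∂μ = 0) (h2 : ∫ t, ‖t‖ ^ 2 ∂μ = 1) (hw : 0 < w.im) (hc : 0 < c)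
    (hmask : RegularMask adj c) (hfix : ∀ w : ℂ, 0 < w.im → ∃ t : ℂ, 0 < t.im ∧ t = fixMap z w t)
    {τ : ℂ} (ht : 0 < (w * τ).im) (htfix : w * τ = fixMap z w (w * τ))
    (hτ : ‖τ‖ ≤ 1 / (w ^ 2).im) {A : ℝ} (hA : 1 < A) (hre : |(w ^ 2).re| < A)
    (him : 0 < (w ^ 2).im) (him1 : (w ^ 2).im < 1) (p : ℕ) :
    ∫ x, ‖empiricalStieltjes (maskedMatrix adj c z x) (w ^ 2) - τ‖ ^ (2 * p)
        ∂(Measure.pi fun _ : ι × ι => μ)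
      ≤ 2 ^ (2 * p) * (8 * 2 ^ p * (2 * p).factorial *
          (64 / (Fintype.card ι * (w ^ 2).im ^ 2)) ^ p
        + (17920 ^ 2 * A * ((∫ t, ‖t‖ ^ 4 ∂μ) * Fintype.card ι / (c : ℝ) ^ 2)
          / (w ^ 2).im ^ 4) ^ p) := by
  obtain ⟨k⟩ := ‹Nonempty ι›
  have hne : Nonempty ι := ⟨k⟩
  have hw0 : w ≠ 0 := fun h => by simp [h] at hw
  have hwn : 0 < ‖w‖ := norm_pos_iff.mpr hw0
  have hn : 0 < (Fintype.card ι : ℝ) := by exact_mod_cast Fintype.card_pos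
  have hc' : (0 : ℝ) < c := by exact_mod_cast hc
  set η := (w ^ 2).im with hη
  set ρ : Measure (ι × ι → ℂ) := Measure.pi fun _ => μ with hρ
  set M : (ι × ι → ℂ) → ℂ := fun x => empiricalStieltjes (maskedMatrix adj c z x) (w ^ 2) with hM
  set s := ∫ x, maskedGreen adj c z w x (Sum.inl k) (Sum.inl k) ∂ρ with hs
  set a : ℂ := (w * Fintype.card ι)⁻¹ with ha
  have hMcont : Continuous M := continuous_empiricalStieltjes_maskedMatrix hw
  have hMle : ∀ x, ‖M x‖ ≤ 1 / η := fun x => norm_empiricalStieltjes_le _ him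
  have hMsum : ∀ x, M x = ∑ i, a * maskedGreen adj c z w x (Sum.inl i) (Sum.inl i) :=
    fun x => empiricalStieltjes_maskedMatrix hw x
  have hmean : ∑ i, a * ∫ y, maskedGreen adj c z w y (Sum.inl i) (Sum.inl i) ∂ρ = w⁻¹ * s := by
    have : ∀ i, ∫ y, maskedGreen adj c z w y (Sum.inl i) (Sum.inl i) ∂ρ = s := fun i =>
      (integral_maskedGreen_eq hmask hw i k).1
    simp only [this, Finset.sum_const, Finset.card_univ, nsmul_eq_mul, ha]
    have : (Fintype.card ι : ℂ) ≠ 0 := by simp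
    field_simp
  have hMint : ∫ x, M x ∂ρ = w⁻¹ * s := by
    rw [← hmean]
    simp only [hMsum]
    rw [integral_finsetSum _ fun i _ => (integrable_maskedGreen hw _ _).const_mul _]
    simp only [integral_const_mul, hρ]
  -- The quotient s / w is the mean of the empirical transform, which is bounded by 1 / η pathwise.
  have hs1 : ‖s‖ / ‖w‖ ≤ 1 / η := by
    have := norm_integral_le_of_norm_le_const (μ := ρ) (Filter.Eventually.of_forall hMle)
    rw [hMint, norm_mul, norm_inv, probReal_univ, mul_one] at this
    rwa [div_eq_inv_mul]
  have hω := one_le_fourth_moment h4 h2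
  set Q := (∫ t, ‖t‖ ^ 4 ∂μ) * Fintype.card ι / (c : ℝ) ^ 2 with hQ
  have hQ0 : 0 < Q := by positivity
  have hdist := norm_sub_div_le h4 h1 h2 hw hc hmask k hfix hs ht htfix (Real.sqrt_pos.mpr hQ0)
    (Real.sq_sqrt hQ0.le) hA hre him him1 hs1 (by rwa [norm_mul, mul_div_cancel_left₀ _ hwn.ne'])
  have hdist' : ‖w⁻¹ * s - τ‖ ^ (2 * p) ≤ (17920 ^ 2 * A * Q / η ^ 4) ^ p := by
    have e : w⁻¹ * s - τ = (s - w * τ) / w := by field_simp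
    rw [e, norm_div, pow_mul]
    refine pow_le_pow_left₀ (by positivity) ?_ p
    refine (pow_le_pow_left₀ (by positivity) hdist 2).trans_eq ?_
    rw [div_pow, mul_pow, mul_pow, Real.sq_sqrt (by linarith), Real.sq_sqrt hQ0.le]
    ring
  have han : ‖a‖ = 1 / (‖w‖ * Fintype.card ι) := by
    rw [ha, norm_inv, norm_mul, Complex.norm_natCast, one_div]
  have hconc := integral_norm_pow_sum_maskedGreen_le (adj := adj) (c := c) (z := z) (μ := μ) hw
    (Sum.inl_injective (β := ι)) (fun _ => a) (α := 1 / (‖w‖ * Fintype.card ι)) (by positivity)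
    (fun _ => han.le) p
  rw [← hρ, hmean] at hconc
  simp only [← hMsum] at hconc
  -- With weights 1 / (n |w|) the variance is 16 / (n |w|² (Im w)²), and η ≤ 2 |w| Im w turns 16
  -- into 64.
  have hvar : (Fintype.card ι : ℝ) * (4 * (1 / (‖w‖ * Fintype.card ι)) / w.im) ^ 2
      ≤ 64 / (Fintype.card ι * η ^ 2) := by
    have h5 : η ≤ 2 * (w.im * ‖w‖) := im_sq_le_two_mul w hw
    have e : (Fintype.card ι : ℝ) * (4 * (1 / (‖w‖ * Fintype.card ι)) / w.im) ^ 2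
        = 64 / (Fintype.card ι * (2 * (w.im * ‖w‖)) ^ 2) := by
      field_simp
      norm_num
    rw [e]
    gcongr
  have hpow : (Fintype.card ι * (4 * (1 / (‖w‖ * Fintype.card ι)) / w.im) ^ 2) ^ p
      ≤ (64 / (Fintype.card ι * η ^ 2)) ^ p := pow_le_pow_left₀ (by positivity) hvar p
  have hi1 : Integrable (fun x => ‖M x - w⁻¹ * s‖ ^ (2 * p)) ρ := by
    refine integrable_of_bounded (M := (1 / η + ‖w⁻¹ * s‖) ^ (2 * p))
      ((((hMcont.sub continuous_const).norm).pow _).aestronglyMeasurable) fun x => ?_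
    rw [norm_pow, norm_norm]
    exact pow_le_pow_left₀ (norm_nonneg _)
      ((norm_sub_le _ _).trans (add_le_add_left (hMle x) _)) _
  calc ∫ x, ‖M x - τ‖ ^ (2 * p) ∂ρ
      ≤ ∫ x, 2 ^ (2 * p) * (‖M x - w⁻¹ * s‖ ^ (2 * p) + ‖w⁻¹ * s - τ‖ ^ (2 * p)) ∂ρ := by
        refine integral_mono_of_nonneg (Filter.Eventually.of_forall fun x => by positivity)
          ((hi1.add (integrable_const _)).const_mul _) (Filter.Eventually.of_forall fun x => ?_)
        refine le_trans (pow_le_pow_left₀ (norm_nonneg _) ?_ _)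
          (add_pow_le_two_pow_mul (norm_nonneg (M x - w⁻¹ * s)) (norm_nonneg (w⁻¹ * s - τ)) _)
        exact norm_sub_le_norm_sub_add_norm_sub _ _ _
    _ = 2 ^ (2 * p) * (∫ x, ‖M x - w⁻¹ * s‖ ^ (2 * p) ∂ρ + ‖w⁻¹ * s - τ‖ ^ (2 * p)) := by
        rw [integral_const_mul, integral_add hi1 (integrable_const _), integral_const,
          probReal_univ, one_smul]
    _ ≤ _ := by
        gcongr
        exact hconc.trans (by gcongr)

end MomentBound

/-! ### Jensen's inequality for the moments of the atom variable -/

section Jensen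

theorem integral_norm_pow_four_pow_le {Ω : Type*} [MeasurableSpace Ω] {P : Measure Ω}
    [IsProbabilityMeasure P] {ξ : Ω → ℂ} {p : ℕ} (hp : 1 ≤ p)
    (h : MemLp ξ ((4 * p : ℕ) : ENNReal) P) :
    (∫ x, ‖ξ x‖ ^ 4 ∂P) ^ p ≤ ∫ x, ‖ξ x‖ ^ (4 * p) ∂P := by
  have h4 : MemLp ξ ((4 : ℕ) : ENNReal) P := h.mono_exponent (by exact_mod_cast (by omega : 4 ≤ 4 * p))
  have hi4 : Integrable (fun x => ‖ξ x‖ ^ 4) P := h4.integrable_norm_pow (by norm_num)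
  have hip : Integrable (fun x => (‖ξ x‖ ^ 4) ^ p) P := by
    simp only [← pow_mul]
    exact h.integrable_norm_pow (by omega)
  have := (convexOn_pow (𝕜 := ℝ) p).map_integral_le (μ := P) (f := fun x => ‖ξ x‖ ^ 4)
    (continuous_pow p).continuousOn isClosed_Ici
    (Filter.Eventually.of_forall fun x => by simp only [Set.mem_Ici]; positivity) hi4 hip
  simpa only [← pow_mul] using this

end Jensen

/-- The constant of the moment bound. -/
noncomputable def momentConstant (p : ℕ) : ℝ :=
  2 ^ (2 * p) * (8 * 2 ^ p * (2 * p).factorial * 576 ^ p + (17920 ^ 2) ^ p)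

theorem momentConstant_pos (p : ℕ) : 0 < momentConstant p := by
  unfold momentConstant
  positivity

/-- The fluctuation term 1 / n is absorbed into the bias term: c ≤ 3n gives 1 / n ≤ 9 n / c², and
576 = 9 · 64. The nonnegative `r` stands for the term c^(-p/2), which is simply added. -/
theorem moment_bound_arithmetic {p : ℕ} {A n c η ω W r : ℝ} (hA : 1 < A) (hn : 0 < n) (hc : 0 < c)
    (hcn : c ≤ 3 * n) (hη : 0 < η) (hη1 : η < 1) (_hω0 : 0 ≤ ω) (hω : ω ^ p ≤ W) (hW : 1 ≤ W)
    (hr : 0 ≤ r) :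
    2 ^ (2 * p) * (8 * 2 ^ p * (2 * p).factorial * (64 / (n * η ^ 2)) ^ p
        + (17920 ^ 2 * A * (ω * n / c ^ 2) / η ^ 4) ^ p)
      ≤ momentConstant p * A ^ p * W / |η| ^ (8 * p) * ((n / c ^ 2) ^ p + r) := by
  have hAp : 1 ≤ A ^ p := one_le_pow₀ hA.le
  have hq : 0 < n / c ^ 2 := by positivity
  set q := n / c ^ 2 with hq'
  have hnq : 64 / n ≤ 576 * q := by
    rw [hq', div_le_iff₀ hn, ← mul_div_assoc, div_mul_eq_mul_div, le_div_iff₀ (by positivity)]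
    nlinarith
  have hη2 : (1 : ℝ) / η ^ 2 ≤ 1 / η ^ 8 := by
    apply one_div_le_one_div_of_le (by positivity)
    exact pow_le_pow_of_le_one hη.le hη1.le (by norm_num)
  have hη4 : (1 : ℝ) / η ^ 4 ≤ 1 / η ^ 8 := by
    apply one_div_le_one_div_of_le (by positivity)
    exact pow_le_pow_of_le_one hη.le hη1.le (by norm_num)
  have e1 : (64 / (n * η ^ 2)) ^ p ≤ 576 ^ p * (A ^ p * W * (q ^ p * (1 / η ^ 8) ^ p)) := by
    have h1 : (64 / (n * η ^ 2)) ^ p ≤ 576 ^ p * (q ^ p * (1 / η ^ 8) ^ p) := by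
      rw [← mul_pow, ← mul_pow]
      refine pow_le_pow_left₀ (by positivity) ?_ p
      calc 64 / (n * η ^ 2) = 64 / n * (1 / η ^ 2) := by field_simp
        _ ≤ 576 * q * (1 / η ^ 8) := by gcongr
        _ = _ := by ring
    exact h1.trans (mul_le_mul_of_nonneg_left (le_mul_of_one_le_left (by positivity)
      (one_le_mul_of_one_le_of_one_le hAp hW)) (by positivity))
  have e2 : (17920 ^ 2 * A * (ω * n / c ^ 2) / η ^ 4) ^ p
      ≤ (17920 ^ 2) ^ p * (A ^ p * W * (q ^ p * (1 / η ^ 8) ^ p)) := by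
    calc (17920 ^ 2 * A * (ω * n / c ^ 2) / η ^ 4) ^ p
        = (17920 ^ 2) ^ p * (A ^ p * ω ^ p * (q ^ p * (1 / η ^ 4) ^ p)) := by
          rw [← mul_pow, ← mul_pow, ← mul_pow, ← mul_pow, hq']
          congr 1
          ring
      _ ≤ _ := by gcongr
  have hη8 : (1 / η ^ 8) ^ p = 1 / |η| ^ (8 * p) := by
    rw [abs_of_pos hη, div_pow, one_pow, pow_mul]
  calc _ ≤ 2 ^ (2 * p) * (8 * 2 ^ p * (2 * p).factorial
          * (576 ^ p * (A ^ p * W * (q ^ p * (1 / η ^ 8) ^ p)))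
        + (17920 ^ 2) ^ p * (A ^ p * W * (q ^ p * (1 / η ^ 8) ^ p))) := by gcongr
    _ = momentConstant p * A ^ p * W / |η| ^ (8 * p) * q ^ p := by
        rw [hη8, momentConstant]
        ring
    _ ≤ _ := by
        have := (momentConstant_pos p).le
        gcongr
        linarith

/-! ### Transfer to periodic block band matrices -/

section Model

theorem continuous_extend {X Y R : Type*} [TopologicalSpace R] [Zero R] (g : X → Y) :
    Continuous fun x : X → R => Function.extend g x 0 := by
  classical
  refine continuous_pi fun y => ?_
  simp only [Function.extend_def]
  split_ifs
  · exact continuous_apply _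
  · exact continuous_const

variable {Ω₀ Ω : Type*} [MeasurableSpace Ω₀] [MeasurableSpace Ω] {m b : ℕ} [NeZero m]

omit [NeZero m] in
-- The mask ignores positions outside the band, so filling them with zeros makes band statistics
-- continuous functions of the band entries; this supplies their measurability.
theorem maskedMatrix_extend (hm : 3 ≤ m) (z : ℂ) (x : BandPart × ZMod m × Fin b × Fin b → ℂ) :
    maskedMatrix (blockAdj m b) (3 * b) z (Function.extend blockPosition x 0)
      = shiftedScaled (periodicBlockBand fun s j => Matrix.of fun a d => x (s, j, a, d)) z := by
  rw [← shiftedScaled_periodicBlockBand hm]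
  simp only [(blockPosition_injective hm).extend_apply]

theorem IsPeriodicBlockBand.moment_bound (hm : 3 ≤ m) (hb : 1 ≤ b) {P₀ : Measure Ω₀}
    [IsProbabilityMeasure P₀] {P : Measure Ω} [IsProbabilityMeasure P] {ξ : Ω₀ → ℂ}
    {Xt : Ω → Matrix (ZMod m × Fin b) (ZMod m × Fin b) ℂ} {p : ℕ} (hp : 1 ≤ p)
    (hξ : MemLp ξ ((4 * p : ℕ) : ENNReal) P₀) (h1 : ∫ x, ξ x ∂P₀ = 0)
    (h2 : ∫ x, ‖ξ x‖ ^ 2 ∂P₀ = 1) (hX : IsPeriodicBlockBand ξ P₀ Xt P) {z : ℂ} {ν : Measure ℝ}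
    [IsProbabilityMeasure ν] (hν0 : ν (Set.Iio 0) = 0)
    (hν : ∀ w : ℂ, 0 < w.im → w * stieltjes ν (w ^ 2) = fixMap z w (w * stieltjes ν (w ^ 2)))
    {A : ℝ} (hA : 1 < A) {w : ℂ} (hw : 0 < w.im) (hre : |(w ^ 2).re| < A)
    (him : 0 < (w ^ 2).im) (him1 : (w ^ 2).im < 1) :
    Integrable (fun ω => ‖empiricalStieltjes (shiftedScaled (Xt ω) z) (w ^ 2)
        - stieltjes ν (w ^ 2)‖ ^ (2 * p)) P ∧
      ∫ ω, ‖empiricalStieltjes (shiftedScaled (Xt ω) z) (w ^ 2)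
          - stieltjes ν (w ^ 2)‖ ^ (2 * p) ∂P
        ≤ momentConstant p * A ^ p * (∫ x, ‖ξ x‖ ^ (4 * p) ∂P₀) / |(w ^ 2).im| ^ (8 * p) *
          (((m * b : ℝ) / (3 * b : ℝ) ^ 2) ^ p + 1 / (3 * b : ℝ) ^ ((p : ℝ) / 2)) := by
  have hξm : AEMeasurable ξ P₀ := hξ.1.aemeasurable
  have hne : Nonempty (ZMod m × Fin b) := ⟨(0, ⟨0, hb⟩)⟩
  set μ := P₀.map ξ with hμ
  have : IsProbabilityMeasure μ := Measure.isProbabilityMeasure_map hξm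
  have hμ4 : MemLp id 4 μ := by
    rw [memLp_map_measure_iff aestronglyMeasurable_id hξm]
    exact hξ.mono_exponent (by exact_mod_cast (by omega : 4 ≤ 4 * p))
  have hμ1 : ∫ t, t ∂μ = 0 := by
    rw [hμ, integral_map (f := fun t => t) hξm measurable_id.aestronglyMeasurable, h1]
  have hμn : ∀ k : ℕ, ∫ t, ‖t‖ ^ k ∂μ = ∫ x, ‖ξ x‖ ^ k ∂P₀ := fun k => by
    rw [hμ, integral_map (f := fun t => ‖t‖ ^ k) hξm
      (Measurable.aestronglyMeasurable (by fun_prop))]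
  have hμ2 : ∫ t, ‖t‖ ^ 2 ∂μ = 1 := by rw [hμn, h2]
  have hτ : ‖stieltjes ν (w ^ 2)‖ ≤ 1 / (w ^ 2).im := norm_stieltjes_le him
  have hmb : (0 : ℝ) < m ∧ (0 : ℝ) < b :=
    ⟨by exact_mod_cast (by omega : 0 < m), by exact_mod_cast hb⟩
  obtain ⟨hmeas, hint⟩ := hX.integral_eq hm hξm z
    (fun B => ‖empiricalStieltjes B (w ^ 2) - stieltjes ν (w ^ 2)‖ ^ (2 * p)) (by
      refine Continuous.stronglyMeasurable ?_
      simp only [← maskedMatrix_extend hm]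
      exact (((continuous_empiricalStieltjes_maskedMatrix hw).comp
        (continuous_extend blockPosition)).sub continuous_const).norm.pow _)
  refine ⟨integrable_of_bounded (M := (1 / (w ^ 2).im + 1 / (w ^ 2).im) ^ (2 * p)) hmeas
    fun ω => ?_, ?_⟩
  · rw [norm_pow, norm_norm]
    exact pow_le_pow_left₀ (norm_nonneg _)
      ((norm_sub_le _ _).trans (add_le_add (norm_empiricalStieltjes_le _ him) hτ)) _
  · rw [hint]
    -- Solvability of the fixed point equation at every height, needed for the comparison between
    -- heights, comes from ν itself.
    refine (integral_norm_empiricalStieltjes_sub_le hμ4 hμ1 hμ2 hw (by omega)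
      (regularMask_blockAdj hm) (fun w hw => ⟨_, im_mul_stieltjes_sq_pos hν0 hw, hν w hw⟩)
      (im_mul_stieltjes_sq_pos hν0 hw) (hν w hw) hτ hA hre him him1 p).trans ?_
    have hJ := integral_norm_pow_four_pow_le hp hξ
    have hω := one_le_fourth_moment hμ4 hμ2
    rw [hμn] at hω
    rw [hμn]
    have hcard : (Fintype.card (ZMod m × Fin b) : ℝ) = m * b := by simp [ZMod.card]
    rw [hcard]
    push_cast
    refine moment_bound_arithmetic hA (by have := hmb.1; have := hmb.2; positivity)
      (by have := hmb.2; positivity) ?_ him him1 (by linarith) hJ ((one_le_pow₀ hω).trans hJ)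
      (by positivity)
    have : (3 : ℝ) ≤ m := by exact_mod_cast hm
    have := hmb.2
    nlinarith

end Model

theorem theorem3p1 :
    ∃ C : ℕ → ℝ, (∀ p, 0 < C p) ∧
      ∀ z : ℂ, ∃ ν : Measure ℝ, IsProbabilityMeasure ν ∧ ν (Set.Iio 0) = 0 ∧
        -- the moment bound; here `n = m b` and `c_n = 3 b`
        (∀ (m b : ℕ) [NeZero m], 3 ≤ m → 1 ≤ b →
          ∀ {Ω₀ Ω : Type*} [MeasurableSpace Ω₀] [MeasurableSpace Ω]
            (P₀ : Measure Ω₀) [IsProbabilityMeasure P₀] (P : Measure Ω) [IsProbabilityMeasure P]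
            (ξ : Ω₀ → ℂ) (Xt : Ω → Matrix (ZMod m × Fin b) (ZMod m × Fin b) ℂ) (p : ℕ),
            1 ≤ p → MemLp ξ ((4 * p : ℕ) : ENNReal) P₀ →
            ∫ x, ξ x ∂P₀ = 0 → ∫ x, ‖ξ x‖ ^ 2 ∂P₀ = 1 →
            IsPeriodicBlockBand ξ P₀ Xt P →
            ∀ A : ℝ, 1 < A → ∀ ζ : ℂ, -A < ζ.re → ζ.re < A → 0 < ζ.im → ζ.im < 1 →
              Integrable (fun ω =>
                ‖empiricalStieltjes (shiftedScaled (Xt ω) z) ζ - stieltjes ν ζ‖ ^ (2 * p)) P ∧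
              ∫ ω, ‖empiricalStieltjes (shiftedScaled (Xt ω) z) ζ - stieltjes ν ζ‖ ^ (2 * p) ∂P
                ≤ C p * A ^ p * (∫ x, ‖ξ x‖ ^ (4 * p) ∂P₀) / |ζ.im| ^ (8 * p) *
                  (((m * b : ℝ) / (3 * b : ℝ) ^ 2) ^ p
                    + 1 / (3 * b : ℝ) ^ ((p : ℝ) / 2))) ∧
        -- the Stieltjes transform of `ν` solves the equation off `[0, ∞)`
        (∀ ζ : ℂ, ¬ (ζ.im = 0 ∧ 0 ≤ ζ.re) → SolvesFixedPoint z ζ (stieltjes ν ζ)) ∧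
        (∀ ζ : ℂ, 0 < ζ.im → 0 < (ζ * stieltjes ν (ζ ^ 2)).im ∧ 0 < (stieltjes ν ζ).im) ∧
        -- uniqueness, point by point; `ζ ^ 2` runs through the complement of `[0, ∞)`
        (∀ ζ : ℂ, 0 < ζ.im → ∀ w : ℂ, SolvesFixedPoint z (ζ ^ 2) w → 0 < (ζ * w).im →
          w = stieltjes ν (ζ ^ 2)) := by
  refine ⟨momentConstant, momentConstant_pos, fun z => ?_⟩
  -- The measure is fixed before m, b, ξ and p appear, so it depends on z alone.
  obtain ⟨ν, hν, hν0, hνfix⟩ := exists_limit_spectral_measure z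
  refine ⟨ν, hν, hν0, ?_, ?_, ?_, ?_⟩
  · intro m b _ hm hb Ω₀ Ω _ _ P₀ _ P _ ξ Xt p hp hξ h1 h2 hX A hA ζ hre hre' him him1
    obtain ⟨w, hw, rfl⟩ := exists_sq_eq_of_notMem (ζ := ζ) fun h => him.ne' h.1
    exact hX.moment_bound hm hb hp hξ h1 h2 hν0 hνfix hA hw (abs_lt.mpr ⟨hre, hre'⟩) him him1
  · intro ζ hζ
    obtain ⟨w, hw, rfl⟩ := exists_sq_eq_of_notMem hζ
    exact (solvesFixedPoint_iff hw (im_mul_stieltjes_sq_pos hν0 hw)).mpr (hνfix w hw)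
  · exact fun ζ hζ => ⟨im_mul_stieltjes_sq_pos hν0 hζ, im_stieltjes_pos hζ⟩
  · intro ζ hζ w hw hpos
    have hζ0 : ζ ≠ 0 := fun h => by simp [h] at hζ
    exact mul_left_cancel₀ hζ0 (fixed_unique hζ hpos (im_mul_stieltjes_sq_pos hν0 hζ)
      ((solvesFixedPoint_iff hζ hpos).mp hw) (hνfix ζ hζ))
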